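/- All rings are commutative. Let $A$ be a ring and let $\varpi\in A$ be a non-zero-divisor and a non-unit. A prime ideal $\mathfrak p$ of $A$ is a weakly associated prime of $\varpi$ if it is minimal over $((\varpi):f)$ for some $f\in A$. The ring $A$ is called strongly $\varpi$-Krull if for every weakly associated prime $\mathfrak p$ of $\varpi$ the local ring $A_{\mathfrak p}$ is a $\varpi$-adically separated valuation ring of rank one, and strongly $\varpi$-Shilov if for every such $\mathfrak p$ the $\varpi$-adic completion of $A_{\mathfrak p}$ is a valuation ring of rank one. The ring $A[\varpi^{-1}]$ carries the ring topology for which the subsets $\varpi^nA$, $n\ge 0$, form a basis of neighbourhoods of $0$; it is a Tate ring with topologically nilpotent unit $\varpi$. Let $\mathcal A$ be a Tate ring with topologically nilpotent unit $\varpi$ and let $\mathcal A^\circ$ be its subring of power-bounded elements; $\mathcal A$ is called uniform if $\mathcal A^\circ$ is bounded. The Berkovich spectrum $\mathcal M(\mathcal A)$ (relative to $\varpi$) is the set of multiplicative ring seminorms on $\mathcal A$ that are bounded with respect to a nonarchimedean ring seminorm $\|\cdot\|$ which defines the topology of $\mathcal A$ and satisfies $\|\varpi\|=\tfrac12$ and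 $\|\varpi f\|=\|\varpi\|\,\|f\|$ for all $f$ (the choice of $\|\cdot\|$ is irrelevant), with the topology of pointwise convergence. A subset $S\subseteq\mathcal M(\mathcal A)$ is a boundary if for every $f\in\mathcal A$ the function $\phi\mapsto\phi(f)$ on $\mathcal M(\mathcal A)$ attains its maximum at a point of $S$; the Shilov boundary is the smallest closed boundary. Let $\operatorname{Spa}(\mathcal A,\mathcal A^\circ)$ be the set of equivalence classes of continuous valuations $v$ on $\mathcal A$ with $v\le 1$ on $\mathcal A^\circ$, let $\operatorname{sp}(v)=\{f\in\mathcal A^\circ : v(f)<1\}$, and identify $\mathcal M(\mathcal A)$ with the set of rank-one points of $\operatorname{Spa}(\mathcal A,\mathcal A^\circ)$. Let $G$ be the set of generic points of the irreducible components of $\operatorname{Spf}(\mathcal A^\circ)=\operatorname{Spec}(\mathcal A^\circ/\varpi\mathcal A^\circ)$, i.e. the set of prime ideals of $\mathcal A^\circ$ minimal over $\varpi$. Then $\mathcal A$ satisfies Berkovich's description of the Shilov boundary if for every $\mathfrak p\in G$ the fibre $\operatorname{sp}^{-1}(\{\mathfrak p\})$ consists of exactly one point, which is of rank one, and the closure of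 $\operatorname{sp}^{-1}(G)$ in $\mathcal M(\mathcal A)$ is the Shilov boundary; it does so in the strong sense if, moreover, $\operatorname{sp}^{-1}(G)$ itself is the Shilov boundary. **Corollary.** Let $R$ be a Noetherian domain and let $\varpi\in R$ be a non-zero non-unit. Let $R^+$ be the absolute integral closure of $R$, i.e. the integral closure of $R$ in an algebraic closure of its field of fractions, and let $\widehat{R^+}$ be its $\varpi$-adic completion. Then $R^+$ is strongly $\varpi$-Krull and $\widehat{R^+}$ is strongly $\varpi$-Shilov. Consequently, $\widehat{R^+}[\varpi^{-1}]$ is a uniform Tate ring with topologically nilpotent unit $\varpi$ which satisfies Berkovich's description of the Shilov boundary in the strong sense. -/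

import Mathlib

open scoped Topology Pointwise

noncomputable section

namespace Shilov

section CommutativeAlgebra

/-- The absolute integral closure `R⁺` of a domain `R`: the integral closure of `R` in an algebraic
closure of its field of fractions. -/
abbrev AbsoluteIntegralClosure (R : Type*) [CommRing R] [IsDomain R] : Type _ :=
  integralClosure R (AlgebraicClosure (FractionRing R))

/-- The `ϖ`-adic completion `lim A / ϖⁿA` of `A`. -/
abbrev Completion (A : Type*) [CommRing A] (ϖ : A) : Type _ :=
  AdicCompletion (Ideal.span {ϖ}) A

/-- The `ϖ`-adic completion of the absolute integral closure `R⁺` of `R`. -/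
abbrev CompletedAbsoluteIntegralClosure (R : Type*) [CommRing R] [IsDomain R] (ϖ : R) : Type _ :=
  Completion (AbsoluteIntegralClosure R) (algebraMap R (AbsoluteIntegralClosure R) ϖ)

/-- `V` is a valuation ring of rank one. (The rank of a valuation ring is its Krull dimension.) -/
def IsRankOneValuationRing (V : Type*) [CommRing V] : Prop :=
  ∃ _ : IsDomain V, ValuationRing V ∧ ringKrullDim V = 1

/-- `p` is a weakly associated prime ideal of `ϖ`: it is minimal over `((ϖ) : f)` for some `f`. -/
def IsWeaklyAssociatedPrime {A : Type*} [CommRing A] (ϖ : A) (p : Ideal A) : Prop :=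
  ∃ f : A, p ∈ ((Ideal.span {ϖ}).colon {f} : Ideal A).minimalPrimes

/-- `A` is strongly `ϖ`-Shilov. -/
structure IsStronglyShilov (A : Type*) [CommRing A] (ϖ : A) : Prop where
  mem_nonZeroDivisors : ϖ ∈ nonZeroDivisors A
  not_isUnit : ¬ IsUnit ϖ
  isRankOneValuationRing : ∀ (p : Ideal A) [p.IsPrime], IsWeaklyAssociatedPrime ϖ p →
    IsRankOneValuationRing
      (Completion (Localization.AtPrime p) (algebraMap A (Localization.AtPrime p) ϖ))

/-- `A` is strongly `ϖ`-Krull. -/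
structure IsStronglyKrull (A : Type*) [CommRing A] (ϖ : A) : Prop where
  mem_nonZeroDivisors : ϖ ∈ nonZeroDivisors A
  not_isUnit : ¬ IsUnit ϖ
  isRankOneValuationRing : ∀ (p : Ideal A) [p.IsPrime], IsWeaklyAssociatedPrime ϖ p →
    IsRankOneValuationRing (Localization.AtPrime p)
  isHausdorff : ∀ (p : Ideal A) [p.IsPrime], IsWeaklyAssociatedPrime ϖ p →
    IsHausdorff (Ideal.span {algebraMap A (Localization.AtPrime p) ϖ}) (Localization.AtPrime p)

end CommutativeAlgebra

section Localization

/-- The ring `A[ϖ⁻¹]`; it is given below the topology with pair of definition `(A, ϖ)`. -/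
def Loc (A : Type*) [CommRing A] (ϖ : A) : Type _ := Localization.Away ϖ

variable (A : Type*) [CommRing A] (ϖ : A)

instance : CommRing (Loc A ϖ) := inferInstanceAs (CommRing (Localization.Away ϖ))

instance : Algebra A (Loc A ϖ) := inferInstanceAs (Algebra A (Localization.Away ϖ))

instance : IsLocalization.Away ϖ (Loc A ϖ) :=
  inferInstanceAs (IsLocalization.Away ϖ (Localization.Away ϖ))

/-- The unit of `A[ϖ⁻¹]` given by `ϖ`. -/
def Loc.unif : Loc A ϖ := algebraMap A (Loc A ϖ) ϖ

/-- The image of `ϖⁿA` in `A[ϖ⁻¹]`. -/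
def Loc.powSubmodule (n : ℕ) : Submodule A (Loc A ϖ) :=
  Submodule.span A {algebraMap A (Loc A ϖ) (ϖ ^ n)}

theorem Loc.mem_powSubmodule {n : ℕ} {x : Loc A ϖ} :
    x ∈ Loc.powSubmodule A ϖ n ↔ ∃ a : A, algebraMap A (Loc A ϖ) (a * ϖ ^ n) = x := by
  simp [Loc.powSubmodule, Submodule.mem_span_singleton, Algebra.smul_def]

theorem Loc.powSubmodule_anti {m n : ℕ} (h : m ≤ n) :
    Loc.powSubmodule A ϖ n ≤ Loc.powSubmodule A ϖ m := by
  intro x hx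
  obtain ⟨a, rfl⟩ := (Loc.mem_powSubmodule A ϖ).1 hx
  refine (Loc.mem_powSubmodule A ϖ).2 ⟨a * ϖ ^ (n - m), ?_⟩
  rw [mul_assoc, ← pow_add, Nat.sub_add_cancel h]

theorem Loc.submodulesRingBasis : SubmodulesRingBasis (Loc.powSubmodule A ϖ) where
  inter i j := ⟨max i j, le_inf (Loc.powSubmodule_anti A ϖ (le_max_left i j))
    (Loc.powSubmodule_anti A ϖ (le_max_right i j))⟩
  leftMul a i := by
    obtain ⟨⟨b, ⟨_, k, rfl⟩⟩, hb⟩ := IsLocalization.surj (Submonoid.powers ϖ) a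
    refine ⟨i + k, ?_⟩
    rintro _ ⟨x, hx, rfl⟩
    obtain ⟨c, rfl⟩ := (Loc.mem_powSubmodule A ϖ).1 hx
    refine (Loc.mem_powSubmodule A ϖ).2 ⟨b * c, ?_⟩
    change _ = a * _
    have hb' : a * algebraMap A (Loc A ϖ) (ϖ ^ k) = algebraMap A (Loc A ϖ) b := hb
    simp only [map_mul, ← hb', pow_add]
    ring
  mul i := by
    refine ⟨i, ?_⟩
    rintro _ ⟨x, hx, y, hy, rfl⟩
    obtain ⟨c, rfl⟩ := (Loc.mem_powSubmodule A ϖ).1 hx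
    obtain ⟨d, rfl⟩ := (Loc.mem_powSubmodule A ϖ).1 hy
    refine (Loc.mem_powSubmodule A ϖ).2 ⟨c * d * ϖ ^ i, ?_⟩
    simp only [map_mul]
    ring

/-- The ring topology on `A[ϖ⁻¹]` for which the images of the ideals `ϖⁿA`, `n ≥ 0`, form a basis
of neighbourhoods of zero. -/
instance : TopologicalSpace (Loc A ϖ) := (Loc.submodulesRingBasis A ϖ).topology

instance : NonarchimedeanRing (Loc A ϖ) :=
  (Loc.submodulesRingBasis A ϖ).toRing_subgroups_basis.nonarchimedean

end Localization

section TopologicalRings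

variable (𝒜 : Type*) [CommRing 𝒜] [TopologicalSpace 𝒜]

/-- `𝒜` is a Tate ring with topologically nilpotent unit `ϖ`: it has an open subring `𝒜₀` whose
topology is adic for a finitely generated ideal, and `ϖ` is a topologically nilpotent unit. -/
structure IsTateRing [IsTopologicalRing 𝒜] (ϖ : 𝒜) : Prop where
  exists_ringOfDefinition : ∃ 𝒜₀ : Subring 𝒜, IsOpen (𝒜₀ : Set 𝒜) ∧
    ∃ I : Ideal 𝒜₀, I.FG ∧ IsAdic I
  isUnit : IsUnit ϖ
  isTopologicallyNilpotent : IsTopologicallyNilpotent ϖ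

variable {𝒜}

/-- Bounded subsets of a topological ring. -/
def IsBounded (S : Set 𝒜) : Prop :=
  ∀ U ∈ 𝓝 (0 : 𝒜), ∃ V ∈ 𝓝 (0 : 𝒜), ∀ v ∈ V, ∀ s ∈ S, v * s ∈ U

/-- Power-bounded elements of a topological ring. -/
def IsPowerBounded (a : 𝒜) : Prop := IsBounded (Set.range fun n : ℕ => a ^ n)

theorem IsBounded.mono {S T : Set 𝒜} (hT : IsBounded T) (h : S ⊆ T) : IsBounded S := by
  intro U hU
  obtain ⟨V, hV, H⟩ := hT U hU
  exact ⟨V, hV, fun v hv s hs => H v hv s (h hs)⟩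

theorem IsBounded.mul {S T : Set 𝒜} (hS : IsBounded S) (hT : IsBounded T) :
    IsBounded (S * T) := by
  intro U hU
  obtain ⟨V, hV, H⟩ := hT U hU
  obtain ⟨W, hW, H'⟩ := hS V hV
  refine ⟨W, hW, ?_⟩
  rintro w hw _ ⟨s, hs, t, ht, rfl⟩
  have := H _ (H' w hw s hs) t ht
  rwa [mul_assoc] at this

theorem isBounded_singleton [IsTopologicalRing 𝒜] (a : 𝒜) : IsBounded {a} := by
  intro U hU
  have h : Filter.Tendsto (fun v : 𝒜 => v * a) (𝓝 0) (𝓝 0) := by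
    simpa using (continuous_mul_const a).tendsto (0 : 𝒜)
  refine ⟨_, h hU, ?_⟩
  rintro v hv s rfl
  exact hv

theorem IsBounded.closure [NonarchimedeanRing 𝒜] {S : Set 𝒜} (hS : IsBounded S) :
    IsBounded (AddSubgroup.closure S : Set 𝒜) := by
  intro U hU
  obtain ⟨W, hW⟩ := NonarchimedeanRing.is_nonarchimedean U hU
  obtain ⟨V, hV, H⟩ := hS W W.mem_nhds_zero
  refine ⟨V, hV, fun v hv s hs => hW ?_⟩
  have : AddSubgroup.closure S ≤ (W : AddSubgroup 𝒜).comap (AddMonoidHom.mulLeft v) :=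
    (AddSubgroup.closure_le _).2 fun s hs => H v hv s hs
  exact this hs

variable (𝒜) [NonarchimedeanRing 𝒜]

/-- The subring `𝒜°` of power-bounded elements. -/
def powerBounded : Subring 𝒜 where
  carrier := {a | IsPowerBounded a}
  one_mem' := (isBounded_singleton (1 : 𝒜)).mono (by rintro _ ⟨n, rfl⟩; simp)
  zero_mem' := ((isBounded_singleton (1 : 𝒜)).closure).mono (by
    rintro _ ⟨n, rfl⟩
    rcases n with _ | n
    · simp
    · simp)
  mul_mem' {a b} ha hb := (IsBounded.mul ha hb).mono (by
    rintro _ ⟨n, rfl⟩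
    exact ⟨a ^ n, ⟨n, rfl⟩, b ^ n, ⟨n, rfl⟩, (mul_pow a b n).symm⟩)
  add_mem' {a b} ha hb := ((IsBounded.mul ha hb).closure).mono (by
    rintro _ ⟨n, rfl⟩
    simp only [add_pow]
    refine AddSubgroup.sum_mem _ fun i _ => ?_
    rw [mul_comm _ ((n.choose i : ℕ) : 𝒜), ← nsmul_eq_mul]
    exact AddSubgroup.nsmul_mem _ (AddSubgroup.subset_closure
      (Set.mul_mem_mul (Set.mem_range_self i) (Set.mem_range_self (n - i)))) _)
  neg_mem' {a} ha := (IsBounded.closure ha).mono (by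
    rintro _ ⟨n, rfl⟩
    have h : a ^ n ∈ AddSubgroup.closure (Set.range fun n : ℕ => a ^ n) :=
      AddSubgroup.subset_closure ⟨n, rfl⟩
    rcases n.even_or_odd with h' | h'
    · simpa [h'.neg_pow] using h
    · simpa [h'.neg_pow] using h)

/-- A uniform ring: `𝒜°` is bounded. -/
def IsUniform : Prop := IsBounded (powerBounded 𝒜 : Set 𝒜)

variable {𝒜}

/-- The equivalence class of valuations `v` on `𝒜` is continuous: `{f | v f < γ}` is open for every
non-zero `γ` in its value group. -/
def IsContinuous (v : ValuativeRel 𝒜) : Prop :=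
  letI := v
  ∀ γ : ValuativeRel.ValueGroupWithZero 𝒜, γ ≠ 0 →
    IsOpen {f : 𝒜 | ValuativeRel.valuation 𝒜 f < γ}

/-- The equivalence class of valuations `v` has rank one: its value group is non-trivial and embeds
into the positive real numbers. -/
def IsRankOne (v : ValuativeRel 𝒜) : Prop :=
  letI := v
  ValuativeRel.IsNontrivial 𝒜 ∧ ValuativeRel.IsRankLeOne 𝒜

variable (𝒜)

/-- The adic spectrum `Spa(𝒜, 𝒜°)`: equivalence classes of continuous valuations which are `≤ 1` on
`𝒜°`. An equivalence class of valuations `v` is encoded by the relation `v f ≤ v g`. -/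
def Spa : Type _ := {v : ValuativeRel 𝒜 // IsContinuous v ∧ ∀ f ∈ powerBounded 𝒜, v.vle f 1}

variable {𝒜}

/-- The specialization map on `Spa(𝒜, 𝒜°)`, sending `v` to `{f ∈ 𝒜° | v f < 1}`. -/
def Spa.spc (x : Spa 𝒜) : Ideal (powerBounded 𝒜) :=
  letI := x.1
  { carrier := {f | ValuativeRel.valuation 𝒜 (f : 𝒜) < 1}
    zero_mem' := by simp
    add_mem' := fun {f g} hf hg => by
      simpa using (ValuativeRel.valuation 𝒜).map_add_lt hf hg
    smul_mem' := fun c f hf => by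
      have hc : ValuativeRel.valuation 𝒜 (c : 𝒜) ≤ 1 := by
        have h := (Valuation.Compatible.vle_iff_le (v := ValuativeRel.valuation 𝒜) (c : 𝒜) 1).1
          (x.2.2 c c.2)
        simpa using h
      have h : ValuativeRel.valuation 𝒜 (c : 𝒜) * ValuativeRel.valuation 𝒜 (f : 𝒜) < 1 :=
        lt_of_le_of_lt (mul_le_of_le_one_left' hc) hf
      simpa using h }

/-- The generic points of the irreducible components of `Spf(𝒜°) = Spec(𝒜°/ϖ𝒜°)`: the prime ideals
of `𝒜°` minimal over the ideal generated by `ϖ`. -/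
def genericPoints (ϖ : 𝒜) : Set (Ideal (powerBounded 𝒜)) :=
  (Ideal.span ((↑) ⁻¹' ({ϖ} : Set 𝒜) : Set (powerBounded 𝒜))).minimalPrimes

/-- A (nonarchimedean) ring seminorm defining the topology of `𝒜`, with `‖ϖ‖ = 1/2` and
`‖ϖ f‖ = ‖ϖ‖ ‖f‖` for all `f`. -/
structure IsAdmissible (ϖ : 𝒜) (N : RingSeminorm 𝒜) : Prop where
  isNonarchimedean : IsNonarchimedean N
  hasBasis_nhds_zero : (𝓝 (0 : 𝒜)).HasBasis (fun ε : ℝ => 0 < ε) fun ε => {f | N f < ε}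
  map_eq_half : N ϖ = 1 / 2
  map_mul : ∀ f, N (ϖ * f) = N ϖ * N f

/-- The Berkovich spectrum `ℳ(𝒜)` of `𝒜` relative to `ϖ`: the multiplicative ring seminorms which
are bounded with respect to an admissible seminorm (any two admissible seminorms of a Tate ring
bound each other up to constants, so that the choice is irrelevant). -/
def BerkovichSpectrum (ϖ : 𝒜) : Type _ :=
  {φ : MulRingSeminorm 𝒜 //
    ∃ N : RingSeminorm 𝒜, IsAdmissible ϖ N ∧ ∃ C : ℝ, ∀ f, φ f ≤ C * N f}

/-- The topology of pointwise convergence. -/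
instance (ϖ : 𝒜) : TopologicalSpace (BerkovichSpectrum ϖ) :=
  TopologicalSpace.induced (fun φ (f : 𝒜) => φ.1 f) inferInstance

/-- A boundary: every `f`, viewed as the function `φ ↦ φ f` on the Berkovich spectrum, attains its
maximum at a point of `S`. -/
def IsBoundary {ϖ : 𝒜} (S : Set (BerkovichSpectrum ϖ)) : Prop :=
  ∀ f : 𝒜, ∃ φ ∈ S, ∀ ψ : BerkovichSpectrum ϖ, ψ.1 f ≤ φ.1 f

/-- The Shilov boundary: the smallest closed boundary. -/
def IsShilovBoundary {ϖ : 𝒜} (S : Set (BerkovichSpectrum ϖ)) : Prop :=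
  IsLeast {T : Set (BerkovichSpectrum ϖ) | IsClosed T ∧ IsBoundary T} S

/-- The identification of points of the Berkovich spectrum with rank-one points of the adic
spectrum: `φ` is a valuation in the equivalence class `x`. -/
def BerkovichSpectrum.Represents {ϖ : 𝒜} (φ : BerkovichSpectrum ϖ) (x : Spa 𝒜) : Prop :=
  ∀ f g : 𝒜, x.1.vle f g ↔ φ.1 f ≤ φ.1 g

/-- The set of pre-images of generic points under the specialization map, as a subset of the
Berkovich spectrum. -/
def spcPreimageGeneric (ϖ : 𝒜) : Set (BerkovichSpectrum ϖ) :=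
  {φ | ∃ x : Spa 𝒜, φ.Represents x ∧ x.spc ∈ genericPoints ϖ}

/-- Berkovich's description of the Shilov boundary. -/
structure BerkovichDescription (ϖ : 𝒜) : Prop where
  /-- The fibre of the specialization map over every generic point is a single point, of rank
  one. -/
  fibre : ∀ p ∈ genericPoints ϖ, ∃ x : Spa 𝒜, IsRankOne x.1 ∧ {y : Spa 𝒜 | y.spc = p} = {x}
  isShilovBoundary_closure : IsShilovBoundary (closure (spcPreimageGeneric ϖ))

/-- Berkovich's description of the Shilov boundary in the strong sense. -/
structure StrongBerkovichDescription (ϖ : 𝒜) : Prop extends BerkovichDescription ϖ where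
  isShilovBoundary : IsShilovBoundary (spcPreimageGeneric ϖ)

end TopologicalRings

end Shilov

end

noncomputable section

namespace Shilov

/-! ### Minimal primes, Krull's principal ideal theorem and roots of polynomials over normal domains
-/

open Polynomial

/-! The ring `A = R⁺` is a normal domain integral over a Noetherian ring, and the local statements
rest on these two properties. Let `p` be a non-zero prime of `A` lying locally in the radical of `(g
: f)`. Then `f / g` or `g / f` lies in `A_p` (`dvd_or_dvd_of_forall`): otherwise `g / f` generates a
proper ideal, even locally at `p`, of the Noetherian ring `B[g / f]` for some finitely generated `B
⊆ A`, and Krull's principal ideal theorem there yields an equation for `g / f` having a coefficient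
outside `p`. Over a normal domain such an equation forces `g / f` or its inverse into `A_p`
(`exists_smul_mem_of_aeval_eq_zero`). With `g = ϖ`, the ideal `(ϖ : f)` becomes principal at a
weakly associated prime `p`, and Krull's theorem makes `p` minimal over `ϖ`. At a minimal prime any
two elements are comparable and `A_p` is a valuation ring of rank one. All of this passes to the
completion `C` because it depends only on the ring modulo `ϖ` (`IsModIso`).

For `𝒜 = C[ϖ⁻¹]`, each prime `p` minimal over `ϖ` carries a real valuation `w_p`
(`exists_isGenericValuation`). Together these valuations detect divisibility by powers of `ϖ`, so
that `C = 𝒜°` and their supremum is an admissible norm. Every continuous valuation centred at `p` is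
equivalent to `w_p` (`IsGenericValuation.isEquiv`), which describes the fibres of specialization.
Compactness of the Berkovich spectrum places every `w_p` in each closed boundary.

It remains to see that the set of all `w_p` is closed, so that suprema over it are attained. Since
`ϖ` may have infinitely many minimal primes in `R⁺`, this is a genuine finiteness statement. In the
integral closure of `R` in its fraction field there are only finitely many, by a count of lengths
(`finite_minimalPrimes_of_birational`), and minimal primes of `R⁺` contract to them
(`comap_integralClosureMap_mem_minimalPrimes`). Minimality is therefore visible in one Noetherian
ring `B` finite over `R`, and is expressed by finitely many families of closed conditions `|s| ≥ 1`.
-/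

theorem mem_minimalPrimes_iff_forall {A : Type*} [CommRing A] {I p : Ideal A} [hp : p.IsPrime] :
    p ∈ I.minimalPrimes ↔ I ≤ p ∧ ∀ a ∈ p, ∃ s ∉ p, ∃ n : ℕ, s * a ^ n ∈ I := by
  constructor
  · intro h
    refine ⟨h.1.2, fun a ha => ?_⟩
    by_contra! hcon
    obtain ⟨P, hP, hIP, hd⟩ := Ideal.exists_le_prime_disjoint I (p.primeCompl ⊔ Submonoid.powers a) (by
      rw [Set.disjoint_left]
      intro x hx hx'
      obtain ⟨s, hs, _, ⟨n, rfl⟩, rfl⟩ := Submonoid.mem_sup.1 hx'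
      exact hcon s hs n hx)
    rw [Set.disjoint_left] at hd
    have hPp : P ≤ p := fun x hx => by
      by_contra hxp
      exact hd hx (Submonoid.mem_sup_left hxp)
    have := h.2 ⟨hP, hIP⟩ hPp ha
    exact hd this (Submonoid.mem_sup_right (Submonoid.mem_powers a))
  · rintro ⟨hI, H⟩
    refine ⟨⟨hp, hI⟩, fun P hP hPp a ha => ?_⟩
    obtain ⟨s, hs, n, hn⟩ := H a ha
    exact hP.1.mem_of_pow_mem n ((hP.1.mem_or_mem (hP.2 hn)).resolve_left fun h => hs (hPp h))

theorem mem_minimalPrimes_span_iff {A : Type*} [CommRing A] {t : A} {p : Ideal A} [p.IsPrime] :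
    p ∈ (Ideal.span {t}).minimalPrimes ↔ t ∈ p ∧ ∀ a ∈ p, ∃ s ∉ p, ∃ n : ℕ, t ∣ s * a ^ n := by
  simp only [mem_minimalPrimes_iff_forall, Ideal.mem_span_singleton,
    Ideal.span_singleton_le_iff_mem]

theorem isWeaklyAssociatedPrime_iff {A : Type*} [CommRing A] {t : A} {p : Ideal A} [p.IsPrime] :
    IsWeaklyAssociatedPrime t p ↔ ∃ f, (∀ a, t ∣ a * f → a ∈ p) ∧
      ∀ a ∈ p, ∃ s ∉ p, ∃ n : ℕ, t ∣ s * a ^ n * f := by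
  simp only [IsWeaklyAssociatedPrime, mem_minimalPrimes_iff_forall, Ideal.mem_span_singleton,
    Submodule.mem_colon_singleton, SetLike.le_def, smul_eq_mul]

/-- A form of Krull's principal ideal theorem: a domain localised at a minimal prime of `t` becomes
a field after inverting `t`. -/
theorem exists_dvd_mul_pow_of_mem_minimalPrimes {T : Type*} [CommRing T] [IsDomain T]
    [IsNoetherianRing T] {t : T} {P : Ideal T} (hP : P ∈ (Ideal.span {t}).minimalPrimes) {a : T}
    (ha : a ≠ 0) : ∃ s ∉ P, ∃ n : ℕ, a ∣ s * t ^ n := by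
  have hPp : P.IsPrime := hP.1.1
  by_contra! hcon
  obtain ⟨Q, hQ, hIQ, hd⟩ := Ideal.exists_le_prime_disjoint (Ideal.span {a})
    (P.primeCompl ⊔ Submonoid.powers t) (by
      rw [Set.disjoint_left]
      intro x hx hx'
      obtain ⟨s, hs, _, ⟨n, rfl⟩, rfl⟩ := Submonoid.mem_sup.1 hx'
      exact hcon s hs n (Ideal.mem_span_singleton.1 hx))
  rw [Set.disjoint_left] at hd
  have hQP : Q ≤ P := fun x hx => by
    by_contra hxp
    exact hd hx (Submonoid.mem_sup_left hxp)
  have ht : t ∉ Q := fun h => hd h (Submonoid.mem_sup_right (Submonoid.mem_powers t))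
  have htP : t ∈ P := hP.1.2 (Ideal.mem_span_singleton_self t)
  have hlt : Q < P := lt_of_le_of_ne hQP (by rintro rfl; exact ht htP)
  have h1 := Ideal.height_le_one_of_isPrincipal_of_mem_minimalPrimes _ P hP
  have h2 : Q.height < 1 := lt_of_lt_of_le (Ideal.height_strict_mono_of_isPrime_of_isPrime hlt) h1
  rw [Order.lt_one_iff, Ideal.height_eq_zero_iff, IsDomain.minimalPrimes_eq_singleton_bot,
    Set.mem_singleton_iff] at h2
  subst h2
  exact ha (by simpa using hIQ (Ideal.mem_span_singleton_self a))

/-- The product `b` of the leading coefficient `a` with `x` is integral, hence in `A`. If `a ∉ p`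
then `x = b / a` lies in `A_p`; if `b ∉ p` then `x⁻¹ = a / b` does. If both lie in `p`, absorbing
the leading term `a xⁿ = b xⁿ⁻¹` into the next one lowers the degree and keeps some coefficient
outside `p`. -/
theorem exists_smul_mem_of_aeval_eq_zero {A K : Type*} [CommRing A] [IsDomain A]
    [IsIntegrallyClosed A] [Field K] [Algebra A K] [IsFractionRing A K] (p : Ideal A) [p.IsPrime]
    {x : K} (hx : x ≠ 0) (F : A[X]) (hF : aeval x F = 0) (hc : ∃ i, F.coeff i ∉ p) :
    (∃ s ∉ p, ∃ b, algebraMap A K s * x = algebraMap A K b) ∨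
      (∃ s ∉ p, ∃ b, algebraMap A K s * x⁻¹ = algebraMap A K b) := by
  induction hn : F.natDegree using Nat.strong_induction_on generalizing F with
  | _ n ih =>
  obtain ⟨b, hb⟩ := IsIntegrallyClosed.isIntegral_iff.1
    (isIntegral_leadingCoeff_smul F x hF)
  rw [Algebra.smul_def] at hb
  by_cases hl : F.leadingCoeff ∉ p
  · exact .inl ⟨_, hl, b, hb.symm⟩
  push Not at hl
  obtain ⟨i, hi⟩ := hc
  have hin : i < n := by
    refine lt_of_le_of_ne (hn ▸ le_natDegree_of_ne_zero (by rintro h; simp [h] at hi)) ?_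
    rintro rfl
    rw [leadingCoeff, hn] at hl
    exact hi hl
  by_cases hbp : b ∉ p
  · refine .inr ⟨b, hbp, F.leadingCoeff, ?_⟩
    rw [hb, mul_assoc, mul_inv_cancel₀ hx, mul_one]
  push Not at hbp
  obtain ⟨m, rfl⟩ : ∃ m, n = m + 1 := ⟨n - 1, by omega⟩
  have hFe : F = F.eraseLead + monomial (m + 1) F.leadingCoeff := by
    conv_lhs => rw [← F.eraseLead_add_monomial_natDegree_leadingCoeff, hn]
  refine ih (F.eraseLead + monomial m b).natDegree ?_ (F.eraseLead + monomial m b) ?_ ⟨i, ?_⟩ rfl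
  · refine Nat.lt_succ_of_le ((natDegree_add_le _ _).trans (max_le ?_ (natDegree_monomial_le _)))
    have := F.eraseLead_natDegree_le
    omega
  · rw [hFe] at hF
    simp only [map_add, aeval_monomial] at hF ⊢
    rw [← hF, hb, pow_succ']
    ring
  · have h1 : F.coeff i = F.eraseLead.coeff i := by
      rw [eraseLead_coeff_of_ne _ (by omega)]
    rw [coeff_add, ← h1, coeff_monomial]
    intro h
    refine hi ?_
    split_ifs at h with h'
    · exact (Ideal.add_mem_iff_left p hbp).1 h
    · simpa using h

/-! ### Descent to finitely generated subalgebras -/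

section Integral

variable {R A : Type*} [CommRing R] [CommRing A] [Algebra R A]

theorem isNoetherianRing_of_fg [IsNoetherianRing R] {B : Subalgebra R A} (hB : B.FG) :
    IsNoetherianRing B := by
  have : Algebra.FiniteType R B := (Subalgebra.fg_iff_finiteType B).1 hB
  exact Algebra.FiniteType.isNoetherianRing R B

/-- It suffices to adjoin the witnesses for finitely many generators of `p ∩ R`. By incomparability
(`eq_comap_of_le`) these alone pin down primes of `B` below `p`. -/
theorem exists_fg_subalgebra [IsNoetherianRing R] (p : Ideal A) (t f : A)
    (h : ∀ a ∈ p, ∃ s ∉ p, ∃ n : ℕ, t ∣ s * a ^ n * f) (E : Finset A) :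
    ∃ B : Subalgebra R A, B.FG ∧ (E : Set A) ⊆ B ∧ ∃ G : Finset R,
      Ideal.span (G : Set R) = p.comap (algebraMap R A) ∧
      ∀ a ∈ G, ∃ s ∈ B, s ∉ p ∧ ∃ n : ℕ, ∃ b ∈ B, s * algebraMap R A a ^ n * f = t * b := by
  classical
  obtain ⟨G, hG⟩ := IsNoetherian.noetherian (p.comap (algebraMap R A))
  have hmem : ∀ a : G, algebraMap R A a ∈ p := fun a => by
    have : (a : R) ∈ p.comap (algebraMap R A) := hG ▸ Ideal.subset_span a.2
    exact this
  choose s hs n b hb using fun a : G => h _ (hmem a)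
  let E' : Finset A := E ∪ (Finset.univ.image s ∪ Finset.univ.image b)
  have hsub := Algebra.subset_adjoin (R := R) (s := (E' : Set A))
  refine ⟨Algebra.adjoin R E', ⟨E', rfl⟩, fun x hx => hsub (by
    simp only [E', Finset.coe_union]; exact .inl hx), G, hG, fun a ha => ?_⟩
  exact ⟨s ⟨a, ha⟩, hsub (by simp [E']), hs _, n ⟨a, ha⟩, b ⟨a, ha⟩, hsub (by simp [E']), hb ⟨a, ha⟩⟩

theorem eq_comap_of_le [Algebra.IsIntegral R A] {B : Subalgebra R A} {p : Ideal A} [p.IsPrime]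
    {P : Ideal B} [P.IsPrime] (hPp : P ≤ p.comap B.val) {G : Set R}
    (hG : Ideal.span G = p.comap (algebraMap R A)) (hGP : ∀ a ∈ G, algebraMap R B a ∈ P) :
    P = p.comap B.val := by
  have hBi : Algebra.IsIntegral R B := ⟨fun x => by
    have := Algebra.IsIntegral.isIntegral (R := R) (x : A)
    exact (isIntegral_algHom_iff B.val Subtype.val_injective).1 this⟩
  by_contra hne
  have hlt := Ideal.IsIntegral.comap_lt_comap (R := R) (lt_of_le_of_ne hPp hne)
  refine hlt.not_ge fun a (ha : algebraMap R A a ∈ p) => ?_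
  have : p.comap (algebraMap R A) ≤ P.comap (algebraMap R B) := by
    rw [← hG, Ideal.span_le]
    exact hGP
  exact this ha

end Integral

/-! ### Weakly associated primes in normal domains integral over a Noetherian ring -/

section Krull

variable (R : Type*) {A : Type*} [CommRing R] [IsNoetherianRing R] [CommRing A] [Algebra R A]
  [Algebra.IsIntegral R A]

/-- A minimal prime of a non-zero element of a domain integral over a Noetherian ring has a finite
level at which it is a minimal prime. -/
theorem exists_fg_comap_mem_minimalPrimes {t : A} {p : Ideal A}
    (hp : p ∈ (Ideal.span {t}).minimalPrimes) (E : Finset A) :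
    ∃ B : Subalgebra R A, B.FG ∧ (E : Set A) ⊆ B ∧ ∃ ht : t ∈ B,
      p.comap B.val ∈ (Ideal.span {(⟨t, ht⟩ : B)}).minimalPrimes := by
  classical
  have hpp : p.IsPrime := hp.1.1
  obtain ⟨htp, H⟩ := mem_minimalPrimes_span_iff.1 hp
  obtain ⟨B, hB, hE, G, hG, hGB⟩ := exists_fg_subalgebra (R := R) p t 1
    (by simpa using H) (insert t E)
  refine ⟨B, hB, fun x hx => hE (by simp [Finset.mem_coe.1 hx]), hE (by simp), ?_⟩
  refine ⟨⟨inferInstance, ?_⟩, ?_⟩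
  · rw [Ideal.span_singleton_le_iff_mem]
    exact htp
  · rintro P ⟨hP, htP⟩ hPp
    rw [Ideal.span_singleton_le_iff_mem] at htP
    refine (eq_comap_of_le hPp hG fun a ha => ?_).ge
    obtain ⟨s, hs, hsp, n, b, hb, hab⟩ := hGB a ha
    have h1 : (⟨s, hs⟩ : B) * algebraMap R B a ^ n = ⟨t, hE (by simp)⟩ * ⟨b, hb⟩ := by
      ext
      simpa using hab
    have h2 : (⟨s, hs⟩ : B) * algebraMap R B a ^ n ∈ P := h1 ▸ P.mul_mem_right _ htP
    exact hP.mem_of_pow_mem n ((hP.mem_or_mem h2).resolve_left fun h => hsp (hPp h))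

theorem exists_dvd_mul_pow (R : Type*) {A : Type*} [CommRing R] [IsNoetherianRing R] [CommRing A]
    [IsDomain A] [Algebra R A] [Algebra.IsIntegral R A] {t : A} {p : Ideal A} (hp : p ∈ (Ideal.span {t}).minimalPrimes)
    {y : A} (hy : y ≠ 0) : ∃ s ∉ p, ∃ n : ℕ, y ∣ s * t ^ n := by
  obtain ⟨B, hB, hE, ht, hpB⟩ := exists_fg_comap_mem_minimalPrimes R hp {y}
  have := isNoetherianRing_of_fg hB
  have hyB : y ∈ B := hE (by simp)
  obtain ⟨s, hs, n, c, hc⟩ := exists_dvd_mul_pow_of_mem_minimalPrimes hpB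
    (a := (⟨y, hyB⟩ : B)) (by simpa [← Subtype.coe_inj] using hy)
  exact ⟨s, hs, n, c, by simpa using congrArg (Subtype.val) hc⟩

theorem aeval_eq_mul_aeval_divX_add {A B : Type*} [CommRing A] [CommRing B] [Algebra A B] (x : B)
    (F : A[X]) : aeval x F = x * aeval x F.divX + algebraMap A B (F.coeff 0) := by
  conv_lhs => rw [← F.X_mul_divX_add]
  rw [map_add, map_mul, aeval_X, aeval_C]

/-- The key comparison lemma behind the Mori–Nagata theorem. -/
theorem dvd_or_dvd_of_forall (R : Type*) {A : Type*} [CommRing R] [IsNoetherianRing R] [CommRing A]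
    [IsDomain A] [Algebra R A] [Algebra.IsIntegral R A] [IsIntegrallyClosed A] {p : Ideal A} [hpp : p.IsPrime] (hp : p ≠ ⊥)
    {f g : A} (hf : f ≠ 0) (hg : g ≠ 0) (h : ∀ a ∈ p, ∃ s ∉ p, ∃ n : ℕ, g ∣ s * a ^ n * f) :
    (∃ s ∉ p, g ∣ s * f) ∨ ∃ s ∉ p, f ∣ s * g := by
  classical
  by_contra! hcon
  obtain ⟨hx1, hx2⟩ := hcon
  obtain ⟨a, hap, ha0⟩ := Submodule.exists_mem_ne_zero_of_ne_bot hp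
  obtain ⟨B, hB, hE, G, hG, hGB⟩ := exists_fg_subalgebra (R := R) p g f h {a}
  have haB : a ∈ B := hE (by simp)
  have := isNoetherianRing_of_fg hB
  let K := FractionRing A
  let ι := algebraMap A K
  have hι : Function.Injective ι := IsFractionRing.injective A K
  have hιf : ι f ≠ 0 := by simpa [ι] using hf
  have hιg : ι g ≠ 0 := by simpa [ι] using hg
  obtain ⟨t, ht⟩ : ∃ t : K, t * ι f = ι g := ⟨ι g / ι f, div_mul_cancel₀ _ hιf⟩
  have ht0 : t ≠ 0 := by rintro rfl; exact hιg (by rw [← ht, zero_mul])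
  have hdvd₁ : ∀ s b, ι s * t = ι b → f ∣ s * g := fun s b h => ⟨b, hι (by
    rw [map_mul, map_mul, ← h, ← ht]; ring)⟩
  have hdvd₂ : ∀ s b, ι s * t⁻¹ = ι b → g ∣ s * f := fun s b h => ⟨b, hι (by
    have h1 : t * ι f * (ι s * t⁻¹) = ι s * ι f * (t * t⁻¹) := by ring
    rw [map_mul, map_mul, ← h, ← ht, h1, mul_inv_cancel₀ ht0, mul_one])⟩
  let T : Subalgebra B K := Algebra.adjoin B {t}
  have hTN : IsNoetherianRing T := isNoetherianRing_of_fg (R := B) ⟨{t}, by simp [T]⟩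
  let τ : T := ⟨t, Algebra.self_mem_adjoin_singleton B t⟩
  have hrep : ∀ z : T, ∃ F : B[X], aeval t F = (z : K) := fun z => by
    have h : (z : K) ∈ Algebra.adjoin B {t} := z.2
    rw [Algebra.adjoin_singleton_eq_range_aeval] at h
    exact h
  let q : Ideal B := p.comap B.val
  have hBK : ∀ b : B, algebraMap B K b = ι b := fun b => rfl
  -- `t` is not a unit, even after inverting the elements of `B` outside `p`
  have hdisj : Disjoint ((Ideal.span {τ} : Ideal T) : Set T)
      (q.primeCompl.map (algebraMap B T) : Submonoid T) := by
    rw [Set.disjoint_left]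
    rintro _ hz ⟨u, hu, rfl⟩
    obtain ⟨w, hw⟩ := Ideal.mem_span_singleton.1 hz
    obtain ⟨F, hF⟩ := hrep w
    have hw' : ι u = t * aeval t F := by
      rw [hF]
      exact congrArg Subtype.val hw
    -- `u x` is integral
    let F' : A[X] := F.map (algebraMap B A)
    have hF' : aeval t F = aeval t F' := by simp [F', aeval_map_algebraMap]
    have hroot : aeval t (X * F' - C (u : A)) = 0 := by
      rw [map_sub, map_mul, aeval_X, ← hF', ← hw', aeval_C]
      simp [ι]
    rcases exists_smul_mem_of_aeval_eq_zero p ht0 (X * F' - C (u : A)) hroot ⟨0, by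
      rw [coeff_sub, coeff_X_mul_zero, coeff_C_zero, zero_sub, neg_mem_iff]
      exact hu⟩ with ⟨s, hs, b, hb⟩ | ⟨s, hs, b, hb⟩
    · exact hx2 s hs (hdvd₁ s b hb)
    · exact hx1 s hs (hdvd₂ s b hb)
  -- A minimal prime `P` of `t` meeting `B` inside `q`. Dividing `s aⁿ f = g b` by `f` gives `s aⁿ =
  -- t b ∈ P`, which forces `P ∩ B = q`.
  obtain ⟨P₀, hP₀, htP₀, hdP₀⟩ := Ideal.exists_le_prime_disjoint _ _ hdisj
  obtain ⟨P, hP, hPP₀⟩ := Ideal.exists_minimalPrimes_le htP₀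
  have hPp : P.IsPrime := hP.1.1
  have htP : τ ∈ P := hP.1.2 (Ideal.mem_span_singleton_self τ)
  have hle : P.comap (algebraMap B T) ≤ q := fun b hb => by
    by_contra hbq
    exact (Set.disjoint_left.1 hdP₀) (hPP₀ hb) ⟨b, hbq, rfl⟩
  have hPq : P.comap (algebraMap B T) = q := by
    refine eq_comap_of_le hle hG fun a ha => ?_
    obtain ⟨s, hs, hsp, n, b, hb, hab⟩ := hGB a ha
    have h1 : algebraMap B T ((⟨s, hs⟩ : B) * algebraMap R B a ^ n) =
        τ * algebraMap B T ⟨b, hb⟩ := by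
      apply Subtype.ext
      change ι (s * algebraMap R A a ^ n) = t * ι b
      have := congrArg ι hab
      simp only [map_mul, ← ht] at this ⊢
      refine mul_right_cancel₀ hιf ?_
      rw [this]; ring
    have h2 : (⟨s, hs⟩ : B) * algebraMap R B a ^ n ∈ P.comap (algebraMap B T) := by
      rw [Ideal.mem_comap, h1]
      exact P.mul_mem_right _ htP
    exact Ideal.IsPrime.mem_of_pow_mem inferInstance n
      ((Ideal.IsPrime.mem_or_mem inferInstance h2).resolve_left fun h => hsp (hle h))
  -- Krull's theorem in `B[t]`: `s t ^ N = a w` with `s ∉ P`. Writing `s = F(t)` and `w = H(t)`, the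
  -- constant term of `F` avoids `q`, because `t ∈ P`.
  obtain ⟨s, hs, N, w, hw⟩ := exists_dvd_mul_pow_of_mem_minimalPrimes hP
    (a := algebraMap B T ⟨a, haB⟩) (by
      intro h0
      have : ι a = 0 := congrArg Subtype.val h0
      exact ha0 (hι (by simpa using this)))
  obtain ⟨F, hF⟩ := hrep s
  obtain ⟨H, hH⟩ := hrep w
  have hF0 : F.coeff 0 ∉ q := by
    intro h0
    apply hs
    have h1 : s = τ * aeval τ F.divX + algebraMap B T (F.coeff 0) := by
      have h2 : s = aeval τ F := by
        apply Subtype.ext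
        rw [← hF]
        exact (Polynomial.aeval_algHom_apply T.val τ F)
      rw [h2]
      exact aeval_eq_mul_aeval_divX_add τ F
    rw [h1]
    refine P.add_mem (P.mul_mem_right _ htP) ?_
    rw [← hPq] at h0
    exact h0
  -- The coefficient of `X ^ N` is `F(0) - a h_N`. It lies outside `p` since `a ∈ p`, so the root
  -- lemma applies to `t`.
  let Φ : B[X] := X ^ N * F - C ⟨a, haB⟩ * H
  have hΦ : aeval t (Φ.map (algebraMap B A)) = 0 := by
    rw [aeval_map_algebraMap]
    have := congrArg Subtype.val hw
    have h2 : (s : K) * t ^ N = ι a * w := by simpa using this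
    simp only [Φ, map_sub, map_mul, map_pow, aeval_X, aeval_C, hF, hH, hBK]
    rw [← h2]; ring
  rcases exists_smul_mem_of_aeval_eq_zero p ht0 _ hΦ ⟨N, by
    intro hmem
    rw [coeff_map] at hmem
    have h1 : Φ.coeff N ∈ q := hmem
    have h2 : Φ.coeff N = F.coeff 0 - ⟨a, haB⟩ * H.coeff N := by
      simp [Φ, coeff_X_pow_mul']
    rw [h2] at h1
    have h3 : (⟨a, haB⟩ : B) * H.coeff N ∈ q := q.mul_mem_right _ hap
    exact hF0 (by simpa using q.add_mem h1 h3)⟩ with ⟨s, hs, b, hb⟩ | ⟨s, hs, b, hb⟩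
  · exact hx2 s hs (hdvd₁ s b hb)
  · exact hx1 s hs (hdvd₂ s b hb)

/-- Locally at `p`, some power of `ϖ` is a multiple of `y` by Krull's theorem, and some power of `a`
is a multiple of `ϖ` by minimality. -/
theorem exists_dvd_mul_pow_of_mem (R : Type*) {A : Type*} [CommRing R]
    [IsNoetherianRing R] [CommRing A] [IsDomain A] [Algebra R A] [Algebra.IsIntegral R A]
    {ϖ : A} {p : Ideal A}
    (hp : p ∈ (Ideal.span {ϖ}).minimalPrimes) {a y : A} (ha : a ∈ p) (hy : y ≠ 0) :
    ∃ s ∉ p, ∃ n : ℕ, y ∣ s * a ^ n := by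
  have hpp : p.IsPrime := hp.1.1
  obtain ⟨s, hs, n, hn⟩ := exists_dvd_mul_pow R hp hy
  obtain ⟨u, hu, m, hm⟩ := (mem_minimalPrimes_span_iff.1 hp).2 a ha
  refine ⟨s * u ^ n, hpp.mul_notMem hs fun h => hu (hpp.mem_of_pow_mem n h), m * n, ?_⟩
  refine hn.trans ?_
  rw [pow_mul, mul_assoc, ← mul_pow]
  exact mul_dvd_mul_left _ (pow_dvd_pow_of_dvd hm n)

/-- Weakly associated primes of `ϖ` in a normal domain integral over a Noetherian ring are minimal
over `ϖ`. -/
theorem IsWeaklyAssociatedPrime.mem_minimalPrimes (R : Type*) {A : Type*} [CommRing R]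
    [IsNoetherianRing R] [CommRing A] [IsDomain A] [Algebra R A] [Algebra.IsIntegral R A]
    [IsIntegrallyClosed A] {ϖ : A} (hϖ : ϖ ≠ 0) {p : Ideal A} [hpp : p.IsPrime]
    (h : IsWeaklyAssociatedPrime ϖ p) : p ∈ (Ideal.span {ϖ}).minimalPrimes := by
  obtain ⟨f, hf, H⟩ := isWeaklyAssociatedPrime_iff.1 h
  have hϖp : ϖ ∈ p := hf ϖ ⟨f, rfl⟩
  have hp0 : p ≠ ⊥ := by
    rintro rfl
    exact hϖ (by simpa using hϖp)
  have hf0 : f ≠ 0 := by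
    rintro rfl
    exact hpp.ne_top ((Ideal.eq_top_iff_one _).2 (hf 1 (by simp)))
  rcases dvd_or_dvd_of_forall R hp0 hf0 hϖ H with ⟨s, hs, h⟩ | ⟨s, hs, t, ht⟩
  · exact (hs (hf s h)).elim
  -- Here `f t = s ϖ` with `s ∉ p`, so `(ϖ : f)` is generated by `t` locally at `p`. Hence `p` is
  -- minimal over `t`, and Krull's theorem transfers minimality from `t` to `ϖ`.
  have htp : t ∈ p := hf t ⟨s, by rw [mul_comm, ← ht, mul_comm]⟩
  have hpt : p ∈ (Ideal.span {t}).minimalPrimes := by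
    refine mem_minimalPrimes_span_iff.2 ⟨htp, fun a ha => ?_⟩
    obtain ⟨u, hu, n, b, hb⟩ := H a ha
    refine ⟨u * s, hpp.mul_notMem hu hs, n, b, mul_left_cancel₀ (mul_ne_zero hf0 hϖ) ?_⟩
    calc f * ϖ * (u * s * a ^ n) = (u * a ^ n * f) * (s * ϖ) := by ring
      _ = f * ϖ * (t * b) := by rw [hb, ht]; ring
  refine mem_minimalPrimes_span_iff.2 ⟨hϖp, fun a ha => ?_⟩
  exact exists_dvd_mul_pow_of_mem R hpt ha hϖ

theorem dvd_or_dvd_of_mem_minimalPrimes (R : Type*) {A : Type*} [CommRing R]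
    [IsNoetherianRing R] [CommRing A] [IsDomain A] [Algebra R A] [Algebra.IsIntegral R A]
    [IsIntegrallyClosed A] {ϖ : A} (hϖ : ϖ ≠ 0) {p : Ideal A}
    (hp : p ∈ (Ideal.span {ϖ}).minimalPrimes) {f g : A} (hf : f ≠ 0) (hg : g ≠ 0) :
    (∃ s ∉ p, g ∣ s * f) ∨ ∃ s ∉ p, f ∣ s * g := by
  have hpp : p.IsPrime := hp.1.1
  refine dvd_or_dvd_of_forall R (fun h => hϖ ?_) hf hg fun a ha => ?_
  · simpa [h] using (mem_minimalPrimes_span_iff.1 hp).1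
  · obtain ⟨s, hs, n, hn⟩ := exists_dvd_mul_pow_of_mem R hp ha hg
    exact ⟨s, hs, n, hn.mul_right _⟩

end Krull

/-! ### Divisibility description of rank-one valuation rings -/

section RankOne

/-- `V` is a valuation ring of rank one and `ϖ` is a non-zero non-unit of `V`. -/
structure IsPseudoUniformizer {V : Type*} [CommRing V] (ϖ : V) : Prop where
  isDomain : IsDomain V
  ne_zero : ϖ ≠ 0
  not_isUnit : ¬ IsUnit ϖ
  dvd_total : ∀ f g : V, f ∣ g ∨ g ∣ f
  dvd_pow : ∀ a : V, ¬ IsUnit a → ∀ y : V, y ≠ 0 → ∃ n : ℕ, y ∣ a ^ n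

theorem IsPseudoUniformizer.isRankOneValuationRing {V : Type*} [CommRing V] {ϖ : V}
    (h : IsPseudoUniformizer ϖ) : IsRankOneValuationRing V := by
  have := h.isDomain
  have hV : ValuationRing V := ValuationRing.iff_dvd_total.2 ⟨h.dvd_total⟩
  refine ⟨this, hV, ?_⟩
  rw [ringKrullDim_eq_one_iff_of_isLocalRing_isDomain]
  refine ⟨fun hF => h.not_isUnit (hF.mul_inv_cancel h.ne_zero |>.elim fun b hb =>
    IsUnit.of_mul_eq_one b hb), fun x hx a ha => ?_⟩
  obtain ⟨n, hn⟩ := h.dvd_pow a ha x hx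
  exact ⟨n, Ideal.mem_span_singleton.2 hn⟩

theorem IsPseudoUniformizer.isHausdorff {V : Type*} [CommRing V] {ϖ : V}
    (h : IsPseudoUniformizer ϖ) : IsHausdorff (Ideal.span {ϖ}) V := by
  have := h.isDomain
  refine ⟨fun x hx => ?_⟩
  by_contra hx0
  obtain ⟨n, hn⟩ := h.dvd_pow ϖ h.not_isUnit x hx0
  have h1 := hx (n + 1)
  rw [SModEq.zero, smul_eq_mul, Ideal.mul_top, Ideal.span_singleton_pow,
    Ideal.mem_span_singleton] at h1
  have h2 := h1.trans hn
  rw [pow_succ] at h2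
  have h3 : ϖ ^ n * ϖ ∣ ϖ ^ n * 1 := by simpa using h2
  exact h.not_isUnit (isUnit_of_dvd_one
    ((mul_dvd_mul_iff_left (pow_ne_zero n h.ne_zero)).1 h3))

end RankOne

/-! ### Ring homomorphisms that are isomorphisms modulo `ϖ` -/

section ModIso

variable {A B C : Type*} [CommRing A] [CommRing B] [CommRing C]

/-- The ring homomorphism `ι` induces an isomorphism modulo `ϖ`. -/
structure IsModIso (ϖ : A) (ι : A →+* B) : Prop where
  surj : ∀ c : B, ∃ a d, c = ι a + ι ϖ * d
  inj : ∀ a : A, ι ϖ ∣ ι a → ϖ ∣ a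

namespace IsModIso

variable {ϖ : A} {ι : A →+* B}

theorem comp {κ : B →+* C} (hκ : IsModIso (ι ϖ) κ) (hι : IsModIso ϖ ι) :
    IsModIso ϖ (κ.comp ι) where
  surj c := by
    obtain ⟨b, d, rfl⟩ := hκ.surj c
    obtain ⟨a, e, rfl⟩ := hι.surj b
    exact ⟨a, κ e + d, by simp [mul_add, add_assoc]⟩
  inj a h := hι.inj a (hκ.inj _ h)

theorem surj_pow (h : IsModIso ϖ ι) (n : ℕ) (c : B) : ∃ a d, c = ι a + ι ϖ ^ n * d := by
  induction n with
  | zero => exact ⟨0, c, by simp⟩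
  | succ n ih =>
    obtain ⟨a, d, rfl⟩ := ih
    obtain ⟨b, e, rfl⟩ := h.surj d
    exact ⟨a + ϖ ^ n * b, e, by simp only [map_add, map_mul, map_pow]; ring⟩

theorem inj_pow (h : IsModIso ϖ ι) (hϖ : ι ϖ ∈ nonZeroDivisors B) (n : ℕ) (a : A)
    (ha : ι ϖ ^ n ∣ ι a) : ϖ ^ n ∣ a := by
  induction n generalizing a with
  | zero => simp
  | succ n ih =>
    obtain ⟨b, rfl⟩ := h.inj a ((Dvd.intro_left _ (pow_succ _ _).symm).trans ha)
    obtain ⟨c, hc⟩ := ha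
    rw [pow_succ']
    refine mul_dvd_mul_left _ (ih b ⟨c, ?_⟩)
    rw [map_mul, pow_succ', mul_assoc] at hc
    exact (mul_cancel_left_mem_nonZeroDivisors hϖ).1 hc

theorem not_isUnit (h : IsModIso ϖ ι) (hϖ : ¬ IsUnit ϖ) : ¬ IsUnit (ι ϖ) := fun hu =>
  hϖ (isUnit_of_dvd_one (h.inj 1 (by simpa using hu.dvd)))

/-- A complete `ϖ`-torsion free ring that agrees modulo `ϖ` with a valuation ring of rank one is
a valuation ring of rank one. -/
theorem isPseudoUniformizer (h : IsModIso ϖ ι) (hA : IsPseudoUniformizer ϖ)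
    (hϖ : ι ϖ ∈ nonZeroDivisors B) [IsAdicComplete (Ideal.span {ι ϖ}) B] :
    IsPseudoUniformizer (ι ϖ) := by
  have := hA.isDomain
  have hnu := h.not_isUnit hA.not_isUnit
  have hnt : Nontrivial B := by
    by_contra hcon
    rw [not_nontrivial_iff_subsingleton] at hcon
    exact hnu (by rw [Subsingleton.elim (ι ϖ) 1]; exact isUnit_one)
  have hinj : ∀ v : A, v ≠ 0 → ι v ≠ 0 := fun v hv hv0 => by
    obtain ⟨n, w, hw⟩ := hA.dvd_pow ϖ hA.not_isUnit v hv
    have : ι ϖ ^ n = 0 := by rw [← map_pow, hw, map_mul, hv0, zero_mul]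
    exact nonZeroDivisors.ne_zero (pow_mem hϖ n) this
  -- If `ϖⁿ ∤ d`, write `d = v + ϖⁿ d'`. Then `v` strictly divides `ϖⁿ`, say `ϖⁿ = v w`, and `d = v
  -- (1 + w d')`. Some power of `w` is divisible by `ϖ`, so `w d'` lies in the Jacobson radical and
  -- the second factor is a unit.
  have key : ∀ d : B, d ≠ 0 → ∃ v, v ≠ 0 ∧ ∃ u, IsUnit u ∧ d = ι v * u := fun d hd => by
    obtain ⟨n, hn⟩ : ∃ n, ¬ ι ϖ ^ n ∣ d := by
      by_contra! hcon
      refine hd (IsHausdorff.haus (I := Ideal.span {ι ϖ}) inferInstance d fun n => ?_)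
      rw [SModEq.zero, smul_eq_mul, Ideal.mul_top, Ideal.span_singleton_pow,
        Ideal.mem_span_singleton]
      exact hcon n
    obtain ⟨v, d', rfl⟩ := h.surj_pow n d
    have hv : ¬ ϖ ^ n ∣ v := fun hv => hn (dvd_add (by
      rw [← map_pow]; exact map_dvd ι hv) (dvd_mul_right _ _))
    obtain ⟨w, hw⟩ := (hA.dvd_total v (ϖ ^ n)).resolve_right hv
    have hwu : ¬ IsUnit w := fun hu => hv (by
      rw [hw]; exact (hu.dvd_mul_right.1 (dvd_refl _) : v * w ∣ v) |>.trans (dvd_refl _))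
    obtain ⟨k, hk⟩ := hA.dvd_pow w hwu ϖ hA.ne_zero
    refine ⟨v, fun h0 => hv (h0 ▸ dvd_zero _), ι w * d' + 1, ?_, ?_⟩
    · have h1 : (ι w * d') ^ k ∈ (⊥ : Ideal B).jacobson := by
        refine IsAdicComplete.le_jacobson_bot (Ideal.span {ι ϖ}) ?_
        rw [Ideal.mem_span_singleton, mul_pow, ← map_pow]
        exact (map_dvd ι hk).mul_right _
      have h2 : ι w * d' ∈ (⊥ : Ideal B).jacobson := Ideal.isRadical_jacobson _ ⟨k, h1⟩
      simpa using Ideal.mem_jacobson_bot.1 h2 1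
    · rw [← map_pow, hw, map_mul]; ring
  have hdom : IsDomain B := by
    have : NoZeroDivisors B := ⟨fun {a b} hab => by
      by_contra! hcon
      obtain ⟨v, hv, u, hu, rfl⟩ := key a hcon.1
      obtain ⟨v', hv', u', hu', rfl⟩ := key b hcon.2
      refine hinj (v * v') (mul_ne_zero hv hv') ?_
      have h1 : ι (v * v') * (u * u') = 0 := by rw [map_mul, ← hab]; ring
      exact (hu.mul hu').mul_left_eq_zero.1 h1⟩
    exact NoZeroDivisors.to_isDomain B
  refine ⟨hdom, hinj _ hA.ne_zero, hnu, fun f g => ?_, fun a ha y hy => ?_⟩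
  · by_cases hf : f = 0
    · exact .inr (hf ▸ dvd_zero _)
    by_cases hg : g = 0
    · exact .inl (hg ▸ dvd_zero _)
    obtain ⟨v, hv, u, hu, rfl⟩ := key f hf
    obtain ⟨v', hv', u', hu', rfl⟩ := key g hg
    rw [hu.mul_right_dvd, hu'.mul_right_dvd, hu.dvd_mul_right, hu'.dvd_mul_right]
    exact (hA.dvd_total v v').imp (map_dvd ι) (map_dvd ι)
  · by_cases ha0 : a = 0
    · exact ⟨1, by simp [ha0]⟩
    obtain ⟨v, hv, u, hu, rfl⟩ := key a ha0
    obtain ⟨v', hv', u', hu', rfl⟩ := key y hy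
    obtain ⟨n, hn⟩ := hA.dvd_pow v (fun hvu => ha ((hvu.map ι).mul hu)) v' hv'
    refine ⟨n, ?_⟩
    rw [hu'.mul_right_dvd, mul_pow, ← map_pow]
    exact (map_dvd ι hn).mul_right _

/-- In the elementwise criterion only divisibility by `ϖ` occurs, and `ϖ` lies in all the primes
involved, so only the ring modulo `ϖ` matters. -/
theorem isWeaklyAssociatedPrime_comap (h : IsModIso ϖ ι) {P : Ideal B} [P.IsPrime]
    (hP : IsWeaklyAssociatedPrime (ι ϖ) P) : IsWeaklyAssociatedPrime ϖ (P.comap ι) := by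
  obtain ⟨f', hf', H⟩ := isWeaklyAssociatedPrime_iff.1 hP
  have hϖP : ι ϖ ∈ P := hf' _ ⟨f', rfl⟩
  obtain ⟨f, e, rfl⟩ := h.surj f'
  refine isWeaklyAssociatedPrime_iff.2 ⟨f, fun a ha => hf' _ ?_, fun a ha => ?_⟩
  · rw [mul_add]
    exact dvd_add (by rw [← map_mul]; exact map_dvd ι ha) ((dvd_mul_right _ _).mul_left _)
  · obtain ⟨s', hs', n, hn⟩ := H _ ha
    obtain ⟨s, d, rfl⟩ := h.surj s'
    refine ⟨s, fun hs => hs' (P.add_mem hs (P.mul_mem_right _ hϖP)), n, h.inj _ ?_⟩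
    have : ι (s * a ^ n * f) = (ι s + ι ϖ * d) * ι a ^ n * (ι f + ι ϖ * e) -
        ι ϖ * (d * ι a ^ n * (ι f + ι ϖ * e) + ι s * ι a ^ n * e) := by
      simp only [map_mul, map_pow]; ring
    rw [this]
    exact dvd_sub hn (dvd_mul_right _ _)

theorem mem_minimalPrimes_comap (h : IsModIso ϖ ι) {P : Ideal B}
    (hP : P ∈ (Ideal.span {ι ϖ}).minimalPrimes) :
    P.comap ι ∈ (Ideal.span {ϖ}).minimalPrimes := by
  have hPp : P.IsPrime := hP.1.1
  obtain ⟨hϖP, H⟩ := mem_minimalPrimes_span_iff.1 hP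
  refine mem_minimalPrimes_span_iff.2 ⟨hϖP, fun a ha => ?_⟩
  obtain ⟨s', hs', n, hn⟩ := H _ ha
  obtain ⟨s, d, rfl⟩ := h.surj s'
  refine ⟨s, fun hs => hs' (P.add_mem hs (P.mul_mem_right _ hϖP)), n, h.inj _ ?_⟩
  have : ι (s * a ^ n) = (ι s + ι ϖ * d) * ι a ^ n - ι ϖ * (d * ι a ^ n) := by
    simp only [map_mul, map_pow]; ring
  rw [this]
  exact dvd_sub hn (dvd_mul_right _ _)

theorem mem_minimalPrimes_of_comap (h : IsModIso ϖ ι) {P : Ideal B} [hPp : P.IsPrime]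
    (hP : P.comap ι ∈ (Ideal.span {ϖ}).minimalPrimes) :
    P ∈ (Ideal.span {ι ϖ}).minimalPrimes := by
  obtain ⟨hϖP, H⟩ := mem_minimalPrimes_span_iff.1 hP
  refine mem_minimalPrimes_iff_forall.2 ⟨by rwa [Ideal.span_singleton_le_iff_mem],
    fun c hc => ?_⟩
  obtain ⟨a, d, rfl⟩ := h.surj c
  have ha : ι a ∈ P := (Ideal.add_mem_iff_left P (P.mul_mem_right _ hϖP)).1 hc
  obtain ⟨s, hs, n, hn⟩ := H a ha
  refine ⟨ι s, hs, n, ?_⟩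
  rw [← Ideal.Quotient.eq_zero_iff_mem]
  have h0 : Ideal.Quotient.mk (Ideal.span {ι ϖ}) (ι ϖ) = 0 :=
    Ideal.Quotient.eq_zero_iff_mem.2 (Ideal.mem_span_singleton_self _)
  have h1 : Ideal.Quotient.mk (Ideal.span {ι ϖ}) (ι (s * a ^ n)) = 0 :=
    Ideal.Quotient.eq_zero_iff_mem.2 (Ideal.mem_span_singleton.2 (map_dvd ι hn))
  simpa [h0] using h1

/-- Since `ι ϖ ∈ P`, every denominator outside `P` is congruent modulo `ι ϖ` to the image of one
outside `P.comap ι`. Numerators and denominators can thus both be moved to `A`. -/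
theorem localRingHom (h : IsModIso ϖ ι) (P : Ideal B) [P.IsPrime] (hP : ι ϖ ∈ P) :
    IsModIso (algebraMap A (Localization.AtPrime (P.comap ι)) ϖ)
      (Localization.localRingHom (P.comap ι) P ι rfl) := by
  set F := Localization.localRingHom (P.comap ι) P ι rfl
  have hF : ∀ a, F (algebraMap A _ a) = algebraMap B _ (ι a) :=
    fun a => Localization.localRingHom_to_map _ _ _ _ _
  have hspl : ∀ s' : B, s' ∉ P → ∃ s : (P.comap ι).primeCompl,
      ∃ d, s' = ι s + ι ϖ * d := fun s' hs' => by
    obtain ⟨s, d, rfl⟩ := h.surj s'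
    exact ⟨⟨s, fun hs => hs' (P.add_mem hs (P.mul_mem_right _ hP))⟩, d, rfl⟩
  constructor
  · intro x
    obtain ⟨f', ⟨s', hs'⟩, rfl⟩ := IsLocalization.exists_mk'_eq P.primeCompl x
    obtain ⟨f, g, rfl⟩ := h.surj f'
    obtain ⟨s, k, rfl⟩ := hspl s' hs'
    refine ⟨IsLocalization.mk' _ f s,
      IsLocalization.mk' _ (g * ι s - ι f * k)
        (⟨ι s + ι ϖ * k, hs'⟩ * ⟨ι s, s.2⟩ : P.primeCompl), ?_⟩
    rw [hF, Localization.localRingHom_mk', IsLocalization.mul_mk'_eq_mk'_of_mul,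
      ← IsLocalization.mk'_add, IsLocalization.mk'_eq_iff_eq]
    congr 1
    simp only [Submonoid.coe_mul]
    ring
  · intro x hx
    obtain ⟨f, s, rfl⟩ := IsLocalization.exists_mk'_eq (P.comap ι).primeCompl x
    rw [Localization.localRingHom_mk', hF] at hx
    obtain ⟨y, hy⟩ := hx
    obtain ⟨g, t, rfl⟩ := IsLocalization.exists_mk'_eq P.primeCompl y
    rw [IsLocalization.mul_mk'_eq_mk'_of_mul, IsLocalization.mk'_eq_iff_eq,
      IsLocalization.eq_iff_exists P.primeCompl] at hy
    obtain ⟨u, hu⟩ := hy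
    obtain ⟨r, d, hrd⟩ := hspl (u * t) (Submonoid.mul_mem _ u.2 t.2)
    have h1 : ϖ ∣ r * f := h.inj _ ⟨u * ι s * g - d * ι f, by
      rw [map_mul, eq_sub_of_add_eq hrd.symm]
      simp only at hu
      linear_combination hu⟩
    have hru : IsUnit (algebraMap A (Localization.AtPrime (P.comap ι)) (r : A)) :=
      IsLocalization.map_units _ r
    have h2 := map_dvd (algebraMap A (Localization.AtPrime (P.comap ι))) h1
    rw [map_mul, hru.dvd_mul_left] at h2
    refine h2.trans ?_
    rw [IsLocalization.mk'_eq_mul_mk'_one f s]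
    exact dvd_mul_right _ _

end IsModIso

end ModIso

/-! ### The `ϖ`-adic completion -/

section Completion

variable {A : Type*} [CommRing A] (ϖ : A)

theorem Completion.exists_eq_add (n : ℕ) (c : Completion A ϖ) :
    ∃ a d, c = algebraMap A (Completion A ϖ) a + algebraMap A (Completion A ϖ) ϖ ^ n * d := by
  obtain ⟨a, ha⟩ := Ideal.Quotient.mk_surjective (AdicCompletion.evalₐ (Ideal.span {ϖ}) n c)
  have h : c - algebraMap A (Completion A ϖ) a ∈
      (AdicCompletion.eval (Ideal.span {ϖ}) A n).ker := by
    rw [LinearMap.mem_ker, map_sub, sub_eq_zero, ← AdicCompletion.factor_evalₐ_eq_eval _ _ (by simp),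
      ← AdicCompletion.factor_evalₐ_eq_eval _ _ (by simp), AdicCompletion.algebraMap_apply,
      Algebra.algebraMap_self_apply, AdicCompletion.evalₐ_of, ha]
  rw [← AdicCompletion.pow_smul_top_eq_ker_eval ⟨{ϖ}, by simp⟩, Ideal.span_singleton_pow,
    Submodule.ideal_span_singleton_smul, Submodule.mem_smul_pointwise_iff_exists] at h
  obtain ⟨d, -, hd⟩ := h
  refine ⟨a, d, ?_⟩
  rw [← map_pow, ← Algebra.smul_def, hd]
  ring

theorem Completion.pow_dvd_of_pow_dvd {n : ℕ} {a : A}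
    (h : algebraMap A (Completion A ϖ) ϖ ^ n ∣ algebraMap A (Completion A ϖ) a) : ϖ ^ n ∣ a := by
  obtain ⟨d, hd⟩ := h
  have h1 := congrArg (AdicCompletion.evalₐ (Ideal.span {ϖ}) n) hd
  have h0 : Ideal.Quotient.mk (Ideal.span {ϖ} ^ n) (ϖ ^ n) = 0 := Ideal.Quotient.eq_zero_iff_mem.2
    (by rw [Ideal.span_singleton_pow]; exact Ideal.mem_span_singleton_self _)
  rw [map_mul, map_pow, AlgHom.commutes, AlgHom.commutes, ← map_pow, Ideal.Quotient.algebraMap_eq,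
    h0, zero_mul, Ideal.Quotient.eq_zero_iff_mem, Ideal.span_singleton_pow, Ideal.mem_span_singleton] at h1
  exact h1

theorem Completion.isModIso : IsModIso ϖ (algebraMap A (Completion A ϖ)) where
  surj c := by simpa using Completion.exists_eq_add ϖ 1 c
  inj a h := by simpa using Completion.pow_dvd_of_pow_dvd ϖ (n := 1) (a := a) (by simpa using h)

instance : IsAdicComplete (Ideal.span {algebraMap A (Completion A ϖ) ϖ}) (Completion A ϖ) := by
  have := AdicCompletion.isAdicComplete_self (Ideal.span {ϖ}) ⟨{ϖ}, by simp⟩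
  rwa [Ideal.map_span, Set.image_singleton] at this

variable {ϖ}

/-- If `x ϖ = 0` and `x ≡ a` modulo `ϖⁿ`, then `ϖⁿ⁺¹ ∣ a ϖ` in `A`, hence `ϖⁿ ∣ a` and `ϖⁿ ∣ x` for
all `n`. Separatedness gives `x = 0`. -/
theorem Completion.mem_nonZeroDivisors (hϖ : ϖ ∈ nonZeroDivisors A) :
    algebraMap A (Completion A ϖ) ϖ ∈ nonZeroDivisors (Completion A ϖ) := by
  rw [mem_nonZeroDivisors_iff_right]
  intro x hx
  refine IsHausdorff.haus (I := Ideal.span {algebraMap A (Completion A ϖ) ϖ}) inferInstance x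
    fun n => ?_
  rw [SModEq.zero, smul_eq_mul, Ideal.mul_top, Ideal.span_singleton_pow, Ideal.mem_span_singleton]
  obtain ⟨a, d, rfl⟩ := Completion.exists_eq_add ϖ n x
  have h1 : ϖ ^ (n + 1) ∣ a * ϖ := Completion.pow_dvd_of_pow_dvd ϖ ⟨-d, by
    rw [map_mul]; linear_combination hx⟩
  obtain ⟨c, hc⟩ := h1
  have h2 : a = ϖ ^ n * c := (mul_cancel_right_mem_nonZeroDivisors hϖ).1 (by rw [hc]; ring)
  rw [h2, map_mul, map_pow]
  exact dvd_add (dvd_mul_right _ _) (dvd_mul_right _ _)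

end Completion

/-! ### Local rings at minimal primes: the strongly Krull and strongly Shilov properties -/

section Localization

theorem IsModIso.isPseudoUniformizer_completion {A B : Type*} [CommRing A] [CommRing B]
    {F : A →+* B} {a : A} {b : B} (hF : IsModIso a F) (ha : IsPseudoUniformizer a) (hab : F a = b)
    (hb : b ∈ nonZeroDivisors B) : IsPseudoUniformizer (algebraMap B (Completion B b) b) := by
  subst hab
  have : IsAdicComplete (Ideal.span {((algebraMap B (Completion B (F a))).comp F) a})
    (Completion B (F a)) := inferInstanceAs
      (IsAdicComplete (Ideal.span {algebraMap B (Completion B (F a)) (F a)}) (Completion B (F a)))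
  exact ((Completion.isModIso (F a)).comp hF).isPseudoUniformizer ha
    (Completion.mem_nonZeroDivisors hb)

theorem isPseudoUniformizer_localization {A : Type*} [CommRing A] [IsDomain A] {ϖ : A}
    (hϖ : ϖ ≠ 0) {p : Ideal A} [p.IsPrime] (hϖp : ϖ ∈ p)
    (htot : ∀ f g : A, f ≠ 0 → g ≠ 0 → (∃ s ∉ p, g ∣ s * f) ∨ ∃ s ∉ p, f ∣ s * g)
    (hpow : ∀ a ∈ p, ∀ y : A, y ≠ 0 → ∃ s ∉ p, ∃ n : ℕ, y ∣ s * a ^ n) :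
    IsPseudoUniformizer (algebraMap A (Localization.AtPrime p) ϖ) := by
  set L := Localization.AtPrime p
  have hLd : IsDomain L := IsLocalization.isDomain_localization p.primeCompl_le_nonZeroDivisors
  have hinj : Function.Injective (algebraMap A L) :=
    IsLocalization.injective L p.primeCompl_le_nonZeroDivisors
  have hunit : ∀ s ∉ p, IsUnit (algebraMap A L s) := fun s hs =>
    IsLocalization.map_units L (⟨s, hs⟩ : p.primeCompl)
  have hdvd : ∀ {f g : A}, (∃ s ∉ p, g ∣ s * f) → algebraMap A L g ∣ algebraMap A L f := by
    rintro f g ⟨s, hs, h⟩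
    have := map_dvd (algebraMap A L) h
    rwa [map_mul, (hunit s hs).dvd_mul_left] at this
  have hrep : ∀ x : L, ∃ a u, IsUnit u ∧ x = algebraMap A L a * u := fun x => by
    obtain ⟨a, s, rfl⟩ := IsLocalization.exists_mk'_eq p.primeCompl x
    refine ⟨a, IsLocalization.mk' L 1 s, ?_, IsLocalization.mk'_eq_mul_mk'_one a s⟩
    refine IsUnit.of_mul_eq_one (algebraMap A L s) ?_
    rw [IsLocalization.mk'_spec, map_one]
  refine ⟨hLd, ?_, ?_, fun f g => ?_, fun a ha y hy => ?_⟩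
  · rwa [Ne, map_eq_zero_iff _ hinj]
  · rw [IsLocalization.AtPrime.isUnit_to_map_iff L p]
    exact fun h => h hϖp
  · obtain ⟨a, u, hu, rfl⟩ := hrep f
    obtain ⟨b, v, hv, rfl⟩ := hrep g
    rw [hu.mul_right_dvd, hv.mul_right_dvd, hu.dvd_mul_right, hv.dvd_mul_right]
    by_cases ha : a = 0
    · exact .inr (by simp [ha])
    by_cases hb : b = 0
    · exact .inl (by simp [hb])
    exact ((htot a b ha hb).imp hdvd hdvd).symm
  · obtain ⟨a, u, hu, rfl⟩ := hrep a
    obtain ⟨b, v, hv, rfl⟩ := hrep y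
    have hb : b ≠ 0 := by rintro rfl; simp at hy
    have hap : a ∈ p := by
      by_contra hap
      exact ha ((hunit a hap).mul hu)
    obtain ⟨s, hs, n, hn⟩ := hpow a hap b hb
    refine ⟨n, ?_⟩
    rw [hv.mul_right_dvd, mul_pow, ← map_pow]
    exact (hdvd ⟨s, hs, hn⟩).mul_right _

variable (R : Type*) {A : Type*} [CommRing R] [IsNoetherianRing R] [CommRing A] [IsDomain A]
  [Algebra R A] [Algebra.IsIntegral R A] [IsIntegrallyClosed A] {ϖ : A}

include R

theorem isPseudoUniformizer_localization_of_mem_minimalPrimes (hϖ : ϖ ≠ 0) {p : Ideal A}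
    [p.IsPrime] (hp : p ∈ (Ideal.span {ϖ}).minimalPrimes) :
    IsPseudoUniformizer (algebraMap A (Localization.AtPrime p) ϖ) :=
  isPseudoUniformizer_localization hϖ (mem_minimalPrimes_span_iff.1 hp).1
    (fun _ _ hf hg => dvd_or_dvd_of_mem_minimalPrimes R hϖ hp hf hg)
    (fun _ ha _ hy => exists_dvd_mul_pow_of_mem R hp ha hy)

/-- A normal domain which is integral over a Noetherian ring is strongly `ϖ`-Krull. -/
theorem isStronglyKrull (hϖ : ϖ ≠ 0) (hϖ' : ¬ IsUnit ϖ) : IsStronglyKrull A ϖ where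
  mem_nonZeroDivisors := mem_nonZeroDivisors_of_ne_zero hϖ
  not_isUnit := hϖ'
  isRankOneValuationRing _ _ hp := (isPseudoUniformizer_localization_of_mem_minimalPrimes R hϖ
    (hp.mem_minimalPrimes R hϖ)).isRankOneValuationRing
  isHausdorff _ _ hp := (isPseudoUniformizer_localization_of_mem_minimalPrimes R hϖ
    (hp.mem_minimalPrimes R hϖ)).isHausdorff

/-- The completed local rings of the completion at minimal primes of `ϖ` are valuation rings of rank
one. -/
theorem isPseudoUniformizer_completion (hϖ : ϖ ≠ 0) {P : Ideal (Completion A ϖ)} [P.IsPrime]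
    (hP : P.comap (algebraMap A (Completion A ϖ)) ∈ (Ideal.span {ϖ}).minimalPrimes) :
    IsPseudoUniformizer (algebraMap (Localization.AtPrime P)
      (Completion (Localization.AtPrime P) (algebraMap _ _ (algebraMap A (Completion A ϖ) ϖ)))
      (algebraMap _ _ (algebraMap A (Completion A ϖ) ϖ))) := by
  set C := Completion A ϖ
  set ι := algebraMap A C
  have h1 : IsModIso ϖ ι := Completion.isModIso ϖ
  -- The completed local ring of the completion at `P` agrees modulo `ϖ` with the local ring of `A`
  -- at the contraction of `P`, which is already a valuation ring of rank one.
  refine (h1.localRingHom P (mem_minimalPrimes_span_iff.1 hP).1).isPseudoUniformizer_completion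
    (isPseudoUniformizer_localization_of_mem_minimalPrimes R hϖ hP)
    (Localization.localRingHom_to_map _ _ _ _ _) ?_
  exact IsLocalization.map_nonZeroDivisors_le P.primeCompl _ ⟨_,
    Completion.mem_nonZeroDivisors (mem_nonZeroDivisors_of_ne_zero hϖ), rfl⟩

theorem isStronglyShilov_completion (hϖ : ϖ ≠ 0) (hϖ' : ¬ IsUnit ϖ) :
    IsStronglyShilov (Completion A ϖ) (algebraMap A (Completion A ϖ) ϖ) where
  mem_nonZeroDivisors := Completion.mem_nonZeroDivisors (mem_nonZeroDivisors_of_ne_zero hϖ)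
  not_isUnit := (Completion.isModIso ϖ).not_isUnit hϖ'
  isRankOneValuationRing _ _ hp := (isPseudoUniformizer_completion R hϖ
    (((Completion.isModIso ϖ).isWeaklyAssociatedPrime_comap hp).mem_minimalPrimes
      R hϖ)).isRankOneValuationRing

end Localization

/-! ### Lengths of power torsion modules -/

section PowTorsion

variable {R : Type*} [CommRing R] (I : Ideal R)

/-- The elements of `M` annihilated by a power of `I`. -/
def powTorsion (M : Type*) [AddCommGroup M] [Module R M] : Submodule R M where
  carrier := {x | ∃ n : ℕ, ∀ a ∈ I ^ n, a • x = 0}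
  zero_mem' := ⟨0, by simp⟩
  add_mem' := by
    rintro x y ⟨m, hm⟩ ⟨n, hn⟩
    refine ⟨m + n, fun a ha => ?_⟩
    rw [smul_add, hm a (Ideal.pow_le_pow_right (Nat.le_add_right m n) ha),
      hn a (Ideal.pow_le_pow_right (Nat.le_add_left n m) ha), add_zero]
  smul_mem' := by
    rintro c x ⟨m, hm⟩
    exact ⟨m, fun a ha => by rw [smul_comm, hm a ha, smul_zero]⟩

variable {I} {M N P : Type*} [AddCommGroup M] [Module R M] [AddCommGroup N] [Module R N]
  [AddCommGroup P] [Module R P]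

theorem map_mem_powTorsion (f : M →ₗ[R] N) {x : M} (hx : x ∈ powTorsion I M) :
    f x ∈ powTorsion I N := by
  obtain ⟨n, hn⟩ := hx
  exact ⟨n, fun a ha => by rw [← map_smul, hn a ha, map_zero]⟩

theorem mem_powTorsion_of_map {f : M →ₗ[R] N} (hf : Function.Injective f) {x : M}
    (hx : f x ∈ powTorsion I N) : x ∈ powTorsion I M := by
  obtain ⟨n, hn⟩ := hx
  exact ⟨n, fun a ha => hf (by rw [map_smul, hn a ha, map_zero])⟩

theorem length_powTorsion_le (f : N →ₗ[R] M) (g : M →ₗ[R] P) (hf : Function.Injective f)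
    (h : Function.Exact f g) :
    Module.length R (powTorsion I M) ≤
      Module.length R (powTorsion I N) + Module.length R (powTorsion I P) := by
  let f' : powTorsion I N →ₗ[R] powTorsion I M := f.restrict fun _ hx => map_mem_powTorsion f hx
  let g' : powTorsion I M →ₗ[R] powTorsion I P := g.restrict fun _ hx => map_mem_powTorsion g hx
  have hf' : Function.Injective f' := fun x y hxy => Subtype.ext (hf (congrArg Subtype.val hxy))
  have hex : Function.Exact f' g'.rangeRestrict := by
    rintro ⟨x, hx⟩
    constructor
    · intro hx0
      have : g x = 0 := congrArg (fun y => ((y : LinearMap.range g') : powTorsion I P).1) hx0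
      obtain ⟨y, rfl⟩ := (h x).1 this
      exact ⟨⟨y, mem_powTorsion_of_map hf hx⟩, rfl⟩
    · rintro ⟨y, hy⟩
      apply Subtype.ext
      apply Subtype.ext
      change g x = 0
      have : f y = x := congrArg Subtype.val hy
      exact (h x).2 ⟨y, this⟩
  rw [Module.length_eq_add_of_exact f' g'.rangeRestrict hf' g'.surjective_rangeRestrict hex]
  gcongr
  exact Module.length_le_of_injective _ (LinearMap.range g').subtype_injective

/-- The torsion submodule is finitely generated, so a single power `I ^ m` kills it. It is then a
finite module over the Artinian ring `R ⧸ I ^ m`. -/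
theorem length_powTorsion_ne_top [IsNoetherianRing R] [I.IsMaximal] [Module.Finite R M] :
    Module.length R (powTorsion I M) ≠ ⊤ := by
  classical
  obtain ⟨s, hs⟩ := IsNoetherian.noetherian (powTorsion I M)
  have hmem : ∀ x : s, (x : M) ∈ powTorsion I M := fun x => hs ▸ Submodule.subset_span x.2
  choose n hn using hmem
  set m := Finset.univ.sup n
  have hann : ∀ a ∈ I ^ m, ∀ x ∈ powTorsion I M, a • x = 0 := by
    intro a ha x hx
    rw [← hs] at hx
    induction hx using Submodule.span_induction with
    | mem x hx =>
      exact hn ⟨x, hx⟩ a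
        (Ideal.pow_le_pow_right (Finset.le_sup (f := n) (Finset.mem_univ (⟨x, hx⟩ : s))) ha)
    | zero => simp
    | add x y _ _ hx hy => rw [smul_add, hx, hy, add_zero]
    | smul c x _ hx => rw [smul_comm, hx, smul_zero]
  have htor : Module.IsTorsionBySet R (powTorsion I M) (I ^ m : Ideal R) := fun x a =>
    Subtype.ext (hann a a.2 x x.2)
  let _ := htor.module
  have htower : IsScalarTower R (R ⧸ I ^ m) (powTorsion I M) := htor.isScalarTower
  have hdim : Ring.KrullDimLE 0 (R ⧸ I ^ m) := by
    rw [Ring.krullDimLE_zero_iff]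
    intro J hJ
    have hp : (J.comap (Ideal.Quotient.mk (I ^ m))).IsPrime := inferInstance
    have hle : I ≤ J.comap (Ideal.Quotient.mk (I ^ m)) := by
      refine hp.le_of_pow_le (n := m) fun x hx => ?_
      rw [Ideal.mem_comap, Ideal.Quotient.eq_zero_iff_mem.2 hx]
      exact J.zero_mem
    have hmax : (J.comap (Ideal.Quotient.mk (I ^ m))).IsMaximal := by
      rw [← Ideal.IsMaximal.eq_of_le (inferInstance : I.IsMaximal) hp.ne_top hle]
      infer_instance
    exact Ideal.IsIntegral.isMaximal_of_isMaximal_comap (R := R) J hmax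
  have hart : IsArtinianRing (R ⧸ I ^ m) :=
    IsNoetherianRing.isArtinianRing_of_krullDimLE_zero
  rw [Module.length_eq_of_surjective (R := R ⧸ I ^ m) Ideal.Quotient.mk_surjective]
  have : Module.Finite (R ⧸ I ^ m) (powTorsion I M) := Module.Finite.of_restrictScalars_finite R _ _
  exact Module.length_ne_top

/-- Induction along `0 → R/tᵏ → R/tᵏ⁺¹ → R/t → 0`, whose first map is multiplication by `t`; taking
power torsion is left exact. -/
theorem length_powTorsion_quotient_pow_le {t : R} (ht : t ∈ nonZeroDivisors R) (k : ℕ) :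
    Module.length R (powTorsion I (R ⧸ Ideal.span {t ^ k})) ≤
      k * Module.length R (powTorsion I (R ⧸ Ideal.span {t})) := by
  induction k with
  | zero =>
    have : Subsingleton (R ⧸ Ideal.span {t ^ 0}) := by
      rw [Ideal.Quotient.subsingleton_iff]; simp
    simp
  | succ k ih =>
    let f : (R ⧸ Ideal.span {t ^ k}) →ₗ[R] (R ⧸ Ideal.span {t ^ (k + 1)}) :=
      Submodule.mapQ (Ideal.span {t ^ k}) (Ideal.span {t ^ (k + 1)}) (LinearMap.mulLeft R t) (by
        rw [Ideal.span_singleton_le_iff_mem]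
        simp [pow_succ'])
    let g : (R ⧸ Ideal.span {t ^ (k + 1)}) →ₗ[R] (R ⧸ Ideal.span {t}) :=
      Submodule.mapQ (Ideal.span {t ^ (k + 1)}) (Ideal.span {t}) LinearMap.id (by
        rw [Ideal.span_singleton_le_iff_mem]
        simp [Ideal.mem_span_singleton, pow_succ'])
    have hf : Function.Injective f := by
      rw [injective_iff_map_eq_zero]
      intro x hx
      obtain ⟨x, rfl⟩ := Ideal.Quotient.mk_surjective x
      have h1 : Ideal.Quotient.mk (Ideal.span {t ^ (k + 1)}) (t * x) = 0 := hx
      rw [Ideal.Quotient.eq_zero_iff_mem, Ideal.mem_span_singleton, pow_succ'] at h1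
      rw [Ideal.Quotient.eq_zero_iff_mem, Ideal.mem_span_singleton]
      obtain ⟨y, hy⟩ := h1
      exact ⟨y, (mul_cancel_left_mem_nonZeroDivisors ht).1 (by rw [hy]; ring)⟩
    have hfg : Function.Exact f g := by
      intro x
      obtain ⟨x, rfl⟩ := Ideal.Quotient.mk_surjective x
      constructor
      · intro hx
        have h1 : Ideal.Quotient.mk (Ideal.span {t}) x = 0 := hx
        rw [Ideal.Quotient.eq_zero_iff_mem, Ideal.mem_span_singleton] at h1
        obtain ⟨y, rfl⟩ := h1
        exact ⟨Ideal.Quotient.mk _ y, rfl⟩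
      · rintro ⟨y, hy⟩
        obtain ⟨y, rfl⟩ := Ideal.Quotient.mk_surjective y
        rw [← hy]
        change Ideal.Quotient.mk (Ideal.span {t}) (t * y) = 0
        rw [Ideal.Quotient.eq_zero_iff_mem, Ideal.mem_span_singleton]
        exact dvd_mul_right _ _
    refine (length_powTorsion_le f g hf hfg).trans ?_
    push_cast
    rw [add_mul, one_mul]
    gcongr

end PowTorsion

/-! ### Powers of `t` localised at a prime -/

section SymbolicPower

variable {S : Type*} [CommRing S]

/-- The elements of `S` that are divisible by `t` after localisation at `Q`. -/
def localSpan (t : S) (Q : Ideal S) [hQ : Q.IsPrime] : Ideal S where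
  carrier := {f | ∃ s ∉ Q, t ∣ s * f}
  zero_mem' := ⟨1, hQ.one_notMem, by simp⟩
  add_mem' := by
    rintro f g ⟨s, hs, hf⟩ ⟨u, hu, hg⟩
    refine ⟨s * u, hQ.mul_notMem hs hu, ?_⟩
    have : s * u * (f + g) = u * (s * f) + s * (u * g) := by ring
    rw [this]
    exact dvd_add (hf.mul_left _) (hg.mul_left _)
  smul_mem' := by
    rintro c f ⟨s, hs, hf⟩
    exact ⟨s, hs, by rw [smul_eq_mul, mul_left_comm]; exact hf.mul_left _⟩

/-- Multiplication by `t` embeds the quotient for `tᵏ` into that for `tᵏ⁺¹`. The cokernel is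
non-zero because `t ∈ Q`, so each step adds at least one to the length. -/
theorem le_length_quotient_localSpan (R : Type*) [CommRing R] [Algebra R S] {t : S}
    (ht : t ∈ nonZeroDivisors S)
    {Q : Ideal S} [hQ : Q.IsPrime] (htQ : t ∈ Q) (k : ℕ) :
    (k : ℕ∞) ≤ Module.length R (S ⧸ localSpan (t ^ k) Q) := by
  induction k with
  | zero => simp
  | succ k ih =>
    let f : (S ⧸ localSpan (t ^ k) Q) →ₗ[S] (S ⧸ localSpan (t ^ (k + 1)) Q) :=
      Submodule.mapQ _ _ (LinearMap.mulLeft S t) (by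
        rintro x ⟨s, hs, hx⟩
        refine ⟨s, hs, ?_⟩
        rw [LinearMap.mulLeft_apply, pow_succ', mul_left_comm]
        exact mul_dvd_mul_left _ hx)
    have hf : Function.Injective f := by
      rw [injective_iff_map_eq_zero]
      intro x hx
      obtain ⟨x, rfl⟩ := Ideal.Quotient.mk_surjective x
      have h1 : Ideal.Quotient.mk (localSpan (t ^ (k + 1)) Q) (t * x) = 0 := hx
      rw [Ideal.Quotient.eq_zero_iff_mem] at h1 ⊢
      obtain ⟨s, hs, y, hy⟩ := h1
      exact ⟨s, hs, y, (mul_cancel_left_mem_nonZeroDivisors ht).1 (by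
        rw [mul_left_comm, hy]; ring)⟩
    let f' := f.restrictScalars R
    have hne : Nontrivial ((S ⧸ localSpan (t ^ (k + 1)) Q) ⧸ LinearMap.range f') := by
      rw [Submodule.Quotient.nontrivial_iff]
      intro htop
      have h1 : Ideal.Quotient.mk (localSpan (t ^ (k + 1)) Q) 1 ∈ LinearMap.range f' := by
        rw [htop]; trivial
      obtain ⟨y, hy⟩ := h1
      obtain ⟨y, rfl⟩ := Ideal.Quotient.mk_surjective y
      have h2 : Ideal.Quotient.mk (localSpan (t ^ (k + 1)) Q) (t * y) =
        Ideal.Quotient.mk (localSpan (t ^ (k + 1)) Q) 1 := hy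
      rw [Ideal.Quotient.eq] at h2
      obtain ⟨s, hs, hd⟩ := h2
      have h3 : s * (t * y - 1) ∈ Q := Q.mem_of_dvd (dvd_trans (dvd_pow_self t (by simp)) hd) htQ
      have h4 : t * y - 1 ∈ Q := (hQ.mem_or_mem h3).resolve_left hs
      have h5 : t * y ∈ Q := Q.mul_mem_right _ htQ
      exact hQ.one_notMem (by simpa using Q.sub_mem h5 h4)
    rw [Module.length_eq_add_of_exact f' (LinearMap.range f').mkQ hf
      (Submodule.mkQ_surjective _) (LinearMap.exact_map_mkQ_range f')]
    push_cast
    exact add_le_add ih (Order.one_le_iff_pos.2 Module.length_pos)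

end SymbolicPower

section SymbolicPower

variable {S : Type*} [CommRing S] [IsNoetherianRing S]

theorem exists_forall_dvd_of_mem_localSpan (t : S) (Q : Ideal S) [hQ : Q.IsPrime] :
    ∃ w ∉ Q, ∀ x ∈ localSpan t Q, t ∣ w * x := by
  classical
  obtain ⟨G, hG⟩ := IsNoetherian.noetherian (localSpan t Q)
  have hmem : ∀ x : G, (x : S) ∈ localSpan t Q := fun x => hG ▸ Submodule.subset_span x.2
  choose s hs hd using hmem
  refine ⟨∏ g, s g, fun h => ?_, fun x hx => ?_⟩
  · obtain ⟨g, -, hg⟩ := (hQ.prod_mem_iff).1 h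
    exact hs g hg
  · rw [← hG] at hx
    induction hx using Submodule.span_induction with
    | mem x hx =>
      exact (hd ⟨x, hx⟩).trans (mul_dvd_mul_right (Finset.dvd_prod_of_mem s (Finset.mem_univ _)) x)
    | zero => simp
    | add x y _ _ hx hy => rw [mul_add]; exact dvd_add hx hy
    | smul c x _ hx => rw [smul_eq_mul, mul_left_comm]; exact hx.mul_left _

/-- Minimality puts `Q` in the radical of `localSpan (t ^ k) Q`, so a power of the finitely
generated `Q` lies in that ideal. The element `w` is a common denominator. -/
theorem exists_pow_forall_dvd {t : S} {Q : Ideal S}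
    (hQ : Q ∈ (Ideal.span {t}).minimalPrimes) (k : ℕ) :
    ∃ w ∉ Q, ∃ m : ℕ, ∀ x ∈ Q ^ m, t ^ k ∣ w * x := by
  have hQp : Q.IsPrime := hQ.1.1
  obtain ⟨w, hw, H⟩ := exists_forall_dvd_of_mem_localSpan (t ^ k) Q
  have hle : Q ≤ (localSpan (t ^ k) Q).radical := fun a ha => by
    obtain ⟨s, hs, n, hd⟩ := (mem_minimalPrimes_span_iff.1 hQ).2 a ha
    refine ⟨n * k, s ^ k, fun h => hs (hQp.mem_of_pow_mem k h), ?_⟩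
    rw [pow_mul, ← mul_pow]
    exact pow_dvd_pow_of_dvd hd k
  obtain ⟨m, hm⟩ := Ideal.exists_pow_le_of_le_radical_of_fg hle (IsNoetherian.noetherian Q)
  exact ⟨w, hw, m, fun x hx => H x (hm hx)⟩

/-- Approximate idempotents at a minimal prime `Q` of `t` that is maximal. -/
theorem exists_approx_idempotent {t : S} {Q : Ideal S} [hmax : Q.IsMaximal]
    (hQ : Q ∈ (Ideal.span {t}).minimalPrimes) (k : ℕ) :
    ∃ u : S, 1 - u ∈ localSpan (t ^ k) Q ∧ ∃ m : ℕ, ∀ x ∈ Q ^ m, t ^ k ∣ x * u := by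
  obtain ⟨w, hw, m, H⟩ := exists_pow_forall_dvd hQ k
  -- With `y w + i = 1` and `u = 1 - iᵐ`: locally at `Q` the element `1 - u = iᵐ` is divisible by
  -- `tᵏ`, while `w ∣ 1 - i ∣ u` makes `u` send `Qᵐ` into `tᵏ S`.
  obtain ⟨y, i, hi, hyi⟩ := hmax.exists_inv hw
  refine ⟨1 - i ^ m, ⟨w, hw, ?_⟩, m, fun x hx => ?_⟩
  · rw [sub_sub_cancel]
    exact H _ (Ideal.pow_mem_pow hi m)
  · have h1 : w ∣ 1 - i ^ m := by
      have h2 : 1 - i ∣ 1 - i ^ m := one_sub_dvd_one_sub_pow i m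
      exact (Dvd.intro_left y (by rw [← hyi]; ring)).trans h2
    rw [mul_comm]
    exact (H x hx).trans (mul_dvd_mul_right h1 x)

end SymbolicPower

/-! ### Counting minimal primes by lengths -/

section Count

variable {R S : Type*} [CommRing R] [IsDomain R] [IsNoetherianRing R] [CommRing S] [IsDomain S]
  [IsNoetherianRing S] [Algebra R S]

omit [IsDomain R] [IsNoetherianRing R] in
-- The `𝔪`-power torsion of `S / t^(h+e)`, lifted to `E ⊆ S`, maps onto the product of the `n`
-- quotients `S ⧸ localSpan (t ^ h) (Q i)`, each of length at least `h`. Multiplication by the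
-- conductor element `c` maps `E` to torsion in `R / t^(h+e)`, and `e` is large enough that the loss
-- caused by `c` is invisible in the product.
theorem card_mul_le_length (hinj : Function.Injective (algebraMap R S)) {𝔪 : Ideal R}
    {t : R} (ht : t ≠ 0) {c : R} (hc : c ≠ 0)
    (hcS : ∀ s : S, ∃ r, algebraMap R S r = algebraMap R S c * s) {n : ℕ} (Q : Fin n → Ideal S)
    (hQ : Function.Injective Q) (hmax : ∀ i, (Q i).IsMaximal)
    (hmin : ∀ i, Q i ∈ (Ideal.span {algebraMap R S t}).minimalPrimes)
    (hle : ∀ i, 𝔪 ≤ (Q i).comap (algebraMap R S)) :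
    ∃ e : ℕ, ∀ h : ℕ, (n * h : ℕ∞) ≤
      Module.length R (powTorsion 𝔪 (R ⧸ Ideal.span {t ^ (h + e)})) := by
  classical
  set T := algebraMap R S t with hT
  have hT0 : T ≠ 0 := by rwa [hT, Ne, map_eq_zero_iff _ hinj]
  have hprime : ∀ i, (Q i).IsPrime := fun i => (hmax i).isPrime
  have hc0 : algebraMap R S c ≠ 0 := by rwa [Ne, map_eq_zero_iff _ hinj]
  -- Krull's theorem at each `Q i`: locally `c` divides a power of `T`. The largest exponent is the
  -- required shift.
  choose s hs e he using fun i => exists_dvd_mul_pow_of_mem_minimalPrimes (hmin i) hc0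
  set e₀ := Finset.univ.sup e
  have he₀ : ∀ i, algebraMap R S c ∣ s i * T ^ e₀ := fun i => (he i).trans
    (mul_dvd_mul_left _ (pow_dvd_pow _ (Finset.le_sup (Finset.mem_univ i))))
  choose r hr using hcS
  let μ : S →ₗ[R] R :=
    { toFun := r
      map_add' := fun x y => hinj (by simp only [map_add, hr, mul_add])
      map_smul' := fun a x => hinj (by
        simp only [hr, smul_eq_mul, map_mul, RingHom.id_apply, Algebra.smul_def]; ring) }
  have hμ : ∀ x, algebraMap R S (μ x) = algebraMap R S c * x := hr
  refine ⟨e₀, fun h => ?_⟩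
  set k := h + e₀
  let πS : S →ₗ[R] (S ⧸ Ideal.span {T ^ k}) := (Ideal.Quotient.mkₐ R _).toLinearMap
  let E : Submodule R S := (powTorsion 𝔪 (S ⧸ Ideal.span {T ^ k})).comap πS
  have hE : ∀ x, x ∈ E ↔ ∃ m : ℕ, ∀ a ∈ 𝔪 ^ m, T ^ k ∣ algebraMap R S a * x := fun x => by
    refine exists_congr fun m => forall₂_congr fun a ha => ?_
    rw [← map_smul, Algebra.smul_def]
    exact Ideal.Quotient.eq_zero_iff_mem.trans Ideal.mem_span_singleton
  let πR : R →ₗ[R] (R ⧸ Ideal.span {t ^ k}) := (Ideal.Quotient.mkₐ R _).toLinearMap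
  have hπR : ∀ x, πR x = 0 ↔ t ^ k ∣ x := fun x =>
    Ideal.Quotient.eq_zero_iff_mem.trans Ideal.mem_span_singleton
  let θ : E →ₗ[R] powTorsion 𝔪 (R ⧸ Ideal.span {t ^ k}) :=
    (πR ∘ₗ μ ∘ₗ E.subtype).codRestrict _ fun x => by
      obtain ⟨m, hm⟩ := (hE x).1 x.2
      refine ⟨m, fun a ha => ?_⟩
      rw [← map_smul, LinearMap.comp_apply, hπR]
      obtain ⟨g, hg⟩ := hm a ha
      refine ⟨μ g, hinj ?_⟩
      simp only [LinearMap.comp_apply, Submodule.subtype_apply, map_smul, smul_eq_mul, map_mul, hμ,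
        map_pow]
      rw [← hT]
      linear_combination algebraMap R S c * hg
  let ψ : E →ₗ[R] (Π i, S ⧸ localSpan (T ^ h) (Q i)) :=
    LinearMap.pi fun i => (Ideal.Quotient.mkₐ R (localSpan (T ^ h) (Q i))).toLinearMap ∘ₗ E.subtype
  -- If `c x` is divisible by `T ^ (h + e₀)`, then locally at `Q i` so is `T ^ e₀ x`, since `c`
  -- divides `T ^ e₀` there. Cancelling leaves `T ^ h`.
  have hker : θ.ker ≤ ψ.ker := by
    intro x hx
    have h1 : t ^ k ∣ μ x := (hπR _).1 (congrArg Subtype.val hx)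
    obtain ⟨g, hg⟩ := h1
    have h2 : algebraMap R S c * x = T ^ k * algebraMap R S g := by
      rw [← hμ, hg, map_mul, map_pow]
    refine LinearMap.mem_ker.2 (funext fun i => Ideal.Quotient.eq_zero_iff_mem.2 ?_)
    obtain ⟨c', hc'⟩ := he₀ i
    refine ⟨s i, hs i, c' * algebraMap R S g, mul_left_cancel₀ (pow_ne_zero e₀ hT0) ?_⟩
    calc T ^ e₀ * (s i * x) = (s i * T ^ e₀) * x := by ring
      _ = c' * (algebraMap R S c * x) := by rw [hc']; ring
      _ = T ^ e₀ * (T ^ h * (c' * algebraMap R S g)) := by rw [h2]; simp only [k, pow_add]; ring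
  -- The approximate idempotents `u i` are congruent to `1` at `Q i` and to `0` at the other `Q j`,
  -- and their multiples lie in `E` because `𝔪` maps into `Q i`.
  have hsurj : Function.Surjective ψ := by
    choose u hu m hm using fun i => exists_approx_idempotent (hmin i) k
    have huE : ∀ i, ∀ x, u i * x ∈ E := fun i x => (hE _).2 ⟨m i, fun a ha => by
      rw [← mul_assoc]
      refine (hm i _ ?_).mul_right _
      have h1 : 𝔪.map (algebraMap R S) ≤ Q i := Ideal.map_le_iff_le_comap.2 (hle i)
      have h2 := Ideal.mem_map_of_mem (algebraMap R S) ha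
      rw [Ideal.map_pow] at h2
      exact Ideal.pow_right_mono h1 _ h2⟩
    have hkh : T ^ h ∣ T ^ k := pow_dvd_pow _ (Nat.le_add_right _ _)
    have hdiag : ∀ i, 1 - u i ∈ localSpan (T ^ h) (Q i) := fun i => by
      obtain ⟨v, hv, hd⟩ := hu i
      exact ⟨v, hv, hkh.trans hd⟩
    have hoff : ∀ i j, i ≠ j → u i ∈ localSpan (T ^ h) (Q j) := fun i j hij => by
      have hnle : ¬ Q i ≤ Q j := fun hle => hij (hQ ((hmax i).eq_of_le (hprime j).ne_top hle))
      obtain ⟨x, hxi, hxj⟩ := SetLike.not_le_iff_exists.1 hnle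
      exact ⟨x ^ m i, fun h => hxj ((hprime j).mem_of_pow_mem _ h),
        hkh.trans (hm i _ (Ideal.pow_mem_pow hxi _))⟩
    intro y
    choose z hz using fun i => Ideal.Quotient.mk_surjective (y i)
    refine ⟨∑ i, ⟨u i * z i, huE i (z i)⟩, funext fun j => ?_⟩
    have h1 : ψ (∑ i, ⟨u i * z i, huE i (z i)⟩) j =
        Ideal.Quotient.mk (localSpan (T ^ h) (Q j)) (∑ i, u i * z i) := by
      rw [map_sum, map_sum, Finset.sum_apply]
      rfl
    rw [h1, ← hz j, Ideal.Quotient.eq]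
    have h2 : ∑ i, u i * z i - z j =
        ∑ i ∈ Finset.univ.erase j, u i * z i - (1 - u j) * z j := by
      rw [← Finset.add_sum_erase _ _ (Finset.mem_univ j)]
      ring
    rw [h2]
    refine Ideal.sub_mem _ (Ideal.sum_mem _ fun i hi => ?_) (Ideal.mul_mem_right _ _ (hdiag j))
    exact Ideal.mul_mem_right _ _ (hoff i j (Finset.ne_of_mem_erase hi))
  have hlen1 : Module.length R (Π i, S ⧸ localSpan (T ^ h) (Q i)) ≤
      Module.length R (E ⧸ θ.ker) :=
    Module.length_le_of_surjective (θ.ker.liftQ ψ hker) fun y => by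
      obtain ⟨x, rfl⟩ := hsurj y
      exact ⟨Submodule.Quotient.mk x, rfl⟩
  have hlen2 : Module.length R (E ⧸ θ.ker) ≤
      Module.length R (powTorsion 𝔪 (R ⧸ Ideal.span {t ^ k})) :=
    Module.length_le_of_injective (θ.ker.liftQ θ le_rfl)
      (LinearMap.ker_eq_bot.1 (Submodule.ker_liftQ_eq_bot _ _ _ le_rfl))
  refine le_trans ?_ (hlen1.trans hlen2)
  rw [Module.length_pi_of_fintype]
  calc (n * h : ℕ∞) = ∑ _i : Fin n, (h : ℕ∞) := by simp
    _ ≤ _ := Finset.sum_le_sum fun i _ => le_length_quotient_localSpan R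
        (mem_nonZeroDivisors_of_ne_zero hT0) (mem_minimalPrimes_span_iff.1 (hmin i)).1 h

/-- The number of maximal ideals of a birational extension `S` of `R` that are minimal over `t` and
lie above `𝔪` is bounded in terms of `R` alone. -/
theorem card_le_length (hinj : Function.Injective (algebraMap R S)) {𝔪 : Ideal R} [𝔪.IsMaximal]
    {t : R} (ht : t ≠ 0) {c : R} (hc : c ≠ 0)
    (hcS : ∀ s : S, ∃ r, algebraMap R S r = algebraMap R S c * s) {n : ℕ} (Q : Fin n → Ideal S)
    (hQ : Function.Injective Q) (hmax : ∀ i, (Q i).IsMaximal)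
    (hmin : ∀ i, Q i ∈ (Ideal.span {algebraMap R S t}).minimalPrimes)
    (hle : ∀ i, 𝔪 ≤ (Q i).comap (algebraMap R S)) :
    (n : ℕ∞) ≤ Module.length R (powTorsion 𝔪 (R ⧸ Ideal.span {t})) := by
  obtain ⟨e, he⟩ := card_mul_le_length hinj ht hc hcS Q hQ hmax hmin hle
  obtain ⟨l, hl⟩ := ENat.ne_top_iff_exists.1
    (length_powTorsion_ne_top (I := 𝔪) (M := R ⧸ Ideal.span {t}))
  -- The two bounds give `n h ≤ (h + e) l` for all `h`. Taking `h = e l + 1` is enough to exclude `n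
  -- ≥ l + 1`.
  have h1 := (he (e * l + 1)).trans
    (length_powTorsion_quotient_pow_le (mem_nonZeroDivisors_of_ne_zero ht) _)
  rw [← hl] at h1 ⊢
  norm_cast at h1 ⊢
  by_contra! hcon
  have h2 : (l + 1) * (e * l + 1) ≤ n * (e * l + 1) := Nat.mul_le_mul_right _ hcon
  nlinarith

end Count

theorem exists_forall_smul_eq_zero_of_powTorsion {R M : Type*} [CommRing R] {I : Ideal R}
    [AddCommGroup M] [Module R M] (h : Nontrivial (powTorsion I M)) :
    ∃ y : M, y ≠ 0 ∧ ∀ a ∈ I, a • y = 0 := by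
  classical
  obtain ⟨⟨x, hx⟩, hx0⟩ := exists_ne (0 : powTorsion I M)
  have hx0 : x ≠ 0 := fun h => hx0 (Subtype.ext h)
  have hx' : ∃ n : ℕ, ∀ a ∈ I ^ n, a • x = 0 := hx
  have hfind := Nat.find_spec hx'
  have hmin := fun m => Nat.find_min hx' (m := m)
  obtain hn | ⟨n, hn⟩ : Nat.find hx' = 0 ∨ ∃ n, Nat.find hx' = n + 1 := by
    rcases Nat.find hx' with _ | n
    · exact .inl rfl
    · exact .inr ⟨n, rfl⟩
  · rw [hn, pow_zero] at hfind
    exact (hx0 (by simpa using hfind 1 (by simp))).elim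
  · rw [hn] at hfind
    have h1 := hmin n (by rw [hn]; exact Nat.lt_succ_self n)
    push Not at h1
    obtain ⟨b, hb, hbx⟩ := h1
    refine ⟨b • x, hbx, fun a ha => ?_⟩
    rw [smul_smul]
    exact hfind _ (by rw [pow_succ']; exact Ideal.mul_mem_mul ha hb)

/-- A prime `q` for which `R_q / t` has torsion supported at `q` is an associated prime of `t`. -/
theorem mem_associatedPrimes_of_powTorsion {R : Type*} [CommRing R] [IsNoetherianRing R]
    {q : Ideal R} [hq : q.IsPrime] {t : R}
    (h : Nontrivial (powTorsion (IsLocalRing.maximalIdeal (Localization.AtPrime q))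
      (Localization.AtPrime q ⧸ Ideal.span {algebraMap R (Localization.AtPrime q) t}))) :
    q ∈ associatedPrimes R (R ⧸ Ideal.span {t}) := by
  classical
  obtain ⟨y, hy0, hy⟩ := exists_forall_smul_eq_zero_of_powTorsion h
  obtain ⟨y, rfl⟩ := Ideal.Quotient.mk_surjective y
  obtain ⟨x, s, rfl⟩ := IsLocalization.exists_mk'_eq q.primeCompl y
  set L := Localization.AtPrime q
  have hdvd : ∀ z, algebraMap R L t ∣ algebraMap R L z ↔ z ∈ localSpan t q := by
    refine fun z => ⟨?_, ?_⟩
    · rintro ⟨w, hw⟩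
      obtain ⟨g, v, rfl⟩ := IsLocalization.exists_mk'_eq q.primeCompl w
      rw [IsLocalization.mul_mk'_eq_mk'_of_mul, eq_comm, IsLocalization.mk'_eq_iff_eq_mul,
        ← map_mul, IsLocalization.eq_iff_exists q.primeCompl] at hw
      obtain ⟨u, hu⟩ := hw
      exact ⟨u * v, hq.mul_notMem u.2 v.2, u * g, by linear_combination -hu⟩
    · rintro ⟨u, hu, hd⟩
      have h1 := map_dvd (algebraMap R L) hd
      rwa [map_mul, (IsLocalization.map_units L (⟨u, hu⟩ : q.primeCompl)).dvd_mul_left] at h1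
  have hmk : ∀ z, algebraMap R L t ∣ algebraMap R L z * IsLocalization.mk' L x s ↔
      z * x ∈ localSpan t q := fun z => by
    rw [← hdvd, ← (IsLocalization.map_units L s).dvd_mul_right, mul_assoc,
      IsLocalization.mk'_spec, map_mul]
  -- The factor `w` turns local divisibility by `t` into actual divisibility, so the annihilator of
  -- `w x` modulo `t` in `R` is exactly `q`.
  obtain ⟨w, hw, hwd⟩ := exists_forall_dvd_of_mem_localSpan t q
  rw [AssociatedPrimes.mem_iff, isAssociatedPrime_iff]
  refine ⟨hq, Ideal.Quotient.mk _ (w * x), ?_⟩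
  ext a
  rw [Submodule.mem_colon_singleton, Submodule.mem_bot, ← Ideal.Quotient.mk_eq_mk, ← Submodule.Quotient.mk_smul,
    Ideal.Quotient.mk_eq_mk, Ideal.Quotient.eq_zero_iff_mem, Ideal.mem_span_singleton, smul_eq_mul]
  constructor
  · intro ha
    have h1 := hy (algebraMap R L a) (by
      rw [← Localization.AtPrime.under_maximalIdeal (I := q)] at ha
      exact ha)
    have h2 : algebraMap R L t ∣ algebraMap R L a * IsLocalization.mk' L x s :=
      Ideal.mem_span_singleton.1 (Ideal.Quotient.eq_zero_iff_mem.1 h1)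
    rw [mul_left_comm]
    exact hwd _ ((hmk a).1 h2)
  · intro ha
    by_contra haq
    refine hy0 (Ideal.Quotient.eq_zero_iff_mem.2 (Ideal.mem_span_singleton.2 ?_))
    have h1 := (hmk 1).2 ⟨a * w, hq.mul_notMem haq hw, by rwa [one_mul, mul_assoc]⟩
    simpa using h1

/-! ### Minimal primes at a finite level -/

section Birational

variable {R A : Type*} [CommRing R] [IsNoetherianRing R] [CommRing A] [Algebra R A]
  [Algebra.IsIntegral R A]

omit [IsNoetherianRing R] in
-- A prime of `B'` over `t` inside `p ∩ B'` has the same contraction to `B` by minimality there,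
-- hence the same contraction to `R`; incomparability makes the primes equal.
theorem comap_mem_minimalPrimes_of_le {B B' : Subalgebra R A} (h : B ≤ B') {t : R} {p : Ideal A}
    [p.IsPrime] (hp : p.comap B.val ∈ (Ideal.span {algebraMap R B t}).minimalPrimes) :
    p.comap B'.val ∈ (Ideal.span {algebraMap R B' t}).minimalPrimes := by
  refine ⟨⟨inferInstance, ?_⟩, fun P hP hPp => ?_⟩
  · rw [Ideal.span_singleton_le_iff_mem]
    have := (Ideal.span_singleton_le_iff_mem (p.comap B.val)).1 hp.1.2
    exact this
  · have hP' := hP.1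
    have ht := (Ideal.span_singleton_le_iff_mem _).1 hP.2
    have h1 : p.comap B.val ≤ P.comap (Subalgebra.inclusion h) :=
      hp.2 ⟨inferInstance, by rwa [Ideal.span_singleton_le_iff_mem]⟩ fun x hx => hPp hx
    refine (eq_comap_of_le hPp (G := (p.comap (algebraMap R A) : Set R)) (Ideal.span_eq _)
      fun a ha => ?_).ge
    exact h1 (x := algebraMap R B a) ha

/-- Finitely many minimal primes of `t` are already minimal at a common finite level. -/
theorem exists_fg_forall_comap_mem_minimalPrimes {t : R} {n : ℕ} (Q : Fin n → Ideal A)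
    (hQ : ∀ i, Q i ∈ (Ideal.span {algebraMap R A t}).minimalPrimes) (E : Finset A) :
    ∃ B : Subalgebra R A, B.FG ∧ (E : Set A) ⊆ B ∧
      ∀ i, (Q i).comap B.val ∈ (Ideal.span {algebraMap R B t}).minimalPrimes := by
  classical
  choose B hB hE ht hmin using fun i => exists_fg_comap_mem_minimalPrimes R (hQ i) E
  choose s hs using hB
  let s' := E ∪ Finset.univ.biUnion s
  refine ⟨Algebra.adjoin R s', ⟨s', rfl⟩, fun x hx => Algebra.subset_adjoin (by
    simp only [s', Finset.coe_union]; exact .inl hx), fun i => ?_⟩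
  have hle : B i ≤ Algebra.adjoin R s' := by
    rw [← hs i]
    refine Algebra.adjoin_mono fun x hx => ?_
    simp only [s', Finset.coe_union, Finset.coe_biUnion]
    exact .inr (Set.mem_biUnion (Finset.mem_coe.2 (Finset.mem_univ i)) hx)
  have := (hQ i).1.1
  exact comap_mem_minimalPrimes_of_le hle (hmin i)

end Birational

/-! ### Finiteness of minimal primes in birational integral extensions -/

section Finiteness

variable {R A : Type*} [CommRing R] [IsDomain R] [IsNoetherianRing R] [CommRing A] [IsDomain A]
  [Algebra R A] [Algebra.IsIntegral R A]

/-- After localisation at `q` the primes `Q i` lie over the maximal ideal of `R_q`, hence are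
maximal by integrality, and `card_le_length` applies. -/
theorem card_le_length_localization_of_conductor [IsNoetherianRing A]
    (hinj : Function.Injective (algebraMap R A)) {t : R} (ht : t ≠ 0) {c : R} (hc : c ≠ 0)
    (hcA : ∀ s : A, ∃ r, algebraMap R A r = algebraMap R A c * s) {q : Ideal R} [hq : q.IsPrime]
    {n : ℕ} (Q : Fin n → Ideal A) (hQ : Function.Injective Q)
    (hmin : ∀ i, Q i ∈ (Ideal.span {algebraMap R A t}).minimalPrimes)
    (hcomap : ∀ i, (Q i).comap (algebraMap R A) = q) :
    (n : ℕ∞) ≤ Module.length (Localization.AtPrime q)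
      (powTorsion (IsLocalRing.maximalIdeal (Localization.AtPrime q))
        (Localization.AtPrime q ⧸ Ideal.span {algebraMap R (Localization.AtPrime q) t})) := by
  let M := Algebra.algebraMapSubmonoid A q.primeCompl
  let S := Localization M
  let L := Localization.AtPrime q
  have hM0 : M ≤ nonZeroDivisors A := by
    rintro _ ⟨x, hx, rfl⟩
    refine mem_nonZeroDivisors_of_ne_zero fun h => hx ?_
    rw [(map_eq_zero_iff _ hinj).1 h]
    exact q.zero_mem
  have hL0 : Function.Injective (algebraMap R L) :=
    IsLocalization.injective L q.primeCompl_le_nonZeroDivisors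
  have : IsDomain S := IsLocalization.isDomain_of_le_nonZeroDivisors (M := M) S hM0
  have : IsNoetherianRing S := IsLocalization.isNoetherianRing M S inferInstance
  have : IsDomain L := IsLocalization.isDomain_localization q.primeCompl_le_nonZeroDivisors
  have : IsNoetherianRing L := IsLocalization.isNoetherianRing q.primeCompl L inferInstance
  let _ : Algebra L S := localizationAlgebra q.primeCompl A
  have : Algebra.IsIntegral L S :=
    ⟨isIntegral_localization (M := q.primeCompl) (R := R) (S := A) (Rₘ := L) (Sₘ := S)⟩
  have hLS : Function.Injective (algebraMap L S) :=
    localizationAlgebra_injective (M := q.primeCompl) L S hinj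
  have halg : ∀ r, algebraMap L S (algebraMap R L r) = algebraMap A S (algebraMap R A r) :=
    fun r => IsLocalization.map_eq _ r
  have hQp : ∀ i, (Q i).IsPrime := fun i => (hmin i).1.1
  have hdis : ∀ i, Disjoint (M : Set A) (Q i : Set A) := by
    intro i
    rw [Set.disjoint_left]
    rintro _ ⟨x, hx, rfl⟩ h
    exact hx (hcomap i ▸ h)
  let P i := (Q i).map (algebraMap A S)
  have hP : ∀ i, (P i).IsPrime := fun i =>
    IsLocalization.isPrime_of_isPrime_disjoint M S _ (hQp i) (hdis i)
  have hPQ : ∀ i, (P i).comap (algebraMap A S) = Q i := fun i =>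
    IsLocalization.under_map_of_isPrime_disjoint M S (hQp i) (hdis i)
  have hle : ∀ i, IsLocalRing.maximalIdeal L ≤ (P i).comap (algebraMap L S) := by
    intro i
    rw [← Localization.AtPrime.map_eq_maximalIdeal, Ideal.map_le_iff_le_comap]
    intro r hr
    change algebraMap L S (algebraMap R L r) ∈ P i
    rw [halg]
    exact Ideal.mem_map_of_mem _ (show r ∈ (Q i).comap (algebraMap R A) by rwa [hcomap])
  refine card_le_length (S := S) hLS ((map_ne_zero_iff _ hL0).2 ht) ((map_ne_zero_iff _ hL0).2 hc)
    (fun s => ?_) P (fun i j h => hQ (by rw [← hPQ i, ← hPQ j, h])) (fun i => ?_) (fun i => ?_) hle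
  · obtain ⟨a, ⟨_, u, hu, rfl⟩, rfl⟩ := IsLocalization.exists_mk'_eq M s
    obtain ⟨r, hr⟩ := hcA a
    refine ⟨IsLocalization.mk' L r (⟨u, hu⟩ : q.primeCompl), ?_⟩
    have hu' : IsUnit (algebraMap A S (algebraMap R A u)) :=
      IsLocalization.map_units S (⟨_, u, hu, rfl⟩ : M)
    refine hu'.mul_left_injective ?_
    change _ * algebraMap A S (algebraMap R A u) = algebraMap L S (algebraMap R L c) * _ * _
    have h1 : IsLocalization.mk' L r (⟨u, hu⟩ : q.primeCompl) * algebraMap R L u =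
        algebraMap R L r := IsLocalization.mk'_spec L r (⟨u, hu⟩ : q.primeCompl)
    have h2 := congrArg (algebraMap L S) h1
    rw [map_mul, halg, halg, hr] at h2
    rw [h2, mul_assoc, halg, map_mul]
    exact congrArg _ (IsLocalization.mk'_spec S a (⟨_, u, hu, rfl⟩ : M)).symm
  · have : ((P i).comap (algebraMap L S)).IsMaximal := by
      rw [← (IsLocalRing.maximalIdeal.isMaximal L).eq_of_le
        (Ideal.IsPrime.ne_top inferInstance) (hle i)]
      infer_instance
    exact Ideal.isMaximal_of_isIntegral_of_isMaximal_comap (P i) this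
  · refine ⟨⟨hP i, ?_⟩, fun P' hP' hle' => ?_⟩
    · rw [Ideal.span_singleton_le_iff_mem, halg]
      exact Ideal.mem_map_of_mem _ ((Ideal.span_singleton_le_iff_mem _).1 (hmin i).1.2)
    · have hP'1 := hP'.1
      refine Ideal.map_le_iff_le_comap.2 ((hmin i).2 ⟨inferInstance, ?_⟩ ?_)
      · rw [Ideal.span_singleton_le_iff_mem, Ideal.mem_comap, ← halg]
        exact (Ideal.span_singleton_le_iff_mem _).1 hP'.2
      · rw [← hPQ i]
        exact Ideal.comap_mono hle'

omit [IsNoetherianRing R] [IsDomain A] in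
-- A finitely generated integral algebra is a finite module; the product of denominators of module
-- generators works.
theorem exists_conductor
    (hbir : ∀ a : A, ∃ c : R, c ≠ 0 ∧ ∃ r, algebraMap R A r = algebraMap R A c * a)
    {B : Subalgebra R A} (hB : B.FG) :
    ∃ c : R, c ≠ 0 ∧ ∀ b : B, ∃ r, algebraMap R B r = algebraMap R B c * b := by
  classical
  have h1 : (Subalgebra.toSubmodule B).FG := by
    obtain ⟨G, hG⟩ := hB
    rw [← hG]
    exact fg_adjoin_of_finite G.finite_toSet fun x _ => Algebra.IsIntegral.isIntegral x
  obtain ⟨G, hG⟩ := h1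
  choose c hc r hr using hbir
  refine ⟨∏ g ∈ G, c g, Finset.prod_ne_zero_iff.2 fun g _ => hc g, ?_⟩
  rintro ⟨b, hb⟩
  suffices ∃ r, algebraMap R A r = algebraMap R A (∏ g ∈ G, c g) * b by
    obtain ⟨r, hr⟩ := this
    exact ⟨r, Subtype.ext hr⟩
  replace hb : b ∈ Submodule.span R (G : Set A) := hG ▸ hb
  induction hb using Submodule.span_induction with
  | mem x hx =>
    rw [← Finset.prod_erase_mul _ _ hx]
    exact ⟨(∏ g ∈ G.erase x, c g) * r x, by rw [map_mul, map_mul, hr, mul_assoc]⟩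
  | zero => exact ⟨0, by simp⟩
  | add x y _ _ hx hy =>
    obtain ⟨u, hu⟩ := hx
    obtain ⟨v, hv⟩ := hy
    exact ⟨u + v, by rw [map_add, hu, hv, mul_add]⟩
  | smul d x _ hx =>
    obtain ⟨u, hu⟩ := hx
    exact ⟨d * u, by rw [map_mul, hu, Algebra.smul_def, mul_left_comm]⟩

theorem card_le_length_localization (hinj : Function.Injective (algebraMap R A))
    (hbir : ∀ a : A, ∃ c : R, c ≠ 0 ∧ ∃ r, algebraMap R A r = algebraMap R A c * a)
    {t : R} (ht : t ≠ 0) {q : Ideal R} [hq : q.IsPrime]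
    {n : ℕ} (Q : Fin n → Ideal A) (hQ : Function.Injective Q)
    (hmin : ∀ i, Q i ∈ (Ideal.span {algebraMap R A t}).minimalPrimes)
    (hcomap : ∀ i, (Q i).comap (algebraMap R A) = q) :
    (n : ℕ∞) ≤ Module.length (Localization.AtPrime q)
      (powTorsion (IsLocalRing.maximalIdeal (Localization.AtPrime q))
        (Localization.AtPrime q ⧸ Ideal.span {algebraMap R (Localization.AtPrime q) t})) := by
  classical
  -- The separating elements are put into `B` so that the contractions of the `Q i` to `B` remain
  -- distinct.
  have hsep : ∀ i j, ∃ x : A, i ≠ j → x ∈ Q i ∧ x ∉ Q j := by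
    intro i j
    by_cases hij : i = j
    · exact ⟨0, fun h => (h hij).elim⟩
    · have : ¬ Q i ≤ Q j := fun h => hij (hQ (le_antisymm h ((hmin j).2 (hmin i).1 h)))
      obtain ⟨x, hx⟩ := SetLike.not_le_iff_exists.1 this
      exact ⟨x, fun _ => hx⟩
  choose x hx using hsep
  obtain ⟨B, hB, hE, hBmin⟩ := exists_fg_forall_comap_mem_minimalPrimes Q hmin
    (Finset.univ.image fun ij : Fin n × Fin n => x ij.1 ij.2)
  have hxB : ∀ i j, x i j ∈ B := fun i j => hE (by simp)
  have : IsNoetherianRing B := isNoetherianRing_of_fg hB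
  have : Algebra.IsIntegral R B := .of_injective B.val Subtype.val_injective
  obtain ⟨c, hc, hcB⟩ := exists_conductor hbir hB
  refine card_le_length_localization_of_conductor (A := B)
    (fun a b h => hinj (congrArg Subtype.val h)) ht hc hcB (fun i => (Q i).comap B.val)
    (fun i j h => ?_) hBmin (fun i => ?_)
  · by_contra hij
    have h1 : (⟨x i j, hxB i j⟩ : B) ∈ (Q i).comap B.val := (hx i j hij).1
    have h' : (Q i).comap B.val = (Q j).comap B.val := h
    rw [h'] at h1
    exact (hx i j hij).2 h1
  · exact hcomap i

/-- An element of a Noetherian domain has only finitely many minimal primes in any integral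
birational extension. -/
theorem finite_minimalPrimes_of_birational (hinj : Function.Injective (algebraMap R A))
    (hbir : ∀ a : A, ∃ c : R, c ≠ 0 ∧ ∃ r, algebraMap R A r = algebraMap R A c * a)
    {t : R} (ht : t ≠ 0) : (Ideal.span {algebraMap R A t}).minimalPrimes.Finite := by
  have key : ∀ (q : Ideal R) [q.IsPrime] {n : ℕ} (Q : Fin n → Ideal A),
      Function.Injective Q → (∀ i, Q i ∈ (Ideal.span {algebraMap R A t}).minimalPrimes) →
      (∀ i, (Q i).comap (algebraMap R A) = q) → (n : ℕ∞) ≤ Module.length (Localization.AtPrime q)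
      (powTorsion (IsLocalRing.maximalIdeal (Localization.AtPrime q))
        (Localization.AtPrime q ⧸ Ideal.span {algebraMap R (Localization.AtPrime q) t})) :=
    fun q _ n Q hQ hmin hcomap => card_le_length_localization hinj hbir ht Q hQ hmin hcomap
  -- The bound with `n = 1` shows that each contraction to `R` carries non-zero torsion, so it is
  -- one of the finitely many associated primes of `t`. The bound for arbitrary `n` makes every
  -- fibre finite.
  refine Set.Finite.of_finite_fibers (fun Q : Ideal A => Q.comap (algebraMap R A))
    ((associatedPrimes.finite R (R ⧸ Ideal.span {t})).subset ?_) ?_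
  · rintro _ ⟨Q, hQ, rfl⟩
    have := hQ.1.1
    refine mem_associatedPrimes_of_powTorsion (t := t) ?_
    rw [← Module.length_pos_iff (R := Localization.AtPrime (Q.comap (algebraMap R A)))]
    refine lt_of_lt_of_le ?_ (key (Q.comap (algebraMap R A)) (n := 1) (fun _ => Q)
      (fun _ _ _ => Subsingleton.elim _ _) (fun _ => hQ) fun _ => rfl)
    simp
  · rintro _ ⟨Q, hQ, rfl⟩
    have := hQ.1.1
    set q := Q.comap (algebraMap R A)
    by_contra hinf
    have hinf : Set.Infinite _ := hinf
    obtain ⟨l, hl⟩ := ENat.ne_top_iff_exists.1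
      (length_powTorsion_ne_top (I := IsLocalRing.maximalIdeal (Localization.AtPrime q))
        (M := Localization.AtPrime q ⧸ Ideal.span {algebraMap R (Localization.AtPrime q) t}))
    let e := hinf.natEmbedding
    have h1 := key q (n := l + 1) (fun i => (e i : Ideal A))
      (fun i j h => Fin.ext (e.injective (Subtype.ext h))) (fun i => (e i).2.1) fun i => (e i).2.2
    rw [← hl] at h1
    norm_cast at h1
    omega

end Finiteness

/-! ### Contraction of minimal primes along a field extension -/

section RationalPart

open Polynomial

variable {R K L : Type*} [CommRing R] [Field K] [Field L] [Algebra R K] [Algebra K L] [Algebra R L]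
  [IsScalarTower R K L]

/-- The inclusion of the integral closures of `R` in a tower of fields. -/
def integralClosureMap (R K L : Type*) [CommRing R] [Field K] [Field L] [Algebra R K]
    [Algebra K L] [Algebra R L] [IsScalarTower R K L] :
    integralClosure R K →ₐ[R] integralClosure R L :=
  ((IsScalarTower.toAlgHom R K L).comp (integralClosure R K).val).codRestrict _ fun x =>
    IsIntegral.map (IsScalarTower.toAlgHom R K L) x.2

theorem coe_integralClosureMap (x : integralClosure R K) :
    (integralClosureMap R K L x : L) = algebraMap K L x := rfl

/-- The minimal polynomial divides a monic polynomial over `R`, and coefficients of monic factors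
are integral. Normality of `R` is not needed. -/
theorem isIntegral_coeff_minpoly {x : L} (hx : IsIntegral R x) (i : ℕ) :
    IsIntegral R ((minpoly K x).coeff i) := by
  obtain ⟨f, hf, hfx⟩ := hx
  have h1 : IsIntegral K x := (show IsIntegral R x from ⟨f, hf, hfx⟩).tower_top
  have hd : minpoly K x ∣ f.map (algebraMap R K) := minpoly.dvd _ _ (by
    rw [aeval_map_algebraMap]; exact hfx)
  have h2 := integralClosure.mem_lifts_of_monic_of_dvd_map K hf (minpoly.monic h1) hd
  obtain ⟨y, hy⟩ := (lifts_iff_coeff_lifts _).1 h2 i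
  rw [← hy]
  exact y.2

theorem minpoly_algebraMap_mul {ρ : K} (hρ : ρ ≠ 0) {x : L} (hx : IsIntegral K x) :
    minpoly K (algebraMap K L ρ * x) = (minpoly K x).scaleRoots ρ := by
  symm
  refine minpoly.unique _ _ ((monic_scaleRoots_iff _).2 (minpoly.monic hx))
    (scaleRoots_aeval_eq_zero (minpoly.aeval _ _)) fun q hq hqx => ?_
  have h1 : aeval x (q.scaleRoots ρ⁻¹) = 0 := by
    have := scaleRoots_aeval_eq_zero (r := ρ⁻¹) hqx
    rwa [← mul_assoc, ← map_mul, inv_mul_cancel₀ hρ, map_one, one_mul] at this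
  rw [degree_scaleRoots]
  have := minpoly.min K x ((monic_scaleRoots_iff ρ⁻¹).2 hq) h1
  rwa [degree_scaleRoots] at this

/-- The minimal primes of `t` in the integral closure of `R` in `L` lie over minimal primes of `t`
in the integral closure of `R` in `K`. -/
theorem comap_integralClosureMap_mem_minimalPrimes {t : R} (ht : algebraMap R K t ≠ 0)
    {p : Ideal (integralClosure R L)}
    (hp : p ∈ (Ideal.span {algebraMap R (integralClosure R L) t}).minimalPrimes) :
    p.comap (integralClosureMap R K L) ∈
      (Ideal.span {algebraMap R (integralClosure R K) t}).minimalPrimes := by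
  have hpp : p.IsPrime := hp.1.1
  obtain ⟨htp, H⟩ := mem_minimalPrimes_span_iff.1 hp
  have hpp' : (p.comap (integralClosureMap R K L)).IsPrime := inferInstance
  refine mem_minimalPrimes_span_iff.2 ⟨?_, fun a ha => ?_⟩
  · rwa [Ideal.mem_comap, AlgHom.commutes]
  by_cases ha0 : a = 0
  · exact ⟨1, fun h => hpp'.ne_top ((Ideal.eq_top_iff_one _).2 h), 1, by simp [ha0]⟩
  obtain ⟨s, hs, n, b, hb⟩ := H _ ha
  have hsR : IsIntegral R (s : L) := s.2
  have hsK : IsIntegral K (s : L) := hsR.tower_top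
  have ha0' : (a : K) ≠ 0 := fun h => ha0 (Subtype.ext h)
  -- The relation `s aⁿ = t b` becomes `b = ρ s` with `ρ ∈ K`, so the minimal polynomials of `b` and
  -- `s` over `K` differ by scaling roots.
  set ρ : K := (a : K) ^ n / algebraMap R K t with hρdef
  have hρ : ρ ≠ 0 := div_ne_zero (pow_ne_zero _ ha0') ht
  have hρt : ρ * algebraMap R K t = (a : K) ^ n := div_mul_cancel₀ _ ht
  have hbρ : (b : L) = algebraMap K L ρ * s := by
    have h1 : algebraMap R L t * (b : L) = s * algebraMap K L a ^ n :=
      (congrArg Subtype.val hb).symm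
    rw [← map_pow, ← hρt, map_mul, ← IsScalarTower.algebraMap_apply] at h1
    have ht' : algebraMap R L t ≠ 0 := by
      rw [IsScalarTower.algebraMap_apply R K L]
      exact (_root_.map_ne_zero _).2 ht
    refine mul_left_cancel₀ ht' (h1.trans ?_)
    ring
  set f := minpoly K (s : L) with hf
  let c : ℕ → integralClosure R K := fun i => ⟨f.coeff i, isIntegral_coeff_minpoly hsR i⟩
  -- If every lower coefficient of the minimal polynomial of `s` were in `p`, its equation would put
  -- a power of `s` in `p`.
  obtain ⟨i, hi, hci⟩ : ∃ i < f.natDegree, c i ∉ p.comap (integralClosureMap R K L) := by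
    by_contra! hcon
    have h1 : s ^ f.natDegree =
        -∑ i ∈ Finset.range f.natDegree, integralClosureMap R K L (c i) * s ^ i := by
      have h2 := minpoly.aeval K (s : L)
      rw [← hf, aeval_eq_sum_range, Finset.sum_range_succ, (minpoly.monic hsK).coeff_natDegree,
        one_smul] at h2
      rw [eq_neg_iff_add_eq_zero, add_comm]
      ext
      simpa [Algebra.smul_def, coe_integralClosureMap, c] using h2
    refine hs (hpp.mem_of_pow_mem f.natDegree ?_)
    rw [h1]
    exact neg_mem (Ideal.sum_mem _ fun i hi =>
      p.mul_mem_right _ (hcon i (Finset.mem_range.1 hi)))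
  -- This is the corresponding coefficient for `b = ρ s`. As `ρ t = aⁿ`, multiplying by `t ^ (j +
  -- 1)` shows that `c i` times a power of `a` is divisible by `t`.
  have hd : IsIntegral R (f.coeff i * ρ ^ (f.natDegree - i)) := by
    rw [← coeff_scaleRoots, hf, ← minpoly_algebraMap_mul hρ hsK, ← hbρ]
    exact isIntegral_coeff_minpoly b.2 i
  obtain ⟨j, hj⟩ : ∃ j, f.natDegree - i = j + 1 := ⟨f.natDegree - i - 1, by omega⟩
  rw [hj] at hd
  refine ⟨c i, hci, n * (j + 1), algebraMap R _ t ^ j * ⟨_, hd⟩, ?_⟩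
  ext
  change f.coeff i * (a : K) ^ (n * (j + 1)) =
    algebraMap R K t * (algebraMap R K t ^ j * (f.coeff i * ρ ^ (j + 1)))
  rw [pow_mul, ← hρt]
  ring

end RationalPart

/-! ### Finite tests for minimality over `t` -/

section FiniteTest

/-- Finitely many subsets of `A` detect the primes minimal over `t` among those containing `t`. -/
def HasFiniteMinimalityTest {A : Type*} [CommRing A] (t : A) : Prop :=
  ∃ F : Set (Set A), F.Finite ∧ ∀ P : Ideal A, P.IsPrime → t ∈ P →
    (P ∈ (Ideal.span {t}).minimalPrimes ↔ ∃ W ∈ F, Disjoint W P)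

theorem exists_fg_forall_mem_minimalPrimes_comap {R A : Type*} [CommRing R] [IsDomain R]
    [IsNoetherianRing R] [CommRing A] [IsDomain A] [Algebra R A] [Algebra.IsIntegral R A]
    (hinj : Function.Injective (algebraMap R A))
    (hbir : ∀ a : A, ∃ c : R, c ≠ 0 ∧ ∃ r, algebraMap R A r = algebraMap R A c * a)
    {t : R} (ht : t ≠ 0) :
    ∃ B : Subalgebra R A, B.FG ∧ ∀ Q ∈ (Ideal.span {algebraMap R A t}).minimalPrimes,
      Q.comap B.val ∈ (Ideal.span {algebraMap R B t}).minimalPrimes := by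
  have := (finite_minimalPrimes_of_birational hinj hbir ht).to_subtype
  obtain ⟨n, ⟨e⟩⟩ := Finite.exists_equiv_fin (Ideal.span {algebraMap R A t}).minimalPrimes
  obtain ⟨B, hB, -, H⟩ := exists_fg_forall_comap_mem_minimalPrimes (fun i => (e.symm i : Ideal A))
    (fun i => (e.symm i).2) ∅
  exact ⟨B, hB, fun Q hQ => by simpa using H (e ⟨Q, hQ⟩)⟩

theorem mem_minimalPrimes_of_comap_of_isIntegral {R A : Type*} [CommRing R] [CommRing A]
    {f : R →+* A} (hf : f.IsIntegral) {t : R} {P : Ideal A} [hP : P.IsPrime]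
    (h : P.comap f ∈ (Ideal.span {t}).minimalPrimes) :
    P ∈ (Ideal.span {f t}).minimalPrimes := by
  algebraize [f]
  refine ⟨⟨hP, ?_⟩, fun P' hP' hle => ?_⟩
  · rw [Ideal.span_singleton_le_iff_mem]
    exact (Ideal.span_singleton_le_iff_mem (P.comap f)).1 h.1.2
  · have := hP'.1
    by_contra hne
    have hlt := Ideal.IsIntegral.comap_lt_comap (R := R) (lt_of_le_not_ge hle hne)
    refine hlt.not_ge (h.2 ⟨inferInstance, ?_⟩ hlt.le)
    rw [Ideal.span_singleton_le_iff_mem]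
    exact (Ideal.span_singleton_le_iff_mem P').1 hP'.2

/-- All minimal primes of `t` lie over minimal primes of one Noetherian ring `B` inside the integral
closure in `K`, and `B` has only finitely many. The test sets are the images of `B \ q` for these
`q`: if `P` avoids one, then `P ∩ B ⊆ q`, so equality holds by minimality of `q`, and
incomparability makes `P` minimal. -/
theorem hasFiniteMinimalityTest_integralClosure {R K L : Type*} [CommRing R] [IsDomain R]
    [IsNoetherianRing R] [Field K] [Field L] [Algebra R K] [IsFractionRing R K] [Algebra K L]
    [Algebra R L] [IsScalarTower R K L] {t : R} (ht : t ≠ 0) :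
    HasFiniteMinimalityTest (algebraMap R (integralClosure R L) t) := by
  have hRK := IsFractionRing.injective R K
  obtain ⟨B, hB, H⟩ := exists_fg_forall_mem_minimalPrimes_comap (R := R) (A := integralClosure R K)
    (fun x y h => hRK (congrArg Subtype.val h)) (fun a => by
      obtain ⟨r, c, hc0, h⟩ := IsFractionRing.div_surjective (A := R) (a : K)
      have hc : algebraMap R K c ≠ 0 :=
        (map_ne_zero_iff _ hRK).2 (nonZeroDivisors.ne_zero hc0)
      refine ⟨c, nonZeroDivisors.ne_zero hc0, r, Subtype.ext ?_⟩
      change algebraMap R K r = algebraMap R K c * a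
      rw [← h, mul_div_cancel₀ _ hc]) ht
  have : IsNoetherianRing B := isNoetherianRing_of_fg hB
  let f : B →ₐ[R] integralClosure R L := (integralClosureMap R K L).comp B.val
  have hf : f.toRingHom.IsIntegral := by
    intro x
    have h1 : (algebraMap R (integralClosure R L)).IsIntegralElem x :=
      Algebra.IsIntegral.isIntegral (R := R) x
    rw [← f.comp_algebraMap] at h1
    exact RingHom.IsIntegralElem.of_comp h1
  refine ⟨(fun q : Ideal B => f '' (q : Set B)ᶜ) '' (Ideal.span {algebraMap R B t}).minimalPrimes,
    (Ideal.finite_minimalPrimes_of_isNoetherianRing _ _).image _, fun P hP htP => ⟨fun h => ?_, ?_⟩⟩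
  · refine ⟨_, ⟨P.comap f, H _ (comap_integralClosureMap_mem_minimalPrimes (K := K)
      ((map_ne_zero_iff _ hRK).2 ht) h), rfl⟩, ?_⟩
    rw [Set.disjoint_left]
    rintro _ ⟨x, hx, rfl⟩ h
    exact hx h
  · rintro ⟨_, ⟨q, hq, rfl⟩, hd⟩
    have h1 : P.comap f.toRingHom ≤ q := fun x hx => by
      by_contra hxq
      exact Set.disjoint_left.1 hd ⟨x, hxq, rfl⟩ hx
    have h2 : P.comap f.toRingHom ∈ (Ideal.span {algebraMap R B t}).minimalPrimes := by
      rwa [le_antisymm h1 (hq.2 ⟨inferInstance, ?_⟩ h1)]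
      rw [Ideal.span_singleton_le_iff_mem, Ideal.mem_comap]
      exact (f.commutes t).symm ▸ htP
    have h3 := mem_minimalPrimes_of_comap_of_isIntegral hf h2
    have h4 : f.toRingHom (algebraMap R B t) = algebraMap R _ t := f.commutes t
    rwa [h4] at h3

theorem HasFiniteMinimalityTest.of_isModIso {A B : Type*} [CommRing A] [CommRing B] {t : A}
    {ι : A →+* B} (hι : IsModIso t ι) (h : HasFiniteMinimalityTest t) :
    HasFiniteMinimalityTest (ι t) := by
  obtain ⟨F, hF, H⟩ := h
  refine ⟨(fun W => ι '' W) '' F, hF.image _, fun P hP htP => ?_⟩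
  have h1 : P ∈ (Ideal.span {ι t}).minimalPrimes ↔ P.comap ι ∈ (Ideal.span {t}).minimalPrimes :=
    ⟨hι.mem_minimalPrimes_comap, hι.mem_minimalPrimes_of_comap⟩
  rw [h1, H _ inferInstance htP, Set.exists_mem_image]
  refine exists_congr fun W => and_congr_right fun _ => ?_
  rw [Set.disjoint_image_left]
  rfl

end FiniteTest

/-! ### Real valuations at minimal primes -/

section RealValuation

open scoped NNReal

/-- Rescale a real valuation. -/
theorem exists_valuation_map_eq_half {K : Type*} [Field K] (v : Valuation K ℝ≥0) {t : K}
    (ht0 : v t ≠ 0) (ht1 : v t < 1) :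
    ∃ w : Valuation K ℝ≥0, w t = 1 / 2 ∧ ∀ x y, w x ≤ w y ↔ v x ≤ v y := by
  set r : ℝ := Real.log (1 / 2) / Real.log (v t) with hr
  have h0 : (0 : ℝ) < v t := by positivity
  have hlog : Real.log (v t) < 0 := Real.log_neg h0 (by exact_mod_cast ht1)
  have hrpos : 0 < r := div_pos_of_neg_of_neg (Real.log_neg (by norm_num) (by norm_num)) hlog
  let f : ℝ≥0 →*₀ ℝ≥0 :=
    { toFun := fun x => x ^ r
      map_zero' := NNReal.zero_rpow hrpos.ne'
      map_one' := NNReal.one_rpow r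
      map_mul' := fun x y => NNReal.mul_rpow }
  have hf : StrictMono f := NNReal.strictMono_rpow_of_pos hrpos
  refine ⟨v.map f hf.monotone, ?_, fun x y => hf.le_iff_le⟩
  change (v t) ^ r = 1 / 2
  rw [← NNReal.coe_inj, NNReal.coe_rpow, Real.rpow_def_of_pos h0, hr,
    mul_div_cancel₀ _ hlog.ne, Real.exp_log (by norm_num)]
  simp

/-- The condition `dvd_pow` says that the value group is archimedean, so it embeds into the positive
reals; the embedding is then rescaled at `t`. -/
theorem IsPseudoUniformizer.exists_valuation {V : Type*} [CommRing V] [IsDomain V] {t : V}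
    (h : IsPseudoUniformizer t) (K : Type*) [Field K] [Algebra V K] [IsFractionRing V K] :
    ∃ w : Valuation K ℝ≥0, w (algebraMap V K t) = 1 / 2 ∧
      ∀ x y : V, w (algebraMap V K x) ≤ w (algebraMap V K y) ↔ y ∣ x := by
  have hV : ValuationRing V := ValuationRing.iff_dvd_total.2 ⟨h.dvd_total⟩
  let v := ValuationRing.valuation V K
  have hinj := IsFractionRing.injective V K
  have hle : ∀ x y : V, v (algebraMap V K x) ≤ v (algebraMap V K y) ↔ y ∣ x := by
    intro x y
    constructor
    · rintro ⟨c, hc⟩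
      rw [Algebra.smul_def, ← map_mul] at hc
      exact ⟨c, by rw [mul_comm]; exact (hinj hc).symm⟩
    · rintro ⟨c, rfl⟩
      exact ⟨c, by rw [Algebra.smul_def, ← map_mul, mul_comm]⟩
  have hsurj : ∀ γ : ValuationRing.ValueGroup V K, ∃ k, v k = γ := fun γ =>
    Quotient.inductionOn γ fun k => ⟨k, rfl⟩
  have hint : ∀ k, v k ≤ 1 → ∃ a, algebraMap V K a = k := fun k hk =>
    (ValuationRing.mem_integer_iff V K k).1 hk
  have harch : MulArchimedean (ValuationRing.ValueGroup V K) := by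
    refine ⟨fun x y hy => ?_⟩
    rcases le_or_gt x 1 with hx | hx
    · exact ⟨0, by simpa using hx⟩
    obtain ⟨k, hk⟩ := hsurj x⁻¹
    obtain ⟨l, hl⟩ := hsurj y⁻¹
    have hy1 : y⁻¹ < 1 := inv_lt_one_of_one_lt₀ hy
    obtain ⟨b, rfl⟩ := hint k (by rw [hk]; exact (inv_lt_one_of_one_lt₀ hx).le)
    obtain ⟨a, rfl⟩ := hint l (by rw [hl]; exact hy1.le)
    have ha : ¬ IsUnit a := fun ha => hy1.not_ge (by
      rw [← hl, ← map_one v, ← map_one (algebraMap V K), hle]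
      exact ha.dvd)
    have hb : b ≠ 0 := by
      rintro rfl
      rw [map_zero, map_zero, eq_comm, inv_eq_zero] at hk
      exact (hk ▸ hx).not_ge zero_le_one
    obtain ⟨n, hn⟩ := h.dvd_pow a ha b hb
    refine ⟨n, ?_⟩
    rw [← hle, map_pow, map_pow, hk, hl, inv_pow] at hn
    exact (inv_le_inv₀ (pow_pos (zero_lt_one.trans hy) n) (zero_lt_one.trans hx)).1 hn
  have ht0 : algebraMap V K t ≠ 0 := (map_ne_zero_iff _ hinj).2 h.ne_zero
  have ht1 : v (algebraMap V K t) < 1 := by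
    rw [← not_le, ← map_one v, ← map_one (algebraMap V K), hle]
    exact fun hd => h.not_isUnit (isUnit_of_dvd_one hd)
  have hnt : v.IsNontrivial := ⟨_, (map_ne_zero v).2 ht0, ht1.ne⟩
  have : MulArchimedean (MonoidWithZeroHom.ValueGroup₀ (.ofClass v)) :=
    MulArchimedean.comap MonoidWithZeroHom.ValueGroup₀.embedding.toMonoidHom
      MonoidWithZeroHom.ValueGroup₀.embedding_strictMono
  obtain ⟨e⟩ := v.nonempty_rankOne_iff_mulArchimedean.2 this
  let v' : Valuation K ℝ≥0 := v.restrict.map e.hom' e.strictMono'.monotone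
  have hv' : ∀ x y, v' x ≤ v' y ↔ v x ≤ v y := fun x y => by
    rw [← v.restrict_le_iff]
    exact e.strictMono'.le_iff_le
  obtain ⟨w, hw1, hw2⟩ := exists_valuation_map_eq_half v' (t := algebraMap V K t)
    ((map_ne_zero v').2 ht0) (by rwa [← not_le, ← map_one v', hv', map_one, not_le])
  exact ⟨w, hw1, fun x y => by rw [hw2, hv', hle]⟩

/-- A real valuation of `C[ϖ⁻¹]` centred at `P` whose valuation ring is approximated by the local
ring of `C` at `P`. -/
structure IsGenericValuation {C : Type*} [CommRing C] (ϖ : C) (P : Ideal C)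
    (w : Valuation (Loc C ϖ) ℝ≥0) : Prop where
  map_unif : w (Loc.unif C ϖ) = 1 / 2
  map_le_one : ∀ c, w (algebraMap C _ c) ≤ 1
  map_lt_one_iff : ∀ c, w (algebraMap C _ c) < 1 ↔ c ∈ P
  approx : ∀ f g, w (algebraMap C _ f) ≤ w (algebraMap C _ g) →
    ∀ N : ℕ, ∃ s ∉ P, ∃ c d, s * f = c * g + ϖ ^ N * d

theorem exists_isGenericValuation {C : Type*} [CommRing C] {ϖ : C} {P : Ideal C} [hPp : P.IsPrime]
    (hP : P ∈ (Ideal.span {ϖ}).minimalPrimes) {D : Type*} [CommRing D]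
    {κ : Localization.AtPrime P →+* D} (hκ : IsModIso (algebraMap C _ ϖ) κ)
    (hD : IsPseudoUniformizer (κ (algebraMap C _ ϖ))) :
    ∃ w, IsGenericValuation ϖ P w := by
  have := hD.isDomain
  let K := FractionRing D
  obtain ⟨v, hv1, hv⟩ := hD.exists_valuation K
  have hinj := IsFractionRing.injective D K
  let ι : C →+* K := (algebraMap D K).comp (κ.comp (algebraMap C _))
  have hunit : IsUnit (ι ϖ) := ((map_ne_zero_iff _ hinj).2 hD.ne_zero).isUnit
  let l : Loc C ϖ →+* K := IsLocalization.Away.lift ϖ hunit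
  have hl : ∀ c, l (algebraMap C _ c) = ι c := fun c => IsLocalization.Away.lift_eq ϖ hunit c
  have hw : ∀ c, (v.comap l) (algebraMap C _ c) =
      v (algebraMap D K (κ (algebraMap C _ c))) := fun c => congrArg v (hl c)
  have hw1 : ∀ c, (v.comap l) (algebraMap C _ c) ≤ 1 := fun c => by
    rw [hw, ← map_one v, ← map_one (algebraMap D K), hv]
    exact one_dvd _
  have hwϖ : (v.comap l) (algebraMap C _ ϖ) = 1 / 2 := (hw ϖ).trans hv1
  refine ⟨v.comap l, hwϖ, hw1, fun c => ⟨fun hc => ?_, fun hc => ?_⟩, fun f g hfg N => ?_⟩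
  · by_contra hcP
    have hu := (IsLocalization.map_units (Localization.AtPrime P) (⟨c, hcP⟩ : P.primeCompl)).map κ
    refine hc.not_ge ?_
    rw [hw, ← map_one v, ← map_one (algebraMap D K), hv]
    exact hu.dvd
  · obtain ⟨s, hs, n, b, hb⟩ := (mem_minimalPrimes_span_iff.1 hP).2 c hc
    -- If `c` had value `1`, the relation `s cⁿ = ϖ b` would give `s` value at most `1 / 2`,
    -- although `s` is a unit at `P`.
    by_contra hc1
    have hc1 : (v.comap l) (algebraMap C _ c) = 1 := le_antisymm (hw1 c) (not_lt.1 hc1)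
    have hs1 : (v.comap l) (algebraMap C _ s) < 1 := by
      have h1 := congrArg (fun x => v.comap l (algebraMap C _ x)) hb
      simp only [map_mul, map_pow, hc1, one_pow, mul_one, hwϖ] at h1
      rw [h1]
      calc 1 / 2 * _ ≤ (1 / 2 : ℝ≥0) * 1 := mul_le_mul_right (hw1 b) _
        _ < 1 := by rw [mul_one]; exact NNReal.half_lt_self one_ne_zero
    refine hs1.not_ge ?_
    have hu := (IsLocalization.map_units (Localization.AtPrime P) (⟨s, hs⟩ : P.primeCompl)).map κ
    rw [hw, ← map_one v, ← map_one (algebraMap D K), hv]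
    exact hu.dvd
  -- In `D` one has `f = g e`. Approximating `e` modulo `ϖ ^ N` from the local ring and descending
  -- by injectivity modulo `ϖ ^ N` gives the relation there; clearing denominators yields `s`.
  · rw [hw, hw, hv] at hfg
    obtain ⟨e, he⟩ := hfg
    obtain ⟨a, d, rfl⟩ := hκ.surj_pow N e
    have h1 : algebraMap C (Localization.AtPrime P) ϖ ^ N ∣
        algebraMap C _ f - algebraMap C _ g * a := by
      refine hκ.inj_pow (mem_nonZeroDivisors_of_ne_zero hD.ne_zero) N _ ?_
      exact ⟨κ (algebraMap C _ g) * d, by rw [map_sub, map_mul, he]; ring⟩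
    obtain ⟨b, hb⟩ := h1
    obtain ⟨x, s, rfl⟩ := IsLocalization.exists_mk'_eq P.primeCompl a
    obtain ⟨y, u, rfl⟩ := IsLocalization.exists_mk'_eq P.primeCompl b
    have h2 : algebraMap C (Localization.AtPrime P) (u * s * f) =
        algebraMap C _ (u * x * g + ϖ ^ N * (s * y)) := by
      have hx := IsLocalization.mk'_spec (Localization.AtPrime P) x s
      have hy := IsLocalization.mk'_spec (Localization.AtPrime P) y u
      simp only [map_mul, map_add, map_pow, ← hx, ← hy]
      linear_combination algebraMap C (Localization.AtPrime P) u * algebraMap C _ s * hb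
    obtain ⟨z, hz⟩ := (IsLocalization.eq_iff_exists P.primeCompl _).1 h2
    exact ⟨z * (u * s), hPp.mul_notMem z.2 (hPp.mul_notMem u.2 s.2), z * (u * x), z * (s * y),
      by linear_combination hz⟩

end RealValuation

open scoped NNReal

/-! ### The Tate ring `C[ϖ⁻¹]` -/

namespace Loc

variable {C : Type*} [CommRing C] {ϖ : C}

theorem exists_unif_pow_mul_eq (y : Loc C ϖ) :
    ∃ (n : ℕ) (c : C), unif C ϖ ^ n * y = algebraMap C _ c := by
  obtain ⟨n, c, h⟩ := IsLocalization.Away.surj ϖ y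
  exact ⟨n, c, by rw [mul_comm]; exact h⟩

theorem isUnit_unif : IsUnit (unif C ϖ) := IsLocalization.Away.algebraMap_isUnit ϖ

theorem algebraMap_injective (hϖ : ϖ ∈ nonZeroDivisors C) :
    Function.Injective (algebraMap C (Loc C ϖ)) :=
  IsLocalization.injective (M := Submonoid.powers ϖ) _ (by
    rintro _ ⟨n, rfl⟩
    exact pow_mem hϖ n)

theorem hasBasis_nhds_zero : (𝓝 (0 : Loc C ϖ)).HasBasis (fun _ : ℕ => True)
    fun n => (powSubmodule C ϖ n : Set (Loc C ϖ)) := by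
  refine ⟨fun U => ?_⟩
  rw [(submodulesRingBasis C ϖ).toRing_subgroups_basis.hasBasis_nhds_zero.mem_iff]
  simp

theorem mem_powSubmodule' {n : ℕ} {x : Loc C ϖ} :
    x ∈ powSubmodule C ϖ n ↔ ∃ c, x = unif C ϖ ^ n * algebraMap C _ c := by
  rw [mem_powSubmodule]
  refine exists_congr fun c => ?_
  rw [eq_comm, map_mul, map_pow, mul_comm]
  rfl

theorem mem_powSubmodule_zero {x : Loc C ϖ} :
    x ∈ powSubmodule C ϖ 0 ↔ ∃ c, algebraMap C _ c = x := by
  simp [mem_powSubmodule]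

theorem isBounded_range : IsBounded (Set.range (algebraMap C (Loc C ϖ))) := by
  intro U hU
  obtain ⟨n, -, hn⟩ := hasBasis_nhds_zero.mem_iff.1 hU
  refine ⟨_, hasBasis_nhds_zero.mem_of_mem (i := n) trivial, ?_⟩
  rintro v hv _ ⟨c, rfl⟩
  refine hn ?_
  rw [mul_comm, ← Algebra.smul_def]
  exact Submodule.smul_mem _ c hv

theorem isPowerBounded_algebraMap (c : C) : IsPowerBounded (algebraMap C (Loc C ϖ) c) :=
  isBounded_range.mono (by rintro _ ⟨n, rfl⟩; exact ⟨c ^ n, map_pow _ _ _⟩)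

theorem isTopologicallyNilpotent_unif : IsTopologicallyNilpotent (unif C ϖ) := by
  refine (Filter.atTop_basis.tendsto_iff hasBasis_nhds_zero).2 fun n _ => ⟨n, trivial, fun m hm => ?_⟩
  refine mem_powSubmodule'.2 ⟨ϖ ^ (m - n), ?_⟩
  rw [map_pow]
  exact (by rw [← pow_add, Nat.add_sub_cancel' hm] :
    unif C ϖ ^ m = unif C ϖ ^ n * unif C ϖ ^ (m - n))

theorem isTateRing : IsTateRing (Loc C ϖ) (unif C ϖ) where
  exists_ringOfDefinition := by
    let A₀ : Subring (Loc C ϖ) := (algebraMap C (Loc C ϖ)).range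
    let u : A₀ := ⟨unif C ϖ, ϖ, rfl⟩
    have hopen : ∀ n, IsOpen (powSubmodule C ϖ n : Set (Loc C ϖ)) := fun n =>
      (powSubmodule C ϖ n).toAddSubgroup.isOpen_of_mem_nhds (g := 0)
        (hasBasis_nhds_zero.mem_of_mem (i := n) trivial)
    have hI : ∀ n, ((Ideal.span {u} ^ n : Ideal A₀) : Set A₀) =
        Subtype.val ⁻¹' (powSubmodule C ϖ n : Set (Loc C ϖ)) := by
      intro n
      ext ⟨x, hx⟩
      rw [SetLike.mem_coe, Ideal.span_singleton_pow, Ideal.mem_span_singleton, Set.mem_preimage,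
        SetLike.mem_coe, mem_powSubmodule']
      constructor
      · rintro ⟨⟨_, c, rfl⟩, h⟩
        exact ⟨c, congrArg Subtype.val h⟩
      · rintro ⟨c, h⟩
        exact ⟨⟨_, c, rfl⟩, Subtype.ext h⟩
    refine ⟨A₀, ?_, Ideal.span {u}, ⟨{u}, by simp⟩, isAdic_iff.2 ⟨fun n => ?_, fun s hs => ?_⟩⟩
    · have : (A₀ : Set (Loc C ϖ)) = powSubmodule C ϖ 0 := by
        ext x
        exact mem_powSubmodule_zero.symm
      rw [this]
      exact hopen 0
    · rw [hI]
      exact (hopen n).preimage continuous_subtype_val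
    · rw [nhds_subtype_eq_comap, Filter.mem_comap] at hs
      obtain ⟨U, hU, hUs⟩ := hs
      obtain ⟨n, -, hn⟩ := hasBasis_nhds_zero.mem_iff.1 hU
      refine ⟨n, ?_⟩
      rw [hI]
      exact (Set.preimage_mono hn).trans hUs
  isUnit := isUnit_unif
  isTopologicallyNilpotent := isTopologicallyNilpotent_unif

end Loc

/-- The commutative algebra of `(C, ϖ)` needed to compute the Shilov boundary of `C[ϖ⁻¹]`. -/
structure HasGenericValuations {C : Type*} [CommRing C] (ϖ : C) : Prop where
  mem_nonZeroDivisors : ϖ ∈ nonZeroDivisors C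
  not_isUnit : ¬ IsUnit ϖ
  mem_minimalPrimes : ∀ p : Ideal C, p.IsPrime → IsWeaklyAssociatedPrime ϖ p →
    p ∈ (Ideal.span {ϖ}).minimalPrimes
  exists_isGenericValuation : ∀ p ∈ (Ideal.span {ϖ}).minimalPrimes, ∃ w, IsGenericValuation ϖ p w
  hasFiniteMinimalityTest : HasFiniteMinimalityTest ϖ

theorem pow_le_imp_le_one {x B : ℝ} (h : ∀ k : ℕ, x ^ k ≤ B) : x ≤ 1 := by
  by_contra! hx
  obtain ⟨k, hk⟩ := pow_unbounded_of_one_lt B hx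
  exact hk.not_ge (h k)

/-! ### Power-bounded elements and uniformity -/

namespace HasGenericValuations

variable {C : Type*} [CommRing C] {ϖ : C} (h : HasGenericValuations ϖ)
include h

/-- If `ϖ ∤ b`, a prime `p` minimal over `(ϖ : b)` is weakly associated, hence minimal over `ϖ`. If
its generic valuation `w` satisfied `w b ≤ w ϖ`, approximation modulo `ϖ` would produce `s ∉ p` with
`s ∈ (ϖ : b) ⊆ p`. -/
theorem pow_dvd_of_forall_le (n : ℕ) (c : C)
    (hc : ∀ p ∈ (Ideal.span {ϖ}).minimalPrimes, ∀ w, IsGenericValuation ϖ p w →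
      w (algebraMap C _ c) ≤ w (Loc.unif C ϖ) ^ n) : ϖ ^ n ∣ c := by
  induction n with
  | zero => simp
  | succ n ih =>
    have hle : ∀ {p : Ideal C} {w}, IsGenericValuation ϖ p w → w (Loc.unif C ϖ) ≤ 1 :=
      fun hw => hw.map_le_one ϖ
    obtain ⟨b, rfl⟩ := ih fun p hp w hw =>
      (hc p hp w hw).trans (pow_le_pow_of_le_one zero_le (hle hw) n.le_succ)
    rw [pow_succ]
    refine mul_dvd_mul_left _ ?_
    by_contra hb
    have hne : ((Ideal.span {ϖ}).colon {b} : Ideal C) ≠ ⊤ := by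
      rw [Ne, Ideal.eq_top_iff_one, Submodule.mem_colon_singleton, one_smul,
        Ideal.mem_span_singleton]
      exact hb
    obtain ⟨m, hm, hle'⟩ := Ideal.exists_le_maximal _ hne
    have := hm.isPrime
    obtain ⟨p, hp, -⟩ := Ideal.exists_minimalPrimes_le hle'
    have hpϖ := h.mem_minimalPrimes p hp.1.1 ⟨b, hp⟩
    obtain ⟨w, hw⟩ := h.exists_isGenericValuation p hpϖ
    have h1 := hc p hpϖ w hw
    have hw0 : w (Loc.unif C ϖ) ≠ 0 := by rw [hw.map_unif]; norm_num
    rw [map_mul, map_mul, map_pow, map_pow, pow_succ] at h1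
    have h2 : w (algebraMap C _ b) ≤ w (algebraMap C _ ϖ) :=
      le_of_mul_le_mul_left h1 (pow_pos (pos_iff_ne_zero.2 hw0) n)
    obtain ⟨s, hs, c, d, hd⟩ := hw.approx b ϖ h2 1
    refine hs (hp.1.2 ?_)
    rw [Submodule.mem_colon_singleton, smul_eq_mul, Ideal.mem_span_singleton, hd]
    exact ⟨c + d, by ring⟩

theorem exists_algebraMap_eq (y : Loc C ϖ)
    (hy : ∀ p ∈ (Ideal.span {ϖ}).minimalPrimes, ∀ w, IsGenericValuation ϖ p w → w y ≤ 1) :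
    ∃ c, algebraMap C _ c = y := by
  obtain ⟨n, c, hc⟩ := Loc.exists_unif_pow_mul_eq y
  obtain ⟨b, rfl⟩ := h.pow_dvd_of_forall_le n c fun p hp w hw => by
    rw [← hc, map_mul, map_pow]
    exact mul_le_of_le_one_right' (hy p hp w hw)
  refine ⟨b, (Loc.isUnit_unif.pow n).mul_left_cancel ?_⟩
  rw [hc, map_mul, map_pow]
  rfl

theorem isPowerBounded_iff (y : Loc C ϖ) : IsPowerBounded y ↔ ∃ c, algebraMap C _ c = y := by
  refine ⟨fun hy => h.exists_algebraMap_eq y fun p hp w hw => ?_, ?_⟩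
  · obtain ⟨V, hV, hVy⟩ := hy _ (Loc.hasBasis_nhds_zero.mem_of_mem (i := 0) trivial)
    obtain ⟨m, -, hm⟩ := Loc.hasBasis_nhds_zero.mem_iff.1 hV
    have h1 : ∀ k : ℕ, w (Loc.unif C ϖ) ^ m * w y ^ k ≤ 1 := fun k => by
      obtain ⟨c, hc⟩ := Loc.mem_powSubmodule_zero.1 (hVy (Loc.unif C ϖ ^ m)
        (hm (Loc.mem_powSubmodule'.2 ⟨1, by simp⟩)) (y ^ k) ⟨k, rfl⟩)
      rw [← map_pow, ← map_pow, ← map_mul, ← hc]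
      exact hw.map_le_one c
    rw [hw.map_unif] at h1
    refine pow_le_imp_le_one (x := w y) (B := 2 ^ m) fun k => ?_
    have h2 : ((1 / 2 : ℝ)) ^ m * (w y : ℝ) ^ k ≤ 1 := by exact_mod_cast h1 k
    rw [one_div, inv_pow] at h2
    rwa [inv_mul_le_iff₀ (by positivity), mul_one] at h2
  · rintro ⟨c, rfl⟩
    exact Loc.isPowerBounded_algebraMap c

theorem isUniform : IsUniform (Loc C ϖ) :=
  Loc.isBounded_range.mono fun y hy => (h.isPowerBounded_iff y).1 hy

/-- The ring `C` is the ring of power-bounded elements of `C[ϖ⁻¹]`. -/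
def equivPowerBounded : C ≃+* powerBounded (Loc C ϖ) :=
  RingEquiv.ofBijective ((algebraMap C (Loc C ϖ)).codRestrict (powerBounded (Loc C ϖ))
      Loc.isPowerBounded_algebraMap)
    ⟨fun _ _ hxy => Loc.algebraMap_injective h.mem_nonZeroDivisors (congrArg Subtype.val hxy),
      fun y => by
        obtain ⟨c, hc⟩ := (h.isPowerBounded_iff y).1 y.2
        exact ⟨c, Subtype.ext hc⟩⟩

theorem mem_genericPoints_iff (P : Ideal (powerBounded (Loc C ϖ))) :
    P ∈ genericPoints (Loc.unif C ϖ) ↔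
      P.comap h.equivPowerBounded ∈ (Ideal.span {ϖ}).minimalPrimes := by
  have h1 : ((↑) ⁻¹' ({Loc.unif C ϖ} : Set (Loc C ϖ)) : Set (powerBounded (Loc C ϖ))) =
      {(h.equivPowerBounded : C →+* _) ϖ} := by
    ext x
    rw [Set.mem_preimage, Set.mem_singleton_iff, Set.mem_singleton_iff, Subtype.ext_iff]
    rfl
  have h2 : IsModIso ϖ (h.equivPowerBounded : C →+* powerBounded (Loc C ϖ)) := by
    refine ⟨fun c => ⟨h.equivPowerBounded.symm c, 0, by simp⟩, ?_⟩
    rintro a ⟨b, hb⟩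
    refine ⟨h.equivPowerBounded.symm b, h.equivPowerBounded.injective ?_⟩
    rw [map_mul, RingEquiv.apply_symm_apply]
    exact hb
  rw [genericPoints, h1]
  refine ⟨h2.mem_minimalPrimes_comap, fun hP => ?_⟩
  have hPp : (P.comap h.equivPowerBounded).IsPrime := hP.1.1
  have : P.IsPrime := by
    have h3 : (P.comap h.equivPowerBounded).comap h.equivPowerBounded.symm = P := by
      ext x
      rw [Ideal.mem_comap, Ideal.mem_comap, RingEquiv.apply_symm_apply]
    rw [← h3]
    infer_instance
  exact h2.mem_minimalPrimes_of_comap hP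

end HasGenericValuations

open scoped NNReal

/-! ### Comparison of real numbers through their powers -/

section RealLemmas

/-- For `y > 0`, placing `yᵏ` between consecutive powers of `1 / 2` gives `xᵏ ≤ 2 yᵏ` for all `k`,
hence `x ≤ y`. This is how values are recovered from comparisons with powers of `ϖ`. -/
theorem le_of_pow_le_imp {x y : ℝ} (hy : 0 ≤ y) (hy1 : y ≤ 1)
    (h : ∀ k n : ℕ, y ^ k ≤ (1 / 2) ^ n → x ^ k ≤ (1 / 2) ^ n) : x ≤ y := by
  by_contra! hlt
  rcases hy.eq_or_lt with rfl | hy0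
  · obtain ⟨n, hn⟩ := exists_pow_lt_of_lt_one hlt (by norm_num : (1 / 2 : ℝ) < 1)
    have := h 1 n (by simp)
    rw [pow_one] at this
    exact hn.not_ge this
  · obtain ⟨k, hk⟩ := pow_unbounded_of_one_lt 2 ((one_lt_div hy0).2 hlt)
    obtain ⟨n, hn1, hn2⟩ := exists_nat_pow_near_of_lt_one (pow_pos hy0 k) (pow_le_one₀ hy hy1)
      (by norm_num : (0 : ℝ) < 1 / 2) (by norm_num)
    have h1 := h k n hn2
    rw [div_pow, lt_div_iff₀ (pow_pos hy0 k)] at hk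
    rw [pow_succ] at hn1
    linarith

theorem le_one_of_pow_le_natCast_add_one {x : ℝ} (h : ∀ k : ℕ, x ^ k ≤ k + 1) : x ≤ 1 := by
  by_contra! hx
  have h1 := tendsto_pow_const_div_const_pow_of_one_lt 1 hx
  obtain ⟨k, hk, hk1⟩ := ((h1.eventually_lt_const (by norm_num : (0 : ℝ) < 1 / 2)).and
    (Filter.eventually_ge_atTop 1)).exists
  rw [pow_one, div_lt_iff₀ (by positivity)] at hk
  have := h k
  have hk2 : (1 : ℝ) ≤ k := by exact_mod_cast hk1
  linarith

end RealLemmas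

/-- Multiplicative seminorms on `C[ϖ⁻¹]` which are at most one on `C` and `1 / 2` at `ϖ`. -/
structure IsRealPoint {C : Type*} [CommRing C] {ϖ : C} (ψ : MulRingSeminorm (Loc C ϖ)) : Prop where
  le_one : ∀ c, ψ (algebraMap C _ c) ≤ 1
  map_unif : ψ (Loc.unif C ϖ) = 1 / 2

/-! ### Points of the Berkovich spectrum and their centres -/

namespace IsRealPoint

variable {C : Type*} [CommRing C] {ϖ : C} {ψ : MulRingSeminorm (Loc C ϖ)}

/-- Binomial coefficients come from `C`, so they have value at most `1`. The binomial theorem gives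
`ψ (x + y) ^ k ≤ (k + 1) M ^ k`, and the factor `k + 1` disappears on taking `k`-th roots. -/
theorem isNonarchimedean (hψ : IsRealPoint ψ) : IsNonarchimedean ψ := by
  intro x y
  set M := ψ x ⊔ ψ y with hM
  have hM0 : 0 ≤ M := (apply_nonneg ψ x).trans le_sup_left
  have key : ∀ k : ℕ, ψ (x + y) ^ k ≤ (k + 1) * M ^ k := by
    intro k
    rw [← map_pow, add_pow]
    refine (Finset.le_sum_of_subadditive ψ (map_zero ψ).le (map_add_le_add ψ) _ _).trans ?_
    · have : ∀ i ∈ Finset.range (k + 1),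
          ψ (x ^ i * y ^ (k - i) * (k.choose i : Loc C ϖ)) ≤ M ^ k := by
        intro i hi
        have hik : i ≤ k := Nat.lt_succ_iff.1 (Finset.mem_range.1 hi)
        have h1 : ψ (k.choose i : Loc C ϖ) ≤ 1 := by
          have := hψ.le_one (k.choose i : C)
          rwa [map_natCast] at this
        rw [map_mul, map_mul, map_pow, map_pow]
        calc ψ x ^ i * ψ y ^ (k - i) * ψ (k.choose i : Loc C ϖ)
            ≤ M ^ i * M ^ (k - i) * 1 := by
              have := apply_nonneg ψ x
              have := apply_nonneg ψ y
              have := apply_nonneg ψ (k.choose i : Loc C ϖ)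
              gcongr
              · exact le_sup_left
              · exact le_sup_right
          _ = M ^ k := by rw [mul_one, ← pow_add, Nat.add_sub_cancel' hik]
      refine (Finset.sum_le_sum this).trans ?_
      simp
  rcases hM0.eq_or_lt with h0 | h0
  · have := key 1
    rw [← h0] at this ⊢
    simpa using this
  · have := le_one_of_pow_le_natCast_add_one (x := ψ (x + y) / M) fun k => by
      rw [div_pow, div_le_iff₀ (pow_pos h0 k)]
      exact key k
    rwa [div_le_one h0] at this

/-- The valuation defined by a real point. -/
def valuation (hψ : IsRealPoint ψ) : Valuation (Loc C ϖ) ℝ≥0 where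
  toFun x := ⟨ψ x, apply_nonneg ψ x⟩
  map_zero' := NNReal.eq (map_zero ψ)
  map_one' := NNReal.eq (map_one ψ)
  map_mul' x y := NNReal.eq (map_mul ψ x y)
  map_add_le_max' x y := hψ.isNonarchimedean x y

theorem coe_valuation (hψ : IsRealPoint ψ) (x : Loc C ϖ) : (hψ.valuation x : ℝ) = ψ x := rfl

/-- The prime ideal of `C` over which a real point lies. -/
def center (hψ : IsRealPoint ψ) : Ideal C where
  carrier := {c | ψ (algebraMap C _ c) < 1}
  zero_mem' := by simp
  add_mem' {a b} ha hb := by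
    rw [Set.mem_ofPred_eq, map_add]
    exact (hψ.isNonarchimedean _ _).trans_lt (max_lt ha hb)
  smul_mem' a b hb := by
    rw [Set.mem_ofPred_eq, smul_eq_mul, map_mul, map_mul]
    exact (mul_le_of_le_one_left (apply_nonneg _ _) (hψ.le_one a)).trans_lt hb

theorem mem_center (hψ : IsRealPoint ψ) (c : C) : c ∈ hψ.center ↔ ψ (algebraMap C _ c) < 1 := Iff.rfl

theorem notMem_center (hψ : IsRealPoint ψ) (c : C) :
    c ∉ hψ.center ↔ ψ (algebraMap C _ c) = 1 := by
  rw [mem_center, not_lt]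
  exact ⟨fun h => le_antisymm (hψ.le_one c) h, fun h => h.ge⟩

theorem isPrime_center (hψ : IsRealPoint ψ) : hψ.center.IsPrime := by
  refine ⟨fun h => ?_, fun {a b} hab => ?_⟩
  · have := (Ideal.eq_top_iff_one _).1 h
    rw [mem_center, map_one, map_one] at this
    exact lt_irrefl _ this
  · by_contra! hcon
    rw [hψ.notMem_center, hψ.notMem_center] at hcon
    rw [mem_center, map_mul, map_mul, hcon.1, hcon.2, one_mul] at hab
    exact lt_irrefl _ hab

theorem mem_center_self (hψ : IsRealPoint ψ) : ϖ ∈ hψ.center := by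
  have : ψ (algebraMap C _ ϖ) = 1 / 2 := hψ.map_unif
  rw [mem_center, this]
  norm_num

/-- A multiplicative seminorm bounded on all powers of an element is at most `1` there. This applies
to elements of `C`, on which `N` is bounded, and, with factors `2 ^ k` and `2 ^ (-k)` included, to
`ϖ` and its inverse, which gives both inequalities for `ψ ϖ`. -/
theorem of_isAdmissible {N : RingSeminorm (Loc C ϖ)} (hN : IsAdmissible (Loc.unif C ϖ) N) {B : ℝ}
    (hB : ∀ f, ψ f ≤ B * N f) : IsRealPoint ψ := by
  have hNpow : ∀ (m : ℕ) f, N (Loc.unif C ϖ ^ m * f) = (1 / 2) ^ m * N f := by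
    intro m f
    induction m with
    | zero => simp
    | succ m ih => rw [pow_succ', mul_assoc, hN.map_mul, ih, hN.map_eq_half]; ring
  have hB0 : ∀ f, 0 ≤ N f := fun f => apply_nonneg N f
  have hle : ∀ c, ψ (algebraMap C _ c) ≤ 1 := by
    intro c
    obtain ⟨m, -, hm⟩ := Loc.hasBasis_nhds_zero.mem_iff.1
      (hN.hasBasis_nhds_zero.mem_of_mem (i := 1) one_pos)
    have hC : ∀ c, N (algebraMap C _ c) ≤ 2 ^ m := by
      intro c
      have h1 : N (Loc.unif C ϖ ^ m * algebraMap C _ c) < 1 :=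
        hm (Loc.mem_powSubmodule'.2 ⟨c, rfl⟩)
      rw [hNpow, one_div, inv_pow, inv_mul_lt_iff₀ (by positivity), mul_one] at h1
      exact h1.le
    refine pow_le_imp_le_one (B := |B| * 2 ^ m) fun k => ?_
    rw [← map_pow, ← map_pow]
    refine (hB _).trans ?_
    have := hB0 (algebraMap C _ (c ^ k))
    calc B * N (algebraMap C _ (c ^ k)) ≤ |B| * N (algebraMap C _ (c ^ k)) := by
          gcongr; exact le_abs_self B
      _ ≤ |B| * 2 ^ m := by gcongr; exact hC _
  refine ⟨hle, ?_⟩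
  obtain ⟨u, hu⟩ := Loc.isUnit_unif (C := C) (ϖ := ϖ)
  set v : Loc C ϖ := ↑u⁻¹ with hv
  have huv : Loc.unif C ϖ * v = 1 := by rw [← hu]; exact u.mul_inv
  have hψuv : ψ (Loc.unif C ϖ) * ψ v = 1 := by rw [← map_mul, huv, map_one]
  have hNv : ∀ k : ℕ, N (v ^ k) = 2 ^ k * N 1 := by
    intro k
    have := hNpow k (v ^ k)
    rw [← mul_pow, huv, one_pow] at this
    rw [this, ← mul_assoc, ← mul_pow]
    norm_num
  have h1 : ψ (Loc.unif C ϖ) * 2 ≤ 1 := by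
    refine pow_le_imp_le_one (B := B * N 1) fun k => ?_
    rw [mul_pow, ← map_pow]
    have := hB (Loc.unif C ϖ ^ k)
    rw [← mul_one (Loc.unif C ϖ ^ k), hNpow] at this
    calc ψ (Loc.unif C ϖ ^ k) * 2 ^ k ≤ B * ((1 / 2) ^ k * N 1) * 2 ^ k := by
          gcongr; rwa [mul_one] at this
      _ = B * N 1 * ((1 / 2) * 2) ^ k := by rw [mul_pow]; ring
      _ = B * N 1 := by norm_num
  have h2 : ψ v * (1 / 2) ≤ 1 := by
    refine pow_le_imp_le_one (B := B * N 1) fun k => ?_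
    rw [mul_pow, ← map_pow]
    have := hB (v ^ k)
    rw [hNv] at this
    calc ψ (v ^ k) * (1 / 2) ^ k ≤ B * (2 ^ k * N 1) * (1 / 2) ^ k := by gcongr
      _ = B * N 1 * (2 * (1 / 2)) ^ k := by rw [mul_pow]; ring
      _ = B * N 1 := by norm_num
  nlinarith [apply_nonneg ψ v, apply_nonneg ψ (Loc.unif C ϖ)]

theorem of_berkovichSpectrum (φ : BerkovichSpectrum (Loc.unif C ϖ)) : IsRealPoint φ.1 := by
  obtain ⟨N, hN, B, hB⟩ := φ.2
  exact of_isAdmissible hN hB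

end IsRealPoint

/-- The seminorm of a real valuation. -/
def _root_.Valuation.toMulRingSeminorm {A : Type*} [CommRing A] (w : Valuation A ℝ≥0) :
    MulRingSeminorm A where
  toFun x := w x
  map_zero' := by simp
  add_le' x y := by
    have h := w.map_add x y
    have h' : w (x + y) ≤ w x + w y := h.trans (max_le (by simp) (by simp))
    exact_mod_cast h'
  neg' x := by simp
  map_one' := by simp
  map_mul' x y := by simp

theorem IsGenericValuation.isRealPoint {C : Type*} [CommRing C] {ϖ : C} {p : Ideal C}
    {w : Valuation (Loc C ϖ) ℝ≥0} (hw : IsGenericValuation ϖ p w) :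
    IsRealPoint w.toMulRingSeminorm where
  le_one c := by exact_mod_cast hw.map_le_one c
  map_unif := by
    change ((w (Loc.unif C ϖ) : ℝ≥0) : ℝ) = 1 / 2
    rw [hw.map_unif]
    simp

/-! ### The supremum norm and compactness of the Berkovich spectrum -/

namespace HasGenericValuations

variable {C : Type*} [CommRing C] {ϖ : C}

/-- The generic valuations. -/
def Index (_ : HasGenericValuations ϖ) : Type _ :=
  {w : Valuation (Loc C ϖ) ℝ≥0 // ∃ p ∈ (Ideal.span {ϖ}).minimalPrimes, IsGenericValuation ϖ p w}

variable (h : HasGenericValuations ϖ)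
include h

theorem exists_mem_minimalPrimes : ∃ p, p ∈ (Ideal.span {ϖ}).minimalPrimes := by
  have hne : Ideal.span {ϖ} ≠ ⊤ := fun hcon => h.not_isUnit (Ideal.span_singleton_eq_top.1 hcon)
  obtain ⟨m, hm, hle⟩ := Ideal.exists_le_maximal _ hne
  have := hm.isPrime
  obtain ⟨p, hp, -⟩ := Ideal.exists_minimalPrimes_le hle
  exact ⟨p, hp⟩

theorem nonempty_index : Nonempty h.Index := by
  obtain ⟨p, hp⟩ := h.exists_mem_minimalPrimes
  obtain ⟨w, hw⟩ := h.exists_isGenericValuation p hp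
  exact ⟨⟨w, p, hp, hw⟩⟩

omit h in
theorem map_unif_index {h : HasGenericValuations ϖ} (i : h.Index) :
    ((i.1 (Loc.unif C ϖ) : ℝ≥0) : ℝ) = 1 / 2 := by
  obtain ⟨w, p, hp, hw⟩ := i
  exact hw.isRealPoint.map_unif

theorem bddAbove (f : Loc C ϖ) : BddAbove (Set.range fun i : h.Index => ((i.1 f : ℝ≥0) : ℝ)) := by
  obtain ⟨n, c, hc⟩ := Loc.exists_unif_pow_mul_eq f
  refine ⟨2 ^ n, ?_⟩
  rintro _ ⟨i, rfl⟩
  obtain ⟨p, hp, hw⟩ := i.2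
  have h1 : ((i.1 (algebraMap C _ c) : ℝ≥0) : ℝ) ≤ 1 := by exact_mod_cast hw.map_le_one c
  rw [← hc, map_mul, map_pow, NNReal.coe_mul, NNReal.coe_pow, map_unif_index, one_div, inv_pow,
    inv_mul_le_iff₀ (by positivity), mul_one] at h1
  exact h1

/-- The supremum of the generic valuations. -/
def supNorm (f : Loc C ϖ) : ℝ := ⨆ i : h.Index, ((i.1 f : ℝ≥0) : ℝ)

theorem le_supNorm (i : h.Index) (f : Loc C ϖ) : (i.1 f : ℝ) ≤ h.supNorm f := le_ciSup (h.bddAbove f) i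

theorem supNorm_le {f : Loc C ϖ} {B : ℝ} (hB : ∀ i : h.Index, (i.1 f : ℝ) ≤ B) :
    h.supNorm f ≤ B :=
  have := h.nonempty_index
  ciSup_le hB

theorem supNorm_nonneg (f : Loc C ϖ) : 0 ≤ h.supNorm f := by
  obtain ⟨i⟩ := h.nonempty_index
  exact (NNReal.coe_nonneg _).trans (h.le_supNorm i f)

theorem supNorm_add_le_max (f g : Loc C ϖ) :
    h.supNorm (f + g) ≤ h.supNorm f ⊔ h.supNorm g := by
  refine h.supNorm_le fun i => ?_
  have h1 : ((i.1 (f + g) : ℝ≥0) : ℝ) ≤ (i.1 f : ℝ) ⊔ (i.1 g : ℝ) := by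
    exact_mod_cast i.1.map_add f g
  exact h1.trans (sup_le_sup (h.le_supNorm i f) (h.le_supNorm i g))

theorem supNorm_unif_mul (f : Loc C ϖ) : h.supNorm (Loc.unif C ϖ * f) = 1 / 2 * h.supNorm f := by
  rw [supNorm, supNorm, Real.mul_iSup_of_nonneg (by norm_num)]
  refine iSup_congr fun i => ?_
  rw [map_mul, NNReal.coe_mul, map_unif_index]

/-- The supremum of the generic valuations as a ring seminorm. -/
def supSeminorm : RingSeminorm (Loc C ϖ) where
  toFun := h.supNorm
  map_zero' := le_antisymm (h.supNorm_le fun i => by simp) (h.supNorm_nonneg 0)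
  add_le' f g := (h.supNorm_add_le_max f g).trans
    (max_le_add_of_nonneg (h.supNorm_nonneg f) (h.supNorm_nonneg g))
  neg' f := by simp [supNorm]
  mul_le' f g := h.supNorm_le fun i => by
    rw [map_mul, NNReal.coe_mul]
    exact mul_le_mul (h.le_supNorm i f) (h.le_supNorm i g) (NNReal.coe_nonneg _)
      (h.supNorm_nonneg f)

theorem supSeminorm_apply (f : Loc C ϖ) : h.supSeminorm f = h.supNorm f := rfl

theorem supNorm_one : h.supNorm 1 = 1 := by
  have := h.nonempty_index
  simp [supNorm]

theorem supNorm_pow_mul (n : ℕ) (f : Loc C ϖ) :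
    h.supNorm (Loc.unif C ϖ ^ n * f) = (1 / 2) ^ n * h.supNorm f := by
  induction n with
  | zero => simp
  | succ n ih => rw [pow_succ', mul_assoc, supNorm_unif_mul, ih]; ring

theorem supNorm_algebraMap_le_one (c : C) : h.supNorm (algebraMap C _ c) ≤ 1 :=
  h.supNorm_le fun i => by
    obtain ⟨p, hp, hw⟩ := i.2
    exact_mod_cast hw.map_le_one c

/-- After division by `ϖⁿ` this is the fact that the generic valuations cut out `C`. It shows that
the supremum norm defines the given topology. -/
theorem supNorm_le_pow_iff (n : ℕ) (f : Loc C ϖ) :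
    h.supNorm f ≤ (1 / 2) ^ n ↔ f ∈ Loc.powSubmodule C ϖ n := by
  rw [Loc.mem_powSubmodule']
  constructor
  · intro hf
    obtain ⟨u, hu⟩ := Loc.isUnit_unif (C := C) (ϖ := ϖ)
    have hf' : f = Loc.unif C ϖ ^ n * (((u⁻¹ ^ n : (Loc C ϖ)ˣ) : Loc C ϖ) * f) := by
      rw [← hu, ← mul_assoc, ← Units.val_pow_eq_pow_val, ← Units.val_mul, ← mul_pow,
        mul_inv_cancel, one_pow, Units.val_one, one_mul]
    set g := ((u⁻¹ ^ n : (Loc C ϖ)ˣ) : Loc C ϖ) * f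
    rw [hf', h.supNorm_pow_mul] at hf
    have hg : h.supNorm g ≤ 1 := le_of_mul_le_mul_left (by rwa [mul_one]) (by positivity)
    obtain ⟨c, hc⟩ := h.exists_algebraMap_eq g fun p hp w hw => by
      exact_mod_cast (h.le_supNorm ⟨w, p, hp, hw⟩ g).trans hg
    exact ⟨c, by rw [hc]; exact hf'⟩
  · rintro ⟨c, rfl⟩
    rw [h.supNorm_pow_mul]
    exact mul_le_of_le_one_right (by positivity) (h.supNorm_algebraMap_le_one c)

theorem isAdmissible_supSeminorm : IsAdmissible (Loc.unif C ϖ) h.supSeminorm where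
  isNonarchimedean := h.supNorm_add_le_max
  hasBasis_nhds_zero := by
    refine Loc.hasBasis_nhds_zero.to_hasBasis (fun n _ => ⟨(1 / 2) ^ n, by positivity, ?_⟩)
      fun ε hε => ?_
    · intro f hf
      exact (h.supNorm_le_pow_iff n f).1 (le_of_lt hf)
    · obtain ⟨n, hn⟩ := exists_pow_lt_of_lt_one hε (by norm_num : (1 / 2 : ℝ) < 1)
      exact ⟨n, trivial, fun f hf => ((h.supNorm_le_pow_iff n f).2 hf).trans_lt hn⟩
  map_eq_half := by
    have := h.supNorm_unif_mul 1
    rwa [mul_one, h.supNorm_one, mul_one] at this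
  map_mul f := by
    have := h.supNorm_unif_mul 1
    rw [mul_one, h.supNorm_one, mul_one] at this
    simp only [supSeminorm_apply, this, h.supNorm_unif_mul f]

theorem supNorm_pow_le (f : Loc C ϖ) (k : ℕ) : h.supNorm (f ^ k) ≤ h.supNorm f ^ k := by
  refine h.supNorm_le fun i => ?_
  rw [map_pow, NNReal.coe_pow]
  exact pow_le_pow_left₀ (NNReal.coe_nonneg _) (h.le_supNorm i f) k

/-- If the norm of `cᵏ` is at most `2⁻ⁿ`, then `cᵏ ∈ ϖⁿ C` and `ψ (c) ^ k ≤ 2⁻ⁿ`. Comparing powers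
gives the bound on `C`, and scaling by `ϖ` gives it everywhere. -/
theorem le_supNorm_of_isRealPoint {ψ : MulRingSeminorm (Loc C ϖ)} (hψ : IsRealPoint ψ)
    (f : Loc C ϖ) : ψ f ≤ h.supNorm f := by
  obtain ⟨m, c, hc⟩ := Loc.exists_unif_pow_mul_eq f
  have h1 : ψ (algebraMap C _ c) ≤ h.supNorm (algebraMap C _ c) := by
    refine le_of_pow_le_imp (h.supNorm_nonneg _)
      (h.supNorm_algebraMap_le_one c) fun k n hkn => ?_
    obtain ⟨d, hd⟩ := Loc.mem_powSubmodule'.1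
      ((h.supNorm_le_pow_iff n _).1 ((h.supNorm_pow_le _ k).trans hkn))
    rw [← map_pow, hd, map_mul, map_pow, hψ.map_unif]
    exact mul_le_of_le_one_right (by positivity) (hψ.le_one d)
  rw [← hc, h.supNorm_pow_mul, map_mul, map_pow, hψ.map_unif] at h1
  exact le_of_mul_le_mul_left h1 (by positivity)

/-- Real points are points of the Berkovich spectrum. -/
def ofIsRealPoint {ψ : MulRingSeminorm (Loc C ϖ)} (hψ : IsRealPoint ψ) :
    BerkovichSpectrum (Loc.unif C ϖ) :=
  ⟨ψ, h.supSeminorm, h.isAdmissible_supSeminorm, 1, fun f => by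
    rw [one_mul]; exact h.le_supNorm_of_isRealPoint hψ f⟩

omit h in
theorem continuous_apply_berkovichSpectrum (f : Loc C ϖ) :
    Continuous fun φ : BerkovichSpectrum (Loc.unif C ϖ) => φ.1 f :=
  (continuous_apply f).comp continuous_induced_dom

/-- The spectrum consists of all real points. It is cut out by closed conditions in the product of
the compact intervals `[0, supNorm f]`. -/
theorem compactSpace : CompactSpace (BerkovichSpectrum (Loc.unif C ϖ)) := by
  let e : BerkovichSpectrum (Loc.unif C ϖ) → Loc C ϖ → ℝ := fun φ f => φ.1 f
  have he : Topology.IsInducing e := ⟨rfl⟩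
  have hrange : Set.range e = {φ | φ 0 = 0} ∩ {φ | φ 1 = 1} ∩
      (⋂ x, ⋂ y, {φ | φ (x + y) ≤ φ x + φ y}) ∩ (⋂ x, {φ | φ (-x) = φ x}) ∩
      (⋂ x, ⋂ y, {φ | φ (x * y) = φ x * φ y}) ∩ (⋂ c, {φ | φ (algebraMap C _ c) ≤ 1}) ∩
      {φ | φ (Loc.unif C ϖ) = 1 / 2} := by
    ext φ
    simp only [Set.mem_inter_iff, Set.mem_iInter, Set.mem_ofPred_eq]
    constructor
    · rintro ⟨ψ, rfl⟩
      have hψ := IsRealPoint.of_berkovichSpectrum ψ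
      exact ⟨⟨⟨⟨⟨⟨map_zero ψ.1, map_one ψ.1⟩, map_add_le_add ψ.1⟩, map_neg_eq_map ψ.1⟩,
        map_mul ψ.1⟩, hψ.le_one⟩, hψ.map_unif⟩
    · rintro ⟨⟨⟨⟨⟨⟨h0, h1⟩, hadd⟩, hneg⟩, hmul⟩, hle⟩, hu⟩
      let ψ : MulRingSeminorm (Loc C ϖ) :=
        { toFun := φ, map_zero' := h0, add_le' := hadd, neg' := hneg, map_one' := h1,
          map_mul' := hmul }
      exact ⟨h.ofIsRealPoint (ψ := ψ) ⟨hle, hu⟩, rfl⟩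
  have hclosed : IsClosed (Set.range e) := by
    rw [hrange]
    refine IsClosed.inter (IsClosed.inter (IsClosed.inter (IsClosed.inter (IsClosed.inter
      (IsClosed.inter ?_ ?_) ?_) ?_) ?_) ?_) ?_
    · exact isClosed_eq (continuous_apply _) continuous_const
    · exact isClosed_eq (continuous_apply _) continuous_const
    · exact isClosed_iInter fun x => isClosed_iInter fun y =>
        isClosed_le (continuous_apply _) (by fun_prop)
    · exact isClosed_iInter fun x => isClosed_eq (continuous_apply _) (continuous_apply _)
    · exact isClosed_iInter fun x => isClosed_iInter fun y =>
        isClosed_eq (continuous_apply _) (by fun_prop)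
    · exact isClosed_iInter fun c => isClosed_le (continuous_apply _) continuous_const
    · exact isClosed_eq (continuous_apply _) continuous_const
  have hcpt : IsCompact (Set.range e) := by
    refine (isCompact_univ_pi fun f : Loc C ϖ => isCompact_Icc (a := 0)
      (b := h.supNorm f)).of_isClosed_subset hclosed ?_
    rintro _ ⟨ψ, rfl⟩ f -
    exact ⟨apply_nonneg ψ.1 f,
      h.le_supNorm_of_isRealPoint (IsRealPoint.of_berkovichSpectrum ψ) f⟩
  exact ⟨he.isCompact_iff.2 (by rwa [Set.image_univ])⟩

end HasGenericValuations

/-! ### Uniqueness of the valuation centred at a minimal prime -/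

open scoped NNReal

/-- A continuous valuation with the same centre as a generic valuation is equivalent to it. -/
theorem IsGenericValuation.isEquiv {C : Type*} [CommRing C] {ϖ : C} {p : Ideal C}
    {w : Valuation (Loc C ϖ) ℝ≥0} (hw : IsGenericValuation ϖ p w) {Γ : Type*}
    [LinearOrderedCommGroupWithZero Γ] {v : Valuation (Loc C ϖ) Γ}
    (hv : ∀ c, v (algebraMap C _ c) ≤ 1) (hvp : ∀ c, v (algebraMap C _ c) < 1 ↔ c ∈ p)
    (hcont : ∀ γ : Γ, γ ≠ 0 → ∃ n : ℕ, ∀ c, v (Loc.unif C ϖ ^ n * algebraMap C _ c) < γ) :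
    v.IsEquiv w := by
  have hu0 : v (Loc.unif C ϖ) ≠ 0 := (Loc.isUnit_unif.map v).ne_zero
  have hu1 : v (Loc.unif C ϖ) < 1 := (hvp ϖ).2 ((hw.map_lt_one_iff ϖ).1 (by
    change w (Loc.unif C ϖ) < 1
    rw [hw.map_unif]
    exact NNReal.half_lt_self one_ne_zero))
  have step₁ : ∀ f g : C, w (algebraMap C _ f) ≤ w (algebraMap C _ g) →
      v (algebraMap C _ f) ≤ v (algebraMap C _ g) := by
    intro f g hfg
    -- In `s f = c g + ϖ ^ N d` the factor `s` has value `1`, and continuity makes the last term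
    -- smaller than `γ`. Taking `γ = v f` excludes the second alternative.
    have key : ∀ γ : Γ, γ ≠ 0 → v (algebraMap C _ f) ≤ v (algebraMap C _ g) ∨
        v (algebraMap C _ f) < γ := by
      intro γ hγ
      obtain ⟨N, hN⟩ := hcont γ hγ
      obtain ⟨s, hs, c, d, hd⟩ := hw.approx f g hfg N
      have hs1 : v (algebraMap C _ s) = 1 :=
        le_antisymm (hv s) (not_lt.1 fun hlt => hs ((hvp s).1 hlt))
      have h1 : v (algebraMap C _ f) = v (algebraMap C _ c * algebraMap C _ g +
          Loc.unif C ϖ ^ N * algebraMap C _ d) := by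
        have := congrArg (fun x => v (algebraMap C _ x)) hd
        simp only [map_mul, map_add, map_pow, hs1, one_mul] at this
        rw [this]
        rfl
      have h2 := v.map_add (algebraMap C _ c * algebraMap C _ g)
        (Loc.unif C ϖ ^ N * algebraMap C _ d)
      rw [← h1] at h2
      rcases le_max_iff.1 h2 with h3 | h3
      · refine .inl (h3.trans ?_)
        rw [map_mul]
        exact mul_le_of_le_one_left' (hv c)
      · exact .inr (h3.trans_lt (hN d))
    by_cases hf : v (algebraMap C _ f) = 0
    · rw [hf]
      exact zero_le
    · exact (key _ hf).resolve_right (lt_irrefl _)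
  have step₂ : ∀ f g : Loc C ϖ, w f ≤ w g → v f ≤ v g := by
    intro f g hfg
    obtain ⟨n, a, ha⟩ := Loc.exists_unif_pow_mul_eq f
    obtain ⟨m, b, hb⟩ := Loc.exists_unif_pow_mul_eq g
    have hf : algebraMap C (Loc C ϖ) (ϖ ^ m * a) = Loc.unif C ϖ ^ (n + m) * f := by
      rw [map_mul, map_pow, ← ha, pow_add]
      change Loc.unif C ϖ ^ m * _ = _
      ring
    have hg : algebraMap C (Loc C ϖ) (ϖ ^ n * b) = Loc.unif C ϖ ^ (n + m) * g := by
      rw [map_mul, map_pow, ← hb, pow_add]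
      change Loc.unif C ϖ ^ n * _ = _
      ring
    have h1 := step₁ (ϖ ^ m * a) (ϖ ^ n * b) (by
      rw [hf, hg, map_mul, map_mul]
      exact mul_le_mul_right hfg _)
    rw [hf, hg, map_mul, map_mul, map_pow] at h1
    exact le_of_mul_le_mul_left h1 (pow_pos (zero_lt_iff.2 hu0) _)
  refine fun f g => ⟨fun hfg => ?_, step₂ f g⟩
  by_contra! hlt
  have hf0 : 0 < w f := pos_of_gt hlt
  have hvf : v f ≠ 0 := by
    obtain ⟨m, hm⟩ := exists_pow_lt_of_lt_one hf0 (NNReal.half_lt_self one_ne_zero)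
    have h1 := step₂ (Loc.unif C ϖ ^ m) f (by rw [map_pow, hw.map_unif]; exact hm.le)
    rw [map_pow] at h1
    exact ((pow_pos (zero_lt_iff.2 hu0) m).trans_le h1).ne'
  -- If `w g < w f`, then `w (gᵏ) < w (ϖ fᵏ)` for some `k` because `w` is real-valued. Transferring
  -- this to `v` gives `v g < v f`.
  obtain ⟨k, hk⟩ := exists_pow_lt_of_lt_one (show (0 : ℝ≥0) < 1 / 2 by positivity)
    ((div_lt_one hf0).2 hlt)
  rw [div_pow, div_lt_iff₀ (pow_pos hf0 k), ← hw.map_unif, ← map_pow, ← map_pow, ← map_mul] at hk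
  have h1 := step₂ _ _ hk.le
  rw [map_pow, map_mul, map_pow] at h1
  have h2 : v (Loc.unif C ϖ) * v f ^ k < v f ^ k :=
    mul_lt_of_lt_one_left (pow_pos (zero_lt_iff.2 hvf) k) hu1
  exact (h1.trans_lt h2).not_ge (pow_le_pow_left₀ zero_le hfg k)

theorem IsRealPoint.exists_forall_lt {C : Type*} [CommRing C] {ϖ : C}
    {ψ : MulRingSeminorm (Loc C ϖ)} (hψ : IsRealPoint ψ) {ε : ℝ} (hε : 0 < ε) (b : Loc C ϖ) :
    ∃ n : ℕ, ∀ c, ψ (Loc.unif C ϖ ^ n * algebraMap C _ c * b) < ε := by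
  obtain ⟨n, hn⟩ := exists_pow_lt_of_lt_one (div_pos hε (by positivity : 0 < ψ b + 1))
    (by norm_num : (1 / 2 : ℝ) < 1)
  rw [lt_div_iff₀ (by positivity)] at hn
  refine ⟨n, fun c => lt_of_le_of_lt ?_ hn⟩
  rw [map_mul, map_mul, map_pow, hψ.map_unif, mul_assoc]
  refine mul_le_mul_of_nonneg_left ?_ (by positivity)
  exact (mul_le_of_le_one_left (apply_nonneg ψ b) (hψ.le_one c)).trans (by linarith)

/-- A real point lying over a minimal prime of `ϖ` is given by the generic valuation. -/
theorem IsRealPoint.eq_of_center_eq {C : Type*} [CommRing C] {ϖ : C} {p : Ideal C}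
    {ψ : MulRingSeminorm (Loc C ϖ)} (hψ : IsRealPoint ψ) (hp : hψ.center = p)
    {w : Valuation (Loc C ϖ) ℝ≥0} (hw : IsGenericValuation ϖ p w) :
    ψ = w.toMulRingSeminorm := by
  have hequiv : hψ.valuation.IsEquiv w := by
    refine hw.isEquiv (fun c => hψ.le_one c) (fun c => by rw [← hp]; exact Iff.rfl) fun γ hγ => ?_
    obtain ⟨n, hn⟩ := hψ.exists_forall_lt (ε := γ) (by positivity) 1
    exact ⟨n, fun c => by
      have h1 := hn c
      rw [mul_one] at h1
      exact h1⟩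
  have hw' := hw.isRealPoint
  set χ := w.toMulRingSeminorm
  have hχ : ∀ f g, ψ f ≤ ψ g ↔ χ f ≤ χ g := fun f g => hequiv f g
  ext f
  obtain ⟨m, c, hc⟩ := Loc.exists_unif_pow_mul_eq f
  -- Equivalent real valuations with the same value at `ϖ` compare in the same way with powers of `1
  -- / 2`, and hence coincide.
  have hpow : ∀ k n : ℕ, ψ (algebraMap C _ c) ^ k ≤ (1 / 2) ^ n ↔
      χ (algebraMap C _ c) ^ k ≤ (1 / 2) ^ n := by
    intro k n
    have h1 := hχ (algebraMap C _ c ^ k) (Loc.unif C ϖ ^ n)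
    rwa [map_pow, map_pow, map_pow, map_pow, hψ.map_unif, hw'.map_unif] at h1
  have h1 : ψ (algebraMap C _ c) = χ (algebraMap C _ c) := le_antisymm
    (le_of_pow_le_imp (apply_nonneg _ _) (hw'.le_one c) fun k n => (hpow k n).2)
    (le_of_pow_le_imp (apply_nonneg _ _) (hψ.le_one c) fun k n => (hpow k n).1)
  rw [← hc, map_mul, map_mul, map_pow, map_pow, hψ.map_unif, hw'.map_unif] at h1
  exact mul_left_cancel₀ (by positivity) h1

section Spa

variable {𝒜 : Type*} [CommRing 𝒜] [TopologicalSpace 𝒜] [NonarchimedeanRing 𝒜]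

theorem Spa.ext_vle {x y : Spa 𝒜} (h : ∀ f g, x.1.vle f g ↔ y.1.vle f g) : x = y := by
  have key : ∀ a b : ValuativeRel 𝒜, (∀ f g, a.vle f g ↔ b.vle f g) → a = b := by
    rintro ⟨va⟩ ⟨vb⟩ hab
    obtain rfl : va = vb := funext₂ fun f g => propext (hab f g)
    rfl
  exact Subtype.ext (key _ _ h)

theorem Spa.mem_spc (x : Spa 𝒜) (f : powerBounded 𝒜) : f ∈ x.spc ↔ ¬ x.1.vle 1 f := by
  let _ := x.1
  change ValuativeRel.valuation 𝒜 (f : 𝒜) < 1 ↔ ¬ x.1.vle 1 f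
  rw [Valuation.Compatible.vle_iff_le (v := ValuativeRel.valuation 𝒜), map_one, not_le]

end Spa

/-! ### Fibres of specialization and the Shilov boundary -/

namespace HasGenericValuations

variable {C : Type*} [CommRing C] {ϖ : C} (h : HasGenericValuations ϖ)
include h

omit h in
theorem _root_.Shilov.IsRealPoint.isContinuous {ψ : MulRingSeminorm (Loc C ϖ)}
    (hψ : IsRealPoint ψ) : IsContinuous (ValuativeRel.ofValuation hψ.valuation) := by
  let _ := ValuativeRel.ofValuation hψ.valuation
  have := Valuation.Compatible.ofValuation hψ.valuation
  intro γ hγ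
  let v := ValuativeRel.valuation (Loc C ϖ)
  change IsOpen ((v.ltAddSubgroup (Units.mk0 γ hγ) : AddSubgroup (Loc C ϖ)) : Set (Loc C ϖ))
  refine AddSubgroup.isOpen_of_mem_nhds _ (g := 0) ?_
  obtain ⟨a, b, hab⟩ := ValuativeRel.exists_valuation_div_valuation_eq γ
  have hb0 : v (b : Loc C ϖ) ≠ 0 := ValuativeRel.valuation_posSubmonoid_ne_zero b
  have hlt : ∀ f g : Loc C ϖ, v f < v g ↔ ψ f < ψ g := fun f g => by
    rw [← not_le, ← Valuation.Compatible.vle_iff_le (v := v),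
      Valuation.Compatible.vle_iff_le (v := hψ.valuation), not_le]
    exact Iff.rfl
  have ha0 : 0 < ψ a := by
    rw [← map_zero ψ, ← hlt, map_zero, zero_lt_iff]
    rintro ha
    exact hγ (by rw [← hab, ha, zero_div])
  obtain ⟨n, hn⟩ := hψ.exists_forall_lt ha0 (b : Loc C ϖ)
  refine Filter.mem_of_superset (Loc.hasBasis_nhds_zero.mem_of_mem (i := n) trivial) fun x hx => ?_
  obtain ⟨c, rfl⟩ := Loc.mem_powSubmodule'.1 hx
  have h1 := (hlt _ _).2 (hn c)
  change v _ < γ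
  rw [← hab, lt_div_iff₀ (zero_lt_iff.2 hb0), ← map_mul]
  exact h1

/-- The point of the adic spectrum given by a real point. -/
def toSpa {ψ : MulRingSeminorm (Loc C ϖ)} (hψ : IsRealPoint ψ) : Spa (Loc C ϖ) :=
  ⟨ValuativeRel.ofValuation hψ.valuation, hψ.isContinuous, fun f hf => by
    obtain ⟨c, rfl⟩ := (h.isPowerBounded_iff f).1 hf
    change ψ _ ≤ ψ 1
    rw [map_one]
    exact hψ.le_one c⟩

theorem vle_toSpa {ψ : MulRingSeminorm (Loc C ϖ)} (hψ : IsRealPoint ψ) (f g : Loc C ϖ) :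
    (h.toSpa hψ).1.vle f g ↔ ψ f ≤ ψ g := Iff.rfl

omit h in
theorem _root_.Shilov.IsRealPoint.isRankOne {ψ : MulRingSeminorm (Loc C ϖ)}
    (hψ : IsRealPoint ψ) : IsRankOne (ValuativeRel.ofValuation hψ.valuation) := by
  let _ := ValuativeRel.ofValuation hψ.valuation
  have := Valuation.Compatible.ofValuation hψ.valuation
  have h1 : ValuativeRel.IsNontrivial (Loc C ϖ) := by
    refine (ValuativeRel.isNontrivial_iff_isNontrivial hψ.valuation).2
      ⟨Loc.unif C ϖ, fun h0 => ?_, fun h1 => ?_⟩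
    · have := hψ.map_unif
      rw [← hψ.coe_valuation, h0] at this
      norm_num at this
    · have := hψ.map_unif
      rw [← hψ.coe_valuation, h1] at this
      norm_num at this
  exact ⟨h1, ValuativeRel.IsRankLeOne.of_compatible_mulArchimedean hψ.valuation⟩

theorem comap_spc_toSpa {ψ : MulRingSeminorm (Loc C ϖ)} (hψ : IsRealPoint ψ) :
    (h.toSpa hψ).spc.comap h.equivPowerBounded = hψ.center := by
  ext c
  rw [Ideal.mem_comap, Spa.mem_spc, vle_toSpa, map_one, not_le]
  exact Iff.rfl

theorem mem_spcPreimageGeneric_iff (φ : BerkovichSpectrum (Loc.unif C ϖ)) :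
    φ ∈ spcPreimageGeneric (Loc.unif C ϖ) ↔
      (IsRealPoint.of_berkovichSpectrum φ).center ∈ (Ideal.span {ϖ}).minimalPrimes := by
  set hφ := IsRealPoint.of_berkovichSpectrum φ
  rw [← h.comap_spc_toSpa, ← h.mem_genericPoints_iff]
  constructor
  · rintro ⟨x, hx, hxp⟩
    obtain rfl : x = h.toSpa hφ := Spa.ext_vle fun f g => (hx f g).trans (h.vle_toSpa hφ f g).symm
    exact hxp
  · exact fun hp => ⟨h.toSpa hφ, fun f g => h.vle_toSpa hφ f g, hp⟩

theorem vle_iff_of_comap_spc_eq {p : Ideal C} {w : Valuation (Loc C ϖ) ℝ≥0}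
    (hw : IsGenericValuation ϖ p w) {x : Spa (Loc C ϖ)}
    (hx : x.spc.comap h.equivPowerBounded = p) (f g : Loc C ϖ) :
    x.1.vle f g ↔ w f ≤ w g := by
  let _ := x.1
  rw [Valuation.Compatible.vle_iff_le (v := ValuativeRel.valuation (Loc C ϖ))]
  refine hw.isEquiv (fun c => ?_) (fun c => ?_) (fun γ hγ => ?_) f g
  · rw [← map_one (ValuativeRel.valuation (Loc C ϖ)), ← Valuation.Compatible.vle_iff_le]
    exact x.2.2 _ (h.equivPowerBounded c).2
  · rw [← hx]
    exact Iff.rfl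
  · have h1 : {f | ValuativeRel.valuation (Loc C ϖ) f < γ} ∈ 𝓝 (0 : Loc C ϖ) :=
      (x.2.1 γ hγ).mem_nhds (by
        change ValuativeRel.valuation (Loc C ϖ) 0 < γ
        rw [map_zero]
        exact zero_lt_iff.2 hγ)
    obtain ⟨n, -, hn⟩ := Loc.hasBasis_nhds_zero.mem_iff.1 h1
    exact ⟨n, fun c => hn (Loc.mem_powSubmodule'.2 ⟨c, rfl⟩)⟩

theorem exists_isRankOne_fibre_eq_singleton {P : Ideal (powerBounded (Loc C ϖ))}
    (hP : P ∈ genericPoints (Loc.unif C ϖ)) :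
    ∃ x : Spa (Loc C ϖ), IsRankOne x.1 ∧ {y : Spa (Loc C ϖ) | y.spc = P} = {x} := by
  obtain ⟨w, hw⟩ := h.exists_isGenericValuation _ ((h.mem_genericPoints_iff P).1 hP)
  have hcenter : hw.isRealPoint.center = P.comap h.equivPowerBounded := by
    ext c
    rw [← hw.map_lt_one_iff]
    exact_mod_cast hw.isRealPoint.mem_center c
  have hinj : ∀ I J : Ideal (powerBounded (Loc C ϖ)),
      I.comap h.equivPowerBounded = J.comap h.equivPowerBounded → I = J := fun I J hIJ =>
    Ideal.comap_injective_of_surjective h.equivPowerBounded h.equivPowerBounded.surjective hIJ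
  refine ⟨h.toSpa hw.isRealPoint, hw.isRealPoint.isRankOne, Set.ext fun y => ⟨fun hy => ?_, ?_⟩⟩
  · refine Spa.ext_vle fun f g => ?_
    rw [h.vle_iff_of_comap_spc_eq hw (congrArg _ hy) f g, h.vle_toSpa]
    exact Iff.rfl
  · rintro rfl
    exact hinj _ _ ((h.comap_spc_toSpa hw.isRealPoint).trans hcenter)

/-- The centre of `φ` is disjoint from a test set `W` exactly when `φ s ≥ 1` for all `s ∈ W`, a
closed condition. Finiteness of the test keeps the union closed. -/
theorem isClosed_spcPreimageGeneric : IsClosed (spcPreimageGeneric (Loc.unif C ϖ)) := by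
  obtain ⟨F, hF, H⟩ := h.hasFiniteMinimalityTest
  have : spcPreimageGeneric (Loc.unif C ϖ) =
      ⋃ W ∈ F, ⋂ s ∈ W, {φ | 1 ≤ φ.1 (algebraMap C _ s)} := by
    ext φ
    have hφ := IsRealPoint.of_berkovichSpectrum φ
    rw [h.mem_spcPreimageGeneric_iff, H _ hφ.isPrime_center hφ.mem_center_self]
    simp only [Set.mem_iUnion, Set.mem_iInter, exists_prop]
    refine exists_congr fun W => and_congr_right fun _ => ?_
    rw [Set.disjoint_left]
    refine forall₂_congr fun s _ => ?_
    rw [SetLike.mem_coe, hφ.mem_center, not_lt]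
    exact Iff.rfl
  rw [this]
  exact hF.isClosed_biUnion fun W _ => isClosed_biInter fun s _ =>
    isClosed_le continuous_const (continuous_apply_berkovichSpectrum _)

omit h in
theorem center_index {h : HasGenericValuations ϖ} (i : h.Index) :
    ∃ hi : IsRealPoint i.1.toMulRingSeminorm, hi.center ∈ (Ideal.span {ϖ}).minimalPrimes := by
  obtain ⟨w, p, hp, hw⟩ := i
  refine ⟨hw.isRealPoint, ?_⟩
  convert hp
  ext c
  rw [← hw.map_lt_one_iff]
  exact_mod_cast hw.isRealPoint.mem_center c

theorem exists_mem_spcPreimageGeneric (i : h.Index) :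
    ∃ φ ∈ spcPreimageGeneric (Loc.unif C ϖ), ∀ f, φ.1 f = i.1 f := by
  obtain ⟨hi, hc⟩ := center_index i
  exact ⟨h.ofIsRealPoint hi, (h.mem_spcPreimageGeneric_iff _).2 hc, fun f => rfl⟩

/-- Every point is bounded by the supremum of the generic valuations, and this supremum is attained
because their set is closed in a compact space. -/
theorem isBoundary_spcPreimageGeneric : IsBoundary (spcPreimageGeneric (Loc.unif C ϖ)) := by
  intro f
  have := h.compactSpace
  obtain ⟨i₀⟩ := h.nonempty_index
  obtain ⟨φ₀, hφ₀, -⟩ := h.exists_mem_spcPreimageGeneric i₀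
  obtain ⟨φ, hφ, hmax⟩ := h.isClosed_spcPreimageGeneric.isCompact.exists_isMaxOn ⟨φ₀, hφ₀⟩
    (continuous_apply_berkovichSpectrum f).continuousOn
  refine ⟨φ, hφ, fun ψ => (h.le_supNorm_of_isRealPoint
    (IsRealPoint.of_berkovichSpectrum ψ) f).trans (h.supNorm_le fun i => ?_)⟩
  obtain ⟨χ, hχ, hχi⟩ := h.exists_mem_spcPreimageGeneric i
  rw [← hχi]
  exact hmax hχ

/-- For `s` outside the centre `p` of `φ`, `φ s = 1`, so the boundary `T` contains a point with
value at least `1` at `s`. By compactness one point `ψ ∈ T` works for all such `s`. Its centre lies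
in `p`, equals `p` by minimality, and uniqueness gives `ψ = φ`. -/
theorem spcPreimageGeneric_subset {T : Set (BerkovichSpectrum (Loc.unif C ϖ))} (hT : IsClosed T)
    (hb : IsBoundary T) : spcPreimageGeneric (Loc.unif C ϖ) ⊆ T := by
  intro φ hφ
  have := h.compactSpace
  have hφr := IsRealPoint.of_berkovichSpectrum φ
  rw [h.mem_spcPreimageGeneric_iff] at hφ
  set p := hφr.center with hp
  have hpp : p.IsPrime := hφr.isPrime_center
  obtain ⟨w, hw⟩ := h.exists_isGenericValuation p hφ
  let Z : p.primeCompl → Set (BerkovichSpectrum (Loc.unif C ϖ)) :=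
    fun s => T ∩ {ψ | 1 ≤ ψ.1 (algebraMap C _ (s : C))}
  have hZ : ∀ s, IsClosed (Z s) := fun s =>
    hT.inter (isClosed_le continuous_const (continuous_apply_berkovichSpectrum _))
  have hmono : ∀ s t : p.primeCompl, Z (s * t) ⊆ Z s := by
    rintro s t ψ ⟨hψT, hψ⟩
    have hψr := IsRealPoint.of_berkovichSpectrum ψ
    have hψ' : 1 ≤ ψ.1 (algebraMap C _ ((s * t : p.primeCompl) : C)) := hψ
    refine ⟨hψT, hψ'.trans ?_⟩
    rw [Submonoid.coe_mul, map_mul, map_mul]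
    exact mul_le_of_le_one_right (apply_nonneg _ _) (hψr.le_one _)
  obtain ⟨ψ, hψ⟩ := IsCompact.nonempty_iInter_of_directed_nonempty_isCompact_isClosed Z
    (fun s t => ⟨s * t, hmono s t, by rw [mul_comm]; exact hmono t s⟩)
    (fun s => by
      obtain ⟨ψ, hψT, hψ⟩ := hb (algebraMap C _ (s : C))
      exact ⟨ψ, hψT, ((hφr.notMem_center s).1 s.2).ge.trans (hψ φ)⟩)
    (fun s => (hZ s).isCompact) hZ
  rw [Set.mem_iInter] at hψ
  have hψr := IsRealPoint.of_berkovichSpectrum ψ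
  have hle : hψr.center ≤ p := by
    intro s hs
    by_contra hsp
    have h1 : 1 ≤ ψ.1 (algebraMap C _ s) := (hψ ⟨s, hsp⟩).2
    exact h1.not_gt ((hψr.mem_center s).1 hs)
  have heq : hψr.center = p := le_antisymm hle (hφ.2 ⟨hψr.isPrime_center, by
    rw [Ideal.span_singleton_le_iff_mem]; exact hψr.mem_center_self⟩ hle)
  have : φ = ψ := Subtype.ext
    ((hφr.eq_of_center_eq hp.symm hw).trans (hψr.eq_of_center_eq heq hw).symm)
  rw [this]
  exact (hψ 1).1

theorem isShilovBoundary : IsShilovBoundary (spcPreimageGeneric (Loc.unif C ϖ)) :=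
  ⟨⟨h.isClosed_spcPreimageGeneric, h.isBoundary_spcPreimageGeneric⟩,
    fun _ hT => h.spcPreimageGeneric_subset hT.1 hT.2⟩

theorem strongBerkovichDescription : StrongBerkovichDescription (Loc.unif C ϖ) where
  fibre _ hP := h.exists_isRankOne_fibre_eq_singleton hP
  isShilovBoundary_closure := by
    rw [h.isClosed_spcPreimageGeneric.closure_eq]
    exact h.isShilovBoundary
  isShilovBoundary := h.isShilovBoundary

end HasGenericValuations

/-! ### Application to the absolute integral closure -/

theorem hasGenericValuations_completion (R : Type*) {A : Type*} [CommRing R] [IsNoetherianRing R]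
    [CommRing A] [IsDomain A] [IsIntegrallyClosed A] [Algebra R A] [Algebra.IsIntegral R A]
    {ϖ : A} (hϖ : ϖ ≠ 0) (hϖ' : ¬ IsUnit ϖ) (hfin : HasFiniteMinimalityTest ϖ) :
    HasGenericValuations (algebraMap A (Completion A ϖ) ϖ) where
  mem_nonZeroDivisors := Completion.mem_nonZeroDivisors (mem_nonZeroDivisors_of_ne_zero hϖ)
  not_isUnit := (Completion.isModIso ϖ).not_isUnit hϖ'
  mem_minimalPrimes _ _ hp := (Completion.isModIso ϖ).mem_minimalPrimes_of_comap
    (((Completion.isModIso ϖ).isWeaklyAssociatedPrime_comap hp).mem_minimalPrimes R hϖ)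
  exists_isGenericValuation p hp := by
    have := hp.1.1
    exact exists_isGenericValuation hp (Completion.isModIso _)
      (isPseudoUniformizer_completion R hϖ ((Completion.isModIso ϖ).mem_minimalPrimes_comap hp))
  hasFiniteMinimalityTest := hfin.of_isModIso (Completion.isModIso ϖ)

theorem AbsoluteIntegralClosure.algebraMap_injective (R : Type*) [CommRing R] [IsDomain R] :
    Function.Injective (algebraMap R (AbsoluteIntegralClosure R)) := by
  intro x y hxy
  have h1 : algebraMap R (AlgebraicClosure (FractionRing R)) x = algebraMap R _ y :=
    congrArg Subtype.val hxy
  rw [IsScalarTower.algebraMap_apply R (FractionRing R), IsScalarTower.algebraMap_apply R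
    (FractionRing R)] at h1
  exact IsFractionRing.injective R (FractionRing R) ((algebraMap _ _).injective h1)

instance (R : Type*) [CommRing R] [IsDomain R] :
    IsIntegrallyClosed (AbsoluteIntegralClosure R) := by
  have : Algebra.IsAlgebraic R (AlgebraicClosure (FractionRing R)) :=
    (IsFractionRing.comap_isAlgebraic_iff (K := FractionRing R)).2 inferInstance
  have : IsFractionRing (AbsoluteIntegralClosure R) (AlgebraicClosure (FractionRing R)) :=
    integralClosure.isFractionRing_of_algebraic (fun x hx => by
      rw [IsScalarTower.algebraMap_apply R (FractionRing R)] at hx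
      simpa using hx)
  exact (isIntegrallyClosed_iff_isIntegrallyClosedIn (AlgebraicClosure (FractionRing R))).2
    inferInstance

end Shilov

end

theorem corollary1p14 {R : Type*} [CommRing R] [IsDomain R] [IsNoetherianRing R]
    (ϖ : R) (hϖ : ϖ ≠ 0) (hϖ' : ¬ IsUnit ϖ) :
    Shilov.IsStronglyKrull (Shilov.AbsoluteIntegralClosure R)
        (algebraMap R (Shilov.AbsoluteIntegralClosure R) ϖ) ∧
      Shilov.IsStronglyShilov (Shilov.CompletedAbsoluteIntegralClosure R ϖ)
        (algebraMap R (Shilov.CompletedAbsoluteIntegralClosure R ϖ) ϖ) ∧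
      Shilov.IsTateRing
        (Shilov.Loc (Shilov.CompletedAbsoluteIntegralClosure R ϖ)
          (algebraMap R (Shilov.CompletedAbsoluteIntegralClosure R ϖ) ϖ))
        (Shilov.Loc.unif (Shilov.CompletedAbsoluteIntegralClosure R ϖ)
          (algebraMap R (Shilov.CompletedAbsoluteIntegralClosure R ϖ) ϖ)) ∧
      Shilov.IsUniform
        (Shilov.Loc (Shilov.CompletedAbsoluteIntegralClosure R ϖ)
          (algebraMap R (Shilov.CompletedAbsoluteIntegralClosure R ϖ) ϖ)) ∧
      Shilov.StrongBerkovichDescription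
        (Shilov.Loc.unif (Shilov.CompletedAbsoluteIntegralClosure R ϖ)
          (algebraMap R (Shilov.CompletedAbsoluteIntegralClosure R ϖ) ϖ)) := by
  have hinj := Shilov.AbsoluteIntegralClosure.algebraMap_injective R
  have : FaithfulSMul R (Shilov.AbsoluteIntegralClosure R) :=
    (faithfulSMul_iff_algebraMap_injective _ _).2 hinj
  have h0 : algebraMap R (Shilov.AbsoluteIntegralClosure R) ϖ ≠ 0 :=
    (map_ne_zero_iff _ hinj).2 hϖ
  have h1 : ¬ IsUnit (algebraMap R (Shilov.AbsoluteIntegralClosure R) ϖ) := fun hu =>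
    hϖ' (isUnit_of_map_unit (algebraMap R (Shilov.AbsoluteIntegralClosure R)) ϖ hu)
  have h := Shilov.hasGenericValuations_completion R h0 h1
    (Shilov.hasFiniteMinimalityTest_integralClosure (K := FractionRing R) hϖ)
  exact ⟨Shilov.isStronglyKrull R h0 h1, Shilov.isStronglyShilov_completion R h0 h1,
    Shilov.Loc.isTateRing, h.isUniform, h.strongBerkovichDescription⟩
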